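/- **Setting.** The complexified Lie algebra $\mathfrak g=\mathfrak{spin}(3,1)_{\mathbb C}$ has basis $J_0,J_\pm,K_0,K_\pm$ ($J_\pm=J_1\pm iJ_2$, $K_\pm=K_1\pm iK_2$), where $[J_a,J_b]=i\varepsilon_{abc}J_c$, $[J_a,K_b]=i\varepsilon_{abc}K_c$, $[K_a,K_b]=-i\varepsilon_{abc}J_c$; the maximal compact subgroup of $\mathrm{Spin}(3,1)$ is $K=\mathrm{SU}(2)$. All square roots are principal. For $\lambda\in\frac12\mathbb Z$, $\rho\in\mathbb C$ put $$P^-(j)=\frac{\sqrt{j+\lambda}\sqrt{j-\lambda}\sqrt{j+\rho}\sqrt{j-\rho}}{j\sqrt{2j+1}\sqrt{2j-1}},\quad P^+(j)=P^-(j+1),\quad P(j)=\frac{i\lambda\rho}{j(j+1)}\ (j\ne0),\quad P(0)=0,$$ and $C_\pm(j,m)=\sqrt{j\mp m}\sqrt{j\pm m+1}$. The $(\mathfrak g,K)$-module $V_{\lambda,\rho}$ has the orthonormal (algebraic) basis $|(\lambda,\rho)\,j,m\rangle$, $m\in\{-j,\dots,j\}$, where $j$ runs over $|\lambda|,|\lambda|+1,\dots$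 up to and including the first zero $j_{\max}$ of $P^+$ on this set (over all of it if there is no zero), and (vectors whose labels do not occur being $0$) $$J_0|j,m\rangle=m|j,m\rangle,\qquad J_\pm|j,m\rangle=C_\pm(j,m)|j,m\pm1\rangle,$$ $$K_0|j,m\rangle=P^+(j)\sqrt{j+m+1}\sqrt{j-m+1}\,|j+1,m\rangle+P(j)\,m\,|j,m\rangle+P^-(j)\sqrt{j+m}\sqrt{j-m}\,|j-1,m\rangle,$$ $$K_\pm|j,m\rangle=\mp P^+(j)\sqrt{j\pm m+1}\sqrt{j\pm m+2}\,|j+1,m\pm1\rangle+P(j)C_\pm(j,m)|j,m\pm1\rangle\pm P^-(j)\sqrt{j\mp m}\sqrt{j\mp m-1}\,|j-1,m\pm1\rangle,$$ with $\mathrm{SU}(2)$ acting on each span of fixed $j$ by the spin-$j$ representation integrating the $J$'s. For $A=\pm1$, $F^A_{1/2}$ is the two-dimensional module with basis $|\frac12_A,\pm\frac12\rangle$ on which $\mathrm{SU}(2)$ and the $J$'s act by the spin-$\frac12$ representation and each $K_a$ acts as $iAJ_a$. A *tensor operator* $T:F^A_{1/2}\otimes V_{\lambda,\rho}\to V_{\lambda',\rho'}$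 is a linear map commuting with the actions of $\mathfrak g$ and of $\mathrm{SU}(2)$; its components are $T_\pm v=T(|\frac12_A,\pm\frac12\rangle\otimes v)$. Let $M^A_0=\frac12(J_0-iAK_0)$, $M^A_\pm=\frac12(J_\pm-iAK_\pm)$. **Proposition (Jordan–Schwinger representation for infinite-dimensional Lorentz modules).** There are linear maps $$T^A:F^A_{1/2}\otimes V_{\lambda,\rho}\to V_{\lambda-\frac12,\rho-\frac A2},\qquad \widetilde T^A:F^A_{1/2}\otimes V_{\lambda,\rho}\to V_{\lambda+\frac12,\rho+\frac A2}\qquad(A=\pm1,\ \lambda\in\tfrac12\mathbb Z,\ \rho\in\mathbb C)$$ with the following properties. 1. For every infinite-dimensional $V_{\lambda,\rho}$ they are tensor operators, and their matrix elements (between basis vectors that exist in source and target) are $$\langle j-\tfrac12,m\pm\tfrac12|T^A_\pm|j,m\rangle=\pm\frac{\sqrt{j\mp m}\sqrt{j+\lambda}\sqrt{j+A\rho}}{\sqrt{2j}\sqrt{2j+1}},\qquad \langle j+\tfrac12,m\pm\tfrac12|T^A_\pm|j,m\rangle=iA\frac{\sqrt{j\pm m+1}\sqrt{j-\lambda+1}\sqrt{j-A\rho+1}}{\sqrt{2j+1}\sqrt{2j+2}},$$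 $$\langle j-\tfrac12,m\pm\tfrac12|\widetilde T^A_\pm|j,m\rangle=\mp iA\frac{\sqrt{j\mp m}\sqrt{j-\lambda}\sqrt{j-A\rho}}{\sqrt{2j}\sqrt{2j+1}},\qquad \langle j+\tfrac12,m\pm\tfrac12|\widetilde T^A_\pm|j,m\rangle=\frac{\sqrt{j\pm m+1}\sqrt{j+\lambda+1}\sqrt{j+A\rho+1}}{\sqrt{2j+1}\sqrt{2j+2}},$$ all other matrix elements being zero. 2. If $V_{\lambda,\rho}$ is infinite-dimensional and $\rho^2\neq\lambda^2$, then $V_{\lambda\pm\frac12,\rho\pm\frac A2}$ (same sign in both places) are infinite-dimensional for $A=\pm1$, and on $V_{\lambda,\rho}$ $$M_0^A=-\tfrac12\big(T^A_-\widetilde T^A_++T^A_+\widetilde T^A_-\big),\qquad M^A_\pm=\pm T^A_\pm\widetilde T^A_\pm .$$ 3. For $A,B\in\{\pm1\}$ and $\mu,\nu\in\{+,-\}$, on every infinite-dimensional $V_{\lambda,\rho}$ $$[T^A_+,\widetilde T^B_-]=[\widetilde T^A_+,T^B_-]=\delta^{AB},\qquad [T^A_\mu,T^B_\nu]=[\widetilde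 T^A_\mu,\widetilde T^B_\nu]=[T^A_\mu,\widetilde T^B_\mu]=0,$$ each commutator being asserted whenever the two modules that its two products pass through are infinite-dimensional; by 2 this is always the case when $\rho^2\ne\lambda^2$. -/

import Mathlib

namespace LorentzJS

open scoped TensorProduct Nat

noncomputable section

/-! ### The modules `V_{λ,ρ}`, with `λ = l/2` for an integer `l` and `ρ` complex -/

/-- The half-integer `λ = l/2`. -/
def lam (l : ℤ) : ℝ := (l : ℝ) / 2

/-- A sign `s = ±1` as a real number. -/
def sg (s : ℤˣ) : ℝ := ((s : ℤ) : ℝ)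

/-- `P⁻_{λ,ρ}(j)`; complex square roots are principal ones. -/
def Pminus (l : ℤ) (ρ : ℂ) (j : ℝ) : ℂ :=
  (√(j + lam l) : ℂ) * (√(j - lam l) : ℂ) * Complex.sqrt (j + ρ) * Complex.sqrt (j - ρ) /
    ((j : ℂ) * (√(2 * j + 1) : ℂ) * (√(2 * j - 1) : ℂ))

/-- `P⁺_{λ,ρ}(j) = P⁻_{λ,ρ}(j+1)`. -/
def Pplus (l : ℤ) (ρ : ℂ) (j : ℝ) : ℂ := Pminus l ρ (j + 1)

/-- `P_{λ,ρ}(j)`. -/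
def Pzero (l : ℤ) (ρ : ℂ) (j : ℝ) : ℂ :=
  if j = 0 then 0 else Complex.I * lam l * ρ / ((j : ℂ) * ((j : ℂ) + 1))

/-- The spins `j ∈ |λ| + ℕ₀` occurring in `V_{λ,ρ}`: all those that are not above the first
zero `j_max` of `P⁺_{λ,ρ}` on `|λ| + ℕ₀` (if there is one). -/
def spins (l : ℤ) (ρ : ℂ) : Set ℝ :=
  {j | ∃ n : ℕ, j = |lam l| + n ∧ ∀ k : ℕ, k < n → Pplus l ρ (|lam l| + k) ≠ 0}

/-- `{-j, -j+1, …, j}`. -/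
def weights (j : ℝ) : Set ℝ := {m | ∃ k : ℕ, m = -j + k ∧ m ≤ j}

/-- Labels `(j, m)` of the basis vectors of `V_{λ,ρ}`. -/
abbrev State (l : ℤ) (ρ : ℂ) : Type :=
  {s : ℝ × ℝ // s.1 ∈ spins l ρ ∧ s.2 ∈ weights s.1}

/-- `V_{λ,ρ}`: the algebraic direct sum of the spin-`j` spaces, with basis `|(λ,ρ) j,m⟩`. -/
abbrev V (l : ℤ) (ρ : ℂ) : Type := State l ρ →₀ ℂ

/-- `V_{λ,ρ}` is infinite-dimensional. -/
def InfDim (l : ℤ) (ρ : ℂ) : Prop := ¬ Module.Finite ℂ (V l ρ)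

open Classical in
/-- The basis vector `|(λ,ρ) j,m⟩`, understood as `0` if `(j,m)` is not an allowed label. -/
def ket (l : ℤ) (ρ : ℂ) (j m : ℝ) : V l ρ :=
  if h : j ∈ spins l ρ ∧ m ∈ weights j then Finsupp.single ⟨(j, m), h⟩ 1 else 0

open Classical in
/-- The functional `⟨(λ,ρ) j,m|` for the inner product that makes the basis vectors
orthonormal. -/
def bra (l : ℤ) (ρ : ℂ) (j m : ℝ) : V l ρ →ₗ[ℂ] ℂ :=
  if h : j ∈ spins l ρ ∧ m ∈ weights j then Finsupp.lapply ⟨(j, m), h⟩ else 0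

/-- The linear map with value `f j m` at `|(λ,ρ) j,m⟩`. -/
def onKets {l : ℤ} {ρ : ℂ} {W : Type} [AddCommGroup W] [Module ℂ W] (f : ℝ → ℝ → W) :
    V l ρ →ₗ[ℂ] W :=
  Finsupp.linearCombination ℂ (fun s : State l ρ => f s.1.1 s.1.2)

/-- The coordinates of a vector in the basis labelled by `(j,m)`, forgetting the index
`(λ,ρ)`. It is injective, and it is only used to compare elements of modules whose indices
are equal, such as `V_{(λ+1/2)-1/2, (ρ+A/2)-A/2}` and `V_{λ,ρ}`. -/
def coords (l : ℤ) (ρ : ℂ) : V l ρ →ₗ[ℂ] (ℝ × ℝ →₀ ℂ) :=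
  Finsupp.lmapDomain ℂ ℂ Subtype.val

/-- `C_±(j,m)`. -/
def Cpm (s : ℤˣ) (j m : ℝ) : ℝ := √(j - sg s * m) * √(j + sg s * m + 1)

/-- `J₀` on `V_{λ,ρ}`. -/
def actJ0 (l : ℤ) (ρ : ℂ) : V l ρ →ₗ[ℂ] V l ρ :=
  onKets fun j m => (m : ℂ) • ket l ρ j m

/-- `J_±` on `V_{λ,ρ}`. -/
def actJ (l : ℤ) (ρ : ℂ) (s : ℤˣ) : V l ρ →ₗ[ℂ] V l ρ :=
  onKets fun j m => (Cpm s j m : ℂ) • ket l ρ j (m + sg s)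

/-- `K₀` on `V_{λ,ρ}`. -/
def actK0 (l : ℤ) (ρ : ℂ) : V l ρ →ₗ[ℂ] V l ρ :=
  onKets fun j m =>
    (Pplus l ρ j * (√(j + m + 1) : ℂ) * (√(j - m + 1) : ℂ)) • ket l ρ (j + 1) m
    + (Pzero l ρ j * (m : ℂ)) • ket l ρ j m
    + (Pminus l ρ j * (√(j + m) : ℂ) * (√(j - m) : ℂ)) • ket l ρ (j - 1) m

/-- `K_±` on `V_{λ,ρ}`. -/
def actK (l : ℤ) (ρ : ℂ) (s : ℤˣ) : V l ρ →ₗ[ℂ] V l ρ :=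
  onKets fun j m =>
    (-(sg s : ℂ) * Pplus l ρ j * (√(j + sg s * m + 1) : ℂ) * (√(j + sg s * m + 2) : ℂ)) •
      ket l ρ (j + 1) (m + sg s)
    + (Pzero l ρ j * (Cpm s j m : ℂ)) • ket l ρ j (m + sg s)
    + ((sg s : ℂ) * Pminus l ρ j * (√(j - sg s * m) : ℂ) * (√(j - sg s * m - 1) : ℂ)) •
      ket l ρ (j - 1) (m + sg s)

/-- The basis `J₀, J_±, K₀, K_±` of the complexified Lie algebra of `Spin(3,1)`. -/
inductive Gen : Type
  | J0 : Gen
  | J (s : ℤˣ) : Gen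
  | K0 : Gen
  | K (s : ℤˣ) : Gen

/-- The Lie algebra action on `V_{λ,ρ}`. -/
def act (l : ℤ) (ρ : ℂ) : Gen → (V l ρ →ₗ[ℂ] V l ρ)
  | .J0 => actJ0 l ρ
  | .J s => actJ l ρ s
  | .K0 => actK0 l ρ
  | .K s => actK l ρ s

/-- Matrix elements of the spin-`(p+q)/2` representation of `SU(2)`, realised on homogeneous
polynomials of degree `p + q` in `x, y` by the substitution
`x ↦ k₀₀ x + k₁₀ y`, `y ↦ k₀₁ x + k₁₁ y`, in the orthonormal basis
`|j,m⟩ = x^p y^q / √(p! q!)`, `p = j + m`, `q = j - m`: the coefficient of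
`x^p' y^(p+q-p') / √(p'! (p+q-p')!)` in the image of `x^p y^q / √(p! q!)`
(computed at `y = 1`). -/
def wigner (k : Matrix (Fin 2) (Fin 2) ℂ) (p q p' : ℕ) : ℂ :=
  (√((p' ! : ℝ) * ((p + q - p') ! : ℝ)) / √((p ! : ℝ) * (q ! : ℝ)) : ℝ) *
    ((Polynomial.C (k 0 0) * Polynomial.X + Polynomial.C (k 1 0)) ^ p *
      (Polynomial.C (k 0 1) * Polynomial.X + Polynomial.C (k 1 1)) ^ q).coeff p'

/-- The action of the maximal compact subgroup `SU(2)` on `V_{λ,ρ}`. -/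
def actSU2 (l : ℤ) (ρ : ℂ) (k : Matrix.specialUnitaryGroup (Fin 2) ℂ) :
    V l ρ →ₗ[ℂ] V l ρ :=
  onKets fun j m =>
    ∑ p' ∈ Finset.range (⌊2 * j⌋₊ + 1),
      wigner (k : Matrix (Fin 2) (Fin 2) ℂ) ⌊j + m⌋₊ ⌊j - m⌋₊ p' • ket l ρ j ((p' : ℝ) - j)

/-! ### The two-dimensional modules `F^A_{1/2}` -/

/-- `F^A_{1/2}`; the coordinates `0, 1` belong to `μ = 1/2, -1/2`. -/
abbrev F (_A : ℤˣ) : Type := Fin 2 → ℂ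

/-- The basis vector `|½_A, s/2⟩`. -/
def spinor (A s : ℤˣ) : F A := if s = 1 then ![1, 0] else ![0, 1]

/-- `J_±` in the spin-½ representation. -/
def spinJ (s : ℤˣ) : Matrix (Fin 2) (Fin 2) ℂ :=
  if s = 1 then !![0, 1; 0, 0] else !![0, 0; 1, 0]

/-- `J₀` in the spin-½ representation. -/
def spinJ0 : Matrix (Fin 2) (Fin 2) ℂ := !![1 / 2, 0; 0, -1 / 2]

/-- The Lie algebra action on `F^A_{1/2}`: the `K`'s act as `i A` times the `J`'s. -/
def actF (A : ℤˣ) : Gen → (F A →ₗ[ℂ] F A)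
  | .J0 => Matrix.toLin' spinJ0
  | .J s => Matrix.toLin' (spinJ s)
  | .K0 => (Complex.I * sg A) • Matrix.toLin' spinJ0
  | .K s => (Complex.I * sg A) • Matrix.toLin' (spinJ s)

/-- The `SU(2)` action on `F^A_{1/2}`. -/
def actFSU2 (A : ℤˣ) (k : Matrix.specialUnitaryGroup (Fin 2) ℂ) : F A →ₗ[ℂ] F A :=
  Matrix.toLin' (k : Matrix (Fin 2) (Fin 2) ℂ)

/-! ### Tensor operators -/

/-- `T : F^A_{1/2} ⊗ V_{λ,ρ} → V_{λ',ρ'}` is a tensor operator: it intertwines the actions of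
the Lie algebra (`X(f ⊗ v) = Xf ⊗ v + f ⊗ Xv`) and of `SU(2)` (`k(f ⊗ v) = kf ⊗ kv`). -/
structure IsTensorOperator (A : ℤˣ) {l l' : ℤ} {ρ ρ' : ℂ}
    (T : F A ⊗[ℂ] V l ρ →ₗ[ℂ] V l' ρ') : Prop where
  lie : ∀ X : Gen,
    T ∘ₗ (TensorProduct.map (actF A X) LinearMap.id
      + TensorProduct.map LinearMap.id (act l ρ X)) = act l' ρ' X ∘ₗ T
  grp : ∀ k : Matrix.specialUnitaryGroup (Fin 2) ℂ,
    T ∘ₗ TensorProduct.map (actFSU2 A k) (actSU2 l ρ k) = actSU2 l' ρ' k ∘ₗ T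

/-- The component `T_± v = T(|½_A, ±½⟩ ⊗ v)`. -/
def comp {A : ℤˣ} {l l' : ℤ} {ρ ρ' : ℂ} (T : F A ⊗[ℂ] V l ρ →ₗ[ℂ] V l' ρ') (s : ℤˣ) :
    V l ρ →ₗ[ℂ] V l' ρ' :=
  T ∘ₗ TensorProduct.mk ℂ (F A) (V l ρ) (spinor A s)

/-- `M₀^A = ½ (J₀ - i A K₀)`. -/
def actM0 (l : ℤ) (ρ : ℂ) (A : ℤˣ) : V l ρ →ₗ[ℂ] V l ρ :=
  (1 / 2 : ℂ) • (act l ρ .J0 - (Complex.I * sg A) • act l ρ .K0)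

/-- `M_±^A = ½ (J_± - i A K_±)`. -/
def actM (l : ℤ) (ρ : ℂ) (A s : ℤˣ) : V l ρ →ₗ[ℂ] V l ρ :=
  (1 / 2 : ℂ) • (act l ρ (.J s) - (Complex.I * sg A) • act l ρ (.K s))

/-- The prescribed matrix element `⟨(λ-½,ρ-A/2) j',m'| T^A_± |(λ,ρ) j,m⟩`. -/
def elT (A : ℤˣ) (l : ℤ) (ρ : ℂ) (s : ℤˣ) (j m j' m' : ℝ) : ℂ :=
  if m' = m + sg s / 2 then
    if j' = j - 1 / 2 then
      (sg s : ℂ) * ((√(j - sg s * m) : ℂ) * (√(j + lam l) : ℂ) * Complex.sqrt (j + sg A * ρ)) /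
        ((√(2 * j) : ℂ) * (√(2 * j + 1) : ℂ))
    else if j' = j + 1 / 2 then
      Complex.I * sg A *
        ((√(j + sg s * m + 1) : ℂ) * (√(j - lam l + 1) : ℂ) * Complex.sqrt (j - sg A * ρ + 1)) /
        ((√(2 * j + 1) : ℂ) * (√(2 * j + 2) : ℂ))
    else 0
  else 0

/-- The prescribed matrix element `⟨(λ+½,ρ+A/2) j',m'| T̃^A_± |(λ,ρ) j,m⟩`. -/
def elTt (A : ℤˣ) (l : ℤ) (ρ : ℂ) (s : ℤˣ) (j m j' m' : ℝ) : ℂ :=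
  if m' = m + sg s / 2 then
    if j' = j - 1 / 2 then
      -(sg s : ℂ) * Complex.I * sg A *
        ((√(j - sg s * m) : ℂ) * (√(j - lam l) : ℂ) * Complex.sqrt (j - sg A * ρ)) /
        ((√(2 * j) : ℂ) * (√(2 * j + 1) : ℂ))
    else if j' = j + 1 / 2 then
      (√(j + sg s * m + 1) : ℂ) * (√(j + lam l + 1) : ℂ) * Complex.sqrt (j + sg A * ρ + 1) /
        ((√(2 * j + 1) : ℂ) * (√(2 * j + 2) : ℂ))
    else 0
  else 0

end

end LorentzJS

open LorentzJS
open scoped TensorProduct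

/-
Proof of the Jordan-Schwinger representation: every module embeds into the Fock space of two
oscillators, where the doublet operators and the generators are normally ordered polynomials whose
coefficients are functions of the total occupation number.
-/

namespace LorentzJS

noncomputable section

/-! ### Two bosonic oscillators -/

/-- The Fock space of two oscillators, with orthonormal basis labelled by occupation numbers. -/
abbrev Fock : Type := ℕ × ℕ →₀ ℂ

/-- The state with occupation numbers `p`, `q`. -/
def occ (p q : ℕ) : Fock := Finsupp.single (p, q) 1

/-- The linear map with value `f p q` at `occ p q`. -/
def onOcc {W : Type} [AddCommGroup W] [Module ℂ W] (f : ℕ → ℕ → W) : Fock →ₗ[ℂ] W :=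
  Finsupp.linearCombination ℂ (fun x : ℕ × ℕ => f x.1 x.2)

@[simp] theorem onOcc_occ {W : Type} [AddCommGroup W] [Module ℂ W] (f : ℕ → ℕ → W) (p q : ℕ) :
    onOcc f (occ p q) = f p q := by
  simp [onOcc, occ]

theorem Fock.hom_ext {W : Type} [AddCommGroup W] [Module ℂ W] {f g : Fock →ₗ[ℂ] W}
    (h : ∀ p q, f (occ p q) = g (occ p q)) : f = g := by
  refine Finsupp.lhom_ext' fun x => LinearMap.ext_ring ?_
  exact h x.1 x.2

/-- Creation operators. -/
def cre (s : ℤˣ) : Fock →ₗ[ℂ] Fock :=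
  onOcc fun p q =>
    if s = 1 then (√((p : ℝ) + 1) : ℂ) • occ (p + 1) q else (√((q : ℝ) + 1) : ℂ) • occ p (q + 1)

/-- Annihilation operators. -/
def ann (s : ℤˣ) : Fock →ₗ[ℂ] Fock :=
  onOcc fun p q =>
    if s = 1 then (√(p : ℝ) : ℂ) • occ (p - 1) q else (√(q : ℝ) : ℂ) • occ p (q - 1)

/-- The function `φ` of the total occupation number. -/
def degOp (φ : ℤ → ℂ) : Fock →ₗ[ℂ] Fock := onOcc fun p q => φ (p + q) • occ p q

theorem cre_one_occ (p q : ℕ) : cre 1 (occ p q) = (√((p : ℝ) + 1) : ℂ) • occ (p + 1) q := by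
  simp [cre]

theorem cre_neg_one_occ (p q : ℕ) :
    cre (-1) (occ p q) = (√((q : ℝ) + 1) : ℂ) • occ p (q + 1) := by
  simp [cre]

theorem ann_one_occ (p q : ℕ) : ann 1 (occ p q) = (√(p : ℝ) : ℂ) • occ (p - 1) q := by
  simp [ann]

theorem ann_neg_one_occ (p q : ℕ) : ann (-1) (occ p q) = (√(q : ℝ) : ℂ) • occ p (q - 1) := by
  simp [ann]

theorem degOp_occ (φ : ℤ → ℂ) (p q : ℕ) : degOp φ (occ p q) = φ (p + q) • occ p q := by
  simp [degOp]

theorem ofReal_sqrt_mul_self {x : ℝ} (hx : 0 ≤ x) : (√x : ℂ) * (√x : ℂ) = x := by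
  rw [← Complex.ofReal_mul, Real.mul_self_sqrt hx]

theorem ofReal_sqrt_sq {x : ℝ} (hx : 0 ≤ x) : (√x : ℂ) ^ 2 = x := by
  rw [sq, ofReal_sqrt_mul_self hx]

theorem csqrt_sq (z : ℂ) : Complex.sqrt z ^ 2 = z := by
  simp [Complex.sqrt, ← Complex.cpow_nat_mul]

theorem units_cases {motive : ℤˣ → Prop} (h1 : motive 1) (h2 : motive (-1)) (s : ℤˣ) :
    motive s := by
  rcases Int.units_eq_one_or s with rfl | rfl <;> assumption

theorem cre_comm (s t : ℤˣ) (v : Fock) : cre s (cre t v) = cre t (cre s v) := by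
  suffices h : cre s ∘ₗ cre t = cre t ∘ₗ cre s from LinearMap.congr_fun h v
  refine Fock.hom_ext fun p q => ?_
  induction s using units_cases <;> induction t using units_cases <;>
    simp only [LinearMap.comp_apply, cre_one_occ, cre_neg_one_occ, map_smul, smul_smul, mul_comm]

theorem ann_comm (s t : ℤˣ) (v : Fock) : ann s (ann t v) = ann t (ann s v) := by
  suffices h : ann s ∘ₗ ann t = ann t ∘ₗ ann s from LinearMap.congr_fun h v
  refine Fock.hom_ext fun p q => ?_
  induction s using units_cases <;> induction t using units_cases <;>
    simp only [LinearMap.comp_apply, ann_one_occ, ann_neg_one_occ, map_smul, smul_smul, mul_comm]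

/-- The occupation number of oscillator `s` in `occ p q`. -/
def num (s : ℤˣ) (p q : ℕ) : ℂ := if s = 1 then p else q

theorem num_add_num (s : ℤˣ) (p q : ℕ) : num s p q + num (-s) p q = p + q := by
  induction s using units_cases <;> simp [num, add_comm]

theorem cre_ann_occ (s : ℤˣ) (p q : ℕ) : cre s (ann s (occ p q)) = num s p q • occ p q := by
  induction s using units_cases
  · rcases p with _ | p
    · simp [ann_one_occ, num]
    · rw [ann_one_occ, map_smul, Nat.add_sub_cancel, cre_one_occ, smul_smul, Nat.cast_add,
        Nat.cast_one, ofReal_sqrt_mul_self (by positivity)]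
      simp [num]
  · rcases q with _ | q
    · simp [ann_neg_one_occ, num]
    · rw [ann_neg_one_occ, map_smul, Nat.add_sub_cancel, cre_neg_one_occ, smul_smul, Nat.cast_add,
        Nat.cast_one, ofReal_sqrt_mul_self (by positivity)]
      simp [num]

theorem ann_occ_eq_zero {s : ℤˣ} {p q : ℕ} (h : num s p q = 0) : ann s (occ p q) = 0 := by
  revert h
  induction s using units_cases <;> simp +contextual [num, ann_one_occ, ann_neg_one_occ]

theorem ann_cre_self (s : ℤˣ) (v : Fock) : ann s (cre s v) = cre s (ann s v) + v := by
  suffices h : ann s ∘ₗ cre s = cre s ∘ₗ ann s + LinearMap.id from LinearMap.congr_fun h v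
  refine Fock.hom_ext fun p q => ?_
  simp only [LinearMap.comp_apply, LinearMap.add_apply, LinearMap.id_apply, cre_ann_occ]
  induction s using units_cases
  · rw [cre_one_occ, map_smul, ann_one_occ, Nat.add_sub_cancel, smul_smul, Nat.cast_add,
        Nat.cast_one, ofReal_sqrt_mul_self (by positivity)]
    simp [num, add_smul]
  · rw [cre_neg_one_occ, map_smul, ann_neg_one_occ, Nat.add_sub_cancel, smul_smul, Nat.cast_add,
        Nat.cast_one, ofReal_sqrt_mul_self (by positivity)]
    simp [num, add_smul]

theorem ann_neg_cre (s : ℤˣ) (v : Fock) : ann (-s) (cre s v) = cre s (ann (-s) v) := by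
  suffices h : ann (-s) ∘ₗ cre s = cre s ∘ₗ ann (-s) from LinearMap.congr_fun h v
  refine Fock.hom_ext fun p q => ?_
  induction s using units_cases <;>
    simp only [LinearMap.comp_apply, cre_one_occ, cre_neg_one_occ, ann_one_occ, ann_neg_one_occ,
      map_smul, smul_smul, mul_comm, neg_neg]

/-- `v` is homogeneous of degree `n`. -/
def HasDeg (n : ℤ) (v : Fock) : Prop := ∀ φ : ℤ → ℂ, degOp φ v = φ n • v

theorem hasDeg_occ (p q : ℕ) : HasDeg (p + q) (occ p q) := fun φ => degOp_occ φ p q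

theorem HasDeg.smul {n : ℤ} {v : Fock} (h : HasDeg n v) (c : ℂ) : HasDeg n (c • v) := fun φ => by
  rw [map_smul, h φ, smul_comm]

theorem HasDeg.add {n : ℤ} {v w : Fock} (h : HasDeg n v) (h' : HasDeg n w) :
    HasDeg n (v + w) := fun φ => by
  rw [map_add, h φ, h' φ, smul_add]

theorem degOp_cre (φ : ℤ → ℂ) (s : ℤˣ) (v : Fock) :
    degOp φ (cre s v) = cre s (degOp (fun n => φ (n + 1)) v) := by
  suffices h : degOp φ ∘ₗ cre s = cre s ∘ₗ degOp (fun n => φ (n + 1)) from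
    LinearMap.congr_fun h v
  refine Fock.hom_ext fun p q => ?_
  induction s using units_cases <;>
    simp only [LinearMap.comp_apply, cre_one_occ, cre_neg_one_occ, degOp_occ, map_smul, smul_smul,
      Nat.cast_add, Nat.cast_one, mul_comm, add_assoc, add_comm, add_left_comm]

theorem degOp_ann (φ : ℤ → ℂ) (s : ℤˣ) (v : Fock) :
    degOp φ (ann s v) = ann s (degOp (fun n => φ (n - 1)) v) := by
  suffices h : degOp φ ∘ₗ ann s = ann s ∘ₗ degOp (fun n => φ (n - 1)) from
    LinearMap.congr_fun h v
  refine Fock.hom_ext fun p q => ?_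
  induction s using units_cases
  · rcases p with _ | p
    · simp [ann_one_occ, degOp_occ]
    · simp only [LinearMap.comp_apply, ann_one_occ, degOp_occ, map_smul, smul_smul,
        Nat.add_sub_cancel]
      rw [mul_comm]; congr 3; push_cast; ring
  · rcases q with _ | q
    · simp [ann_neg_one_occ, degOp_occ]
    · simp only [LinearMap.comp_apply, ann_neg_one_occ, degOp_occ, map_smul, smul_smul,
        Nat.add_sub_cancel]
      rw [mul_comm]; congr 3; push_cast; ring

theorem HasDeg.cre {n : ℤ} {v : Fock} (h : HasDeg n v) (s : ℤˣ) : HasDeg (n + 1) (cre s v) :=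
  fun φ => by rw [degOp_cre, h, map_smul]

theorem HasDeg.ann {n : ℤ} {v : Fock} (h : HasDeg n v) (s : ℤˣ) : HasDeg (n - 1) (ann s v) :=
  fun φ => by rw [degOp_ann, h, map_smul]

/-! ### Generators on the Fock space -/

/-- The doublet operator `f(N) a†_s + s g(N) a_{-s}`, with `f`, `g` evaluated at the source. -/
def dbl (f g : ℤ → ℂ) (s : ℤˣ) : Fock →ₗ[ℂ] Fock :=
  cre s ∘ₗ degOp f + (sg s : ℂ) • ann (-s) ∘ₗ degOp g

/-- Schwinger's `J₀`. -/
def fJ0 : Fock →ₗ[ℂ] Fock := (1 / 2 : ℂ) • (cre 1 ∘ₗ ann 1 - cre (-1) ∘ₗ ann (-1))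

/-- Schwinger's `J_±`. -/
def fJ (s : ℤˣ) : Fock →ₗ[ℂ] Fock := cre s ∘ₗ ann (-s)

/-- `K₀` with coefficient functions `P⁺, P, P⁻`. -/
def fK0 (u z d : ℤ → ℂ) : Fock →ₗ[ℂ] Fock :=
  cre 1 ∘ₗ cre (-1) ∘ₗ degOp u + fJ0 ∘ₗ degOp z + ann 1 ∘ₗ ann (-1) ∘ₗ degOp d

/-- `K_±` with coefficient functions `P⁺, P, P⁻`. -/
def fK (u z d : ℤ → ℂ) (s : ℤˣ) : Fock →ₗ[ℂ] Fock :=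
  (-(sg s) : ℂ) • cre s ∘ₗ cre s ∘ₗ degOp u + fJ s ∘ₗ degOp z
    + (sg s : ℂ) • ann (-s) ∘ₗ ann (-s) ∘ₗ degOp d

@[simp] theorem sg_one : sg 1 = 1 := by simp [sg]

@[simp] theorem sg_neg (s : ℤˣ) : sg (-s) = -sg s := by simp [sg]

theorem sg_sq (s : ℤˣ) : (sg s : ℂ) ^ 2 = 1 := by
  induction s using units_cases <;> simp

theorem sg_sq_real (s : ℤˣ) : sg s ^ 2 = 1 := by
  induction s using units_cases <;> simp

theorem fJ0_apply (s : ℤˣ) (v : Fock) :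
    fJ0 v = (sg s / 2 : ℂ) • (cre s (ann s v) - cre (-s) (ann (-s) v)) := by
  induction s using units_cases
  · simp [fJ0]
  · simp only [fJ0, LinearMap.smul_apply, LinearMap.sub_apply, LinearMap.comp_apply, sg_neg,
      sg_one, neg_neg]
    push_cast
    module

theorem fK0_apply (s : ℤˣ) {u z d : ℤ → ℂ} {n : ℤ} {v : Fock} (h : HasDeg n v) :
    fK0 u z d v = u n • cre s (cre (-s) v) + z n • fJ0 v + d n • ann s (ann (-s) v) := by
  have : fK0 u z d v = u n • cre 1 (cre (-1) v) + z n • fJ0 v + d n • ann 1 (ann (-1) v) := by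
    simp only [fK0, LinearMap.add_apply, LinearMap.comp_apply, h u, h z, h d, map_smul]
  rw [this]
  induction s using units_cases
  · rfl
  · rw [neg_neg, cre_comm, ann_comm]

theorem fK_apply (s : ℤˣ) {u z d : ℤ → ℂ} {n : ℤ} {v : Fock} (h : HasDeg n v) :
    fK u z d s v = (-(sg s) * u n : ℂ) • cre s (cre s v) + z n • fJ s v
      + (sg s * d n : ℂ) • ann (-s) (ann (-s) v) := by
  simp only [fK, LinearMap.add_apply, LinearMap.smul_apply, LinearMap.comp_apply, h u, h z, h d,
    map_smul, smul_smul]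

theorem dbl_apply {f g : ℤ → ℂ} (s : ℤˣ) {n : ℤ} {v : Fock} (h : HasDeg n v) :
    dbl f g s v = f n • cre s v + (sg s * g n : ℂ) • ann (-s) v := by
  simp only [dbl, LinearMap.add_apply, LinearMap.smul_apply, LinearMap.comp_apply, h f, h g,
    map_smul, smul_smul]

theorem fJ_apply (s : ℤˣ) (v : Fock) : fJ s v = cre s (ann (-s) v) := rfl

theorem HasDeg.fJ {n : ℤ} {v : Fock} (h : HasDeg n v) (s : ℤˣ) : HasDeg n (fJ s v) := by
  simpa [LorentzJS.fJ_apply] using (h.ann (-s)).cre s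

theorem HasDeg.fJ0 {n : ℤ} {v : Fock} (h : HasDeg n v) : HasDeg n (fJ0 v) := by
  have h1 : HasDeg n (LorentzJS.cre 1 (LorentzJS.ann 1 v)) := by simpa using (h.ann 1).cre 1
  have h2 : HasDeg n (LorentzJS.cre (-1) (LorentzJS.ann (-1) v)) := by
    simpa using (h.ann (-1)).cre (-1)
  have := (h1.add (h2.smul (-1))).smul (1 / 2)
  simpa [LorentzJS.fJ0, sub_eq_add_neg] using this

/-- `K_s = -s [J_s, K₀]`. -/
theorem fK_eq_commutator (u z d : ℤ → ℂ) (s : ℤˣ) (v : Fock) :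
    fK u z d s v = (-(sg s) : ℂ) • (fJ s (fK0 u z d v) - fK0 u z d (fJ s v)) := by
  suffices h : fK u z d s = (-(sg s) : ℂ) • (fJ s ∘ₗ fK0 u z d - fK0 u z d ∘ₗ fJ s) from
    LinearMap.congr_fun h v
  refine Fock.hom_ext fun p q => ?_
  have h := hasDeg_occ p q
  generalize occ p q = v at h
  simp only [LinearMap.smul_apply, LinearMap.sub_apply, LinearMap.comp_apply, fK_apply s h,
    fK0_apply s h, fK0_apply s (h.fJ s)]
  simp only [fJ0_apply s, fJ_apply, map_add, map_sub, map_smul,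
    ann_cre_self, ann_neg_cre, ann_comm s (-s), cre_comm (-s) s]
  have := sg_sq s
  match_scalars <;> grind

/-! ### Products of doublet operators -/

theorem dbl_dbl_apply {f g f' g' : ℤ → ℂ} (s t : ℤˣ) {n : ℤ} {v : Fock} (h : HasDeg n v) :
    dbl f' g' s (dbl f g t v) = (f n * f' (n + 1)) • cre s (cre t v)
      + (sg s * (f n * g' (n + 1)) : ℂ) • ann (-s) (cre t v)
      + (sg t * (g n * f' (n - 1)) : ℂ) • cre s (ann (-t) v)
      + (sg s * sg t * (g n * g' (n - 1)) : ℂ) • ann (-s) (ann (-t) v) := by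
  rw [dbl_apply t h, map_add, map_smul, map_smul, dbl_apply s (h.cre t), dbl_apply s (h.ann (-t))]
  module

theorem cre_ann_occ_eq_zero {p q : ℕ} (h : p + q = 0) (s t : ℤˣ) :
    cre s (ann t (occ p q)) = 0 := by
  obtain ⟨rfl, rfl⟩ : p = 0 ∧ q = 0 := by omega
  rw [ann_occ_eq_zero (by simp [num]), map_zero]

/-- The commutator of two doublet operators, in terms of their coefficient functions. -/
theorem dbl_commutator {f g f₂ g₂ f' g' f₂' g₂' : ℤ → ℂ} {κ : ℂ} {p q : ℕ} {n : ℤ}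
    (hn : n = p + q)
    (hxx : f' n * f₂ (n + 1) = f n * f₂' (n + 1))
    (hdd : g' n * g₂ (n - 1) = g n * g₂' (n - 1))
    (hγ : n ≠ 0 → f' n * g₂ (n + 1) - g n * f₂' (n - 1) = f n * g₂' (n + 1) - g' n * f₂ (n - 1))
    (hκ : n * (f' n * g₂ (n + 1) - g n * f₂' (n - 1)) + f' n * g₂ (n + 1) + f n * g₂' (n + 1) = κ)
    (s t : ℤˣ) :
    dbl f₂ g₂ s (dbl f' g' t (occ p q)) - dbl f₂' g₂' t (dbl f g s (occ p q)) =
      (if t = -s then sg s * κ else 0) • occ p q := by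
  have h : HasDeg n (occ p q) := hn ▸ hasDeg_occ p q
  have h0 : n = 0 → ∀ s t, cre s (ann t (occ p q)) = 0 := fun h0 =>
    cre_ann_occ_eq_zero (by omega)
  rw [dbl_dbl_apply s t h, dbl_dbl_apply t s h]
  have hs := sg_sq s
  obtain rfl | rfl : t = s ∨ t = -s := by
    induction s using units_cases <;> induction t using units_cases <;> simp
  · have hne : t ≠ -t := by induction t using units_cases <;> decide
    simp only [hne, if_false, zero_smul, ann_neg_cre]
    by_cases hn0 : n = 0
    · simp only [h0 hn0]
      match_scalars <;> grind
    · have := hγ hn0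
      match_scalars <;> grind
  · have e1 := cre_ann_occ s p q
    have e2 := cre_ann_occ (-s) p q
    have e3 : num s p q + num (-s) p q = n := by rw [num_add_num, hn]; push_cast; rfl
    simp only [if_true, neg_neg, ann_cre_self, cre_comm (-s) s, ann_comm (-s) s, sg_neg, e1, e2]
    push_cast
    by_cases hn0 : n = 0
    · have e1' : num s p q • occ p q = 0 := by rw [← e1, h0 hn0]
      have e2' : num (-s) p q • occ p q = 0 := by rw [← e2, h0 hn0]
      have hnc : (n : ℂ) = 0 := by simp [hn0]
      rw [hnc] at hκ
      rw [e1', e2']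
      match_scalars <;> grind
    · have := hγ hn0
      match_scalars <;> grind

/-- Condition for `½ (J - κ K)` to be a product of two doublet operators. -/
structure Factors (κ k : ℂ) (f g f' g' u z d : ℤ → ℂ) (n : ℤ) : Prop where
  up : k * (f n * f' (n + 1)) = κ / 2 * u n
  down : k * (g n * g' (n - 1)) = -κ / 2 * d n
  mid : n ≠ 0 → k * (f n * g' (n + 1) + g n * f' (n - 1)) = (1 - κ * z n) / 2

theorem Factors.fK {κ k : ℂ} {f g f' g' u z d : ℤ → ℂ} {n : ℤ} {p q : ℕ}
    (H : Factors κ k f g f' g' u z d n) (hn : n = p + q) (s : ℤˣ) :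
    (1 / 2 : ℂ) • (fJ s (occ p q) - κ • fK u z d s (occ p q)) =
      (sg s * k : ℂ) • dbl f' g' s (dbl f g s (occ p q)) := by
  have h : HasDeg n (occ p q) := hn ▸ hasDeg_occ p q
  have h0 : n = 0 → ∀ s t, cre s (ann t (occ p q)) = 0 := fun h0 =>
    cre_ann_occ_eq_zero (by omega)
  rw [dbl_dbl_apply s s h, fK_apply s h]
  have hs := sg_sq s
  obtain ⟨h1, h2, h3⟩ := H
  simp only [fJ_apply, ann_neg_cre]
  by_cases hn0 : n = 0
  · simp only [h0 hn0]
    match_scalars <;> grind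
  · have := h3 hn0
    match_scalars <;> grind

theorem Factors.fK0 {κ k : ℂ} {f g f' g' u z d : ℤ → ℂ} {n : ℤ} {p q : ℕ}
    (H : Factors κ k f g f' g' u z d n) (hn : n = p + q) :
    (1 / 2 : ℂ) • (fJ0 (occ p q) - κ • fK0 u z d (occ p q)) =
      (-(1 / 2) * k : ℂ) • (dbl f' g' (-1) (dbl f g 1 (occ p q))
        + dbl f' g' 1 (dbl f g (-1) (occ p q))) := by
  have h : HasDeg n (occ p q) := hn ▸ hasDeg_occ p q
  have h0 : n = 0 → ∀ s t, cre s (ann t (occ p q)) = 0 := fun h0 =>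
    cre_ann_occ_eq_zero (by omega)
  rw [dbl_dbl_apply _ _ h, dbl_dbl_apply _ _ h, fK0_apply 1 h]
  obtain ⟨h1, h2, h3⟩ := H
  simp only [fJ0_apply 1, neg_neg, ann_cre_self, cre_comm (-1) 1, ann_comm (-1) 1, sg_neg, sg_one]
  push_cast
  by_cases hn0 : n = 0
  · simp only [h0 hn0]
    match_scalars <;> grind
  · have := h3 hn0
    match_scalars <;> grind

/-! ### Doublet operators and the generators -/

theorem fJ0_dbl (f g : ℤ → ℂ) (s : ℤˣ) (v : Fock) :
    fJ0 (dbl f g s v) = dbl f g s (fJ0 v) + (sg s / 2 : ℂ) • dbl f g s v := by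
  suffices h : fJ0 ∘ₗ dbl f g s = dbl f g s ∘ₗ fJ0 + (sg s / 2 : ℂ) • dbl f g s from
    LinearMap.congr_fun h v
  refine Fock.hom_ext fun p q => ?_
  have h := hasDeg_occ p q
  generalize occ p q = v at h
  simp only [LinearMap.smul_apply, LinearMap.add_apply, LinearMap.comp_apply,
    dbl_apply s h, dbl_apply s h.fJ0]
  simp only [fJ0_apply s, map_add, map_sub, map_smul, ann_cre_self, ann_neg_cre,
    cre_comm (-s) s, ann_comm (-s) s]
  match_scalars <;> grind

theorem fJ_dbl (f g : ℤ → ℂ) (s t : ℤˣ) (v : Fock) :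
    fJ t (dbl f g s v) = dbl f g s (fJ t v) + if t = -s then dbl f g t v else 0 := by
  suffices h : fJ t ∘ₗ dbl f g s = dbl f g s ∘ₗ fJ t + if t = -s then dbl f g t else 0 by
    have := LinearMap.congr_fun h v
    split_ifs at this ⊢ <;> simpa using this
  refine Fock.hom_ext fun p q => ?_
  have h := hasDeg_occ p q
  generalize occ p q = v at h
  obtain rfl | rfl : t = s ∨ t = -s := by
    induction s using units_cases <;> induction t using units_cases <;> simp
  · have hne : t ≠ -t := by induction t using units_cases <;> decide
    simp only [hne, if_false, LinearMap.add_apply, LinearMap.comp_apply, LinearMap.zero_apply,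
      dbl_apply t h, dbl_apply t (h.fJ t)]
    simp only [fJ_apply, map_add, map_smul, ann_neg_cre]
    module
  · simp only [if_true, LinearMap.add_apply, LinearMap.comp_apply,
      dbl_apply s h, dbl_apply (-s) h, dbl_apply s (h.fJ (-s))]
    simp only [fJ_apply, map_add, map_smul, neg_neg, ann_cre_self, cre_comm (-s) s,
      ann_comm (-s) s, sg_neg]
    push_cast
    module

/-- Condition for the doublet operator with coefficient functions `f`, `g` to intertwine `K₀`. -/
structure Intertwines (κ : ℂ) (f g u z d u' z' d' : ℤ → ℂ) (n : ℤ) : Prop where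
  up : u n * f (n + 2) = f n * u' (n + 1)
  down : d n * g (n - 2) = g n * d' (n - 1)
  midUp : ∀ x y : ℕ, n = x + y →
    u n * g (n + 2) * (1 + y) + z n * f n * (x - y) / 2 + κ / 2 * f n =
      f n * z' (n + 1) * (x - y + 1) / 2 + g n * u' (n - 1) * y
  midDown : ∀ x y : ℕ, n = x + y → y ≠ 0 →
    d n * f (n - 2) * x + z n * g n * (x - y) / 2 + κ / 2 * g n =
      f n * d' (n + 1) * (1 + x) + g n * z' (n - 1) * (x - y + 1) / 2

theorem Intertwines.fK0_dbl {κ : ℂ} {f g u z d u' z' d' : ℤ → ℂ} {n : ℤ} {p q : ℕ}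
    (H : Intertwines κ f g u z d u' z' d' n) (hn : n = p + q) (s : ℤˣ) :
    fK0 u' z' d' (dbl f g s (occ p q)) =
      dbl f g s (fK0 u z d (occ p q)) + (κ * (sg s / 2) : ℂ) • dbl f g s (occ p q) := by
  have h : HasDeg n (occ p q) := hn ▸ hasDeg_occ p q
  obtain ⟨h1, h2, h3, h4⟩ := H
  obtain ⟨x, y, hx, hy, hxy⟩ : ∃ x y : ℕ, num s p q = x ∧ num (-s) p q = y ∧ n = x + y := by
    induction s using units_cases
    · exact ⟨p, q, by simp [num], by simp [num], hn⟩
    · exact ⟨q, p, by simp [num], by simp [num], by omega⟩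
  have e1 := cre_ann_occ s p q
  have e2 := cre_ann_occ (-s) p q
  have e0 : y = 0 → ann (-s) (occ p q) = 0 := fun h => ann_occ_eq_zero (by simp [hy, h])
  rw [hx] at e1
  rw [hy] at e2
  replace h3 := h3 x y hxy
  replace h4 := h4 x y hxy
  generalize occ p q = v at *
  have hs := sg_sq s
  simp only [dbl_apply s h, map_add, map_smul, fK0_apply s h, fK0_apply s (h.cre s),
    fK0_apply s (h.ann (-s)), dbl_apply s ((h.cre (-s)).cre s), dbl_apply s h.fJ0,
    dbl_apply s ((h.ann (-s)).ann s)]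
  have k1 : n + 1 + 1 = n + 2 := by ring
  have k2 : n - 1 - 1 = n - 2 := by ring
  have c1 : ann s (ann (-s) (cre s v)) = (1 + x : ℂ) • ann (-s) v := by
    rw [ann_neg_cre, ann_cre_self, ann_comm, ← ann_neg_cre, e1, map_smul]; module
  have c2 : cre s (ann s (ann (-s) v)) = (x : ℂ) • ann (-s) v := by
    rw [ann_comm, ← ann_neg_cre, e1, map_smul]
  have c3 : cre s (cre (-s) (ann (-s) v)) = (y : ℂ) • cre s v := by
    rw [e2, map_smul]
  have c4 : ann (-s) (cre s (cre (-s) v)) = (1 + y : ℂ) • cre s v := by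
    rw [ann_neg_cre, ann_cre_self, e2, map_add, map_smul]; module
  have c5 : fJ0 v = (sg s / 2 * (x - y) : ℂ) • v := by
    rw [fJ0_apply s, e1, e2]; module
  have c6 : fJ0 (cre s v) = (sg s / 2 * (x - y + 1) : ℂ) • cre s v := by
    rw [fJ0_apply s, ann_cre_self, ann_neg_cre, map_add, e1, cre_comm (-s), e2, map_smul, map_smul]
    module
  have c7 : fJ0 (ann (-s) v) = (sg s / 2 * (x - y + 1) : ℂ) • ann (-s) v := by
    have : cre (-s) (ann (-s) (ann (-s) v)) = (y - 1 : ℂ) • ann (-s) v := by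
      rw [← sub_eq_iff_eq_add.2 (ann_cre_self (-s) (ann (-s) v)), e2, map_smul]; module
    rw [fJ0_apply s, c2, this]
    module
  simp only [k1, k2, c1, c2, c3, c4, c5, c6, c7, cre_comm (-s) s, ann_comm (-s) s, map_smul]
  rcases Nat.eq_zero_or_pos y with hy0 | hy0
  · simp only [e0 hy0, map_zero, smul_zero]
    match_scalars <;> grind
  · have := h4 hy0.ne'
    match_scalars <;> grind

/-! ### Comparison of `V_{λ,ρ}` with the Fock space -/

theorem onKets_ket {l : ℤ} {ρ : ℂ} {W : Type} [AddCommGroup W] [Module ℂ W] (f : ℝ → ℝ → W)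
    {j m : ℝ} (hj : j ∈ spins l ρ) (hm : m ∈ weights j) :
    onKets f (ket l ρ j m) = f j m := by
  simp [onKets, ket, hj, hm]

theorem mem_weights (p q : ℕ) : ((p : ℝ) - q) / 2 ∈ weights (((p : ℝ) + q) / 2) :=
  ⟨p, by ring, by have : (0 : ℝ) ≤ q := q.cast_nonneg; linarith⟩

theorem exists_occupation {l : ℤ} {ρ : ℂ} {j m : ℝ} (hj : j ∈ spins l ρ) (hm : m ∈ weights j) :
    ∃ p q : ℕ, j = ((p : ℝ) + q) / 2 ∧ m = ((p : ℝ) - q) / 2 := by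
  obtain ⟨n, hn, -⟩ := hj
  obtain ⟨k, hk, hkj⟩ := hm
  have h2 : 2 * j = (l.natAbs + 2 * n : ℕ) := by
    have : |lam l| = (l.natAbs : ℝ) / 2 := by
      rw [lam, abs_div, abs_two, Nat.cast_natAbs, Int.cast_abs]
    rw [hn, this]; push_cast; ring
  have hle : k ≤ l.natAbs + 2 * n := by
    have : (k : ℝ) ≤ (l.natAbs + 2 * n : ℕ) := by rw [← h2]; linarith
    exact_mod_cast this
  refine ⟨k, l.natAbs + 2 * n - k, ?_, ?_⟩
  · rw [Nat.cast_sub hle, ← h2]; ring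
  · rw [Nat.cast_sub hle, ← h2, hk]; ring

theorem V.hom_ext {l : ℤ} {ρ : ℂ} {W : Type} [AddCommGroup W] [Module ℂ W]
    {f g : V l ρ →ₗ[ℂ] W}
    (h : ∀ p q : ℕ, ((p : ℝ) + q) / 2 ∈ spins l ρ →
      f (ket l ρ (((p : ℝ) + q) / 2) (((p : ℝ) - q) / 2)) =
        g (ket l ρ (((p : ℝ) + q) / 2) (((p : ℝ) - q) / 2))) : f = g := by
  refine Finsupp.lhom_ext' fun x => LinearMap.ext_ring ?_
  obtain ⟨⟨j, m⟩, hj, hm⟩ := x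
  obtain ⟨p, q, rfl, rfl⟩ := exists_occupation hj hm
  have := h p q hj
  simpa [ket, dif_pos (show _ ∧ _ from ⟨hj, hm⟩)] using this

/-- The embedding `|j,m⟩ ↦ occ (j+m) (j-m)`. -/
def emb (l : ℤ) (ρ : ℂ) : V l ρ →ₗ[ℂ] Fock := onKets fun j m => occ ⌊j + m⌋₊ ⌊j - m⌋₊

/-- The projection of the Fock space onto `V_{λ,ρ}`. -/
def proj (l : ℤ) (ρ : ℂ) : Fock →ₗ[ℂ] V l ρ :=
  onOcc fun p q => ket l ρ (((p : ℝ) + q) / 2) (((p : ℝ) - q) / 2)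

open Classical in
/-- The indicator function of the degrees `2j` occurring in `V_{λ,ρ}`. -/
def ind (l : ℤ) (ρ : ℂ) (n : ℤ) : ℂ := if (n : ℝ) / 2 ∈ spins l ρ then 1 else 0

theorem ind_of_mem {l : ℤ} {ρ : ℂ} {n : ℤ} (h : (n : ℝ) / 2 ∈ spins l ρ) : ind l ρ n = 1 :=
  if_pos h

theorem ind_of_notMem {l : ℤ} {ρ : ℂ} {n : ℤ} (h : (n : ℝ) / 2 ∉ spins l ρ) : ind l ρ n = 0 :=
  if_neg h

theorem proj_occ (l : ℤ) (ρ : ℂ) (p q : ℕ) :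
    proj l ρ (occ p q) = ket l ρ (((p : ℝ) + q) / 2) (((p : ℝ) - q) / 2) := onOcc_occ _ p q

theorem emb_ket_of_mem {l : ℤ} {ρ : ℂ} {p q : ℕ} (h : ((p : ℝ) + q) / 2 ∈ spins l ρ) :
    emb l ρ (ket l ρ (((p : ℝ) + q) / 2) (((p : ℝ) - q) / 2)) = occ p q := by
  rw [emb, onKets_ket _ h (mem_weights p q)]
  congr 1
  · rw [show ((p : ℝ) + q) / 2 + ((p : ℝ) - q) / 2 = p by ring, Nat.floor_natCast]
  · rw [show ((p : ℝ) + q) / 2 - ((p : ℝ) - q) / 2 = q by ring, Nat.floor_natCast]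

theorem emb_proj (l : ℤ) (ρ : ℂ) (w : Fock) : emb l ρ (proj l ρ w) = degOp (ind l ρ) w := by
  suffices h : emb l ρ ∘ₗ proj l ρ = degOp (ind l ρ) from LinearMap.congr_fun h w
  refine Fock.hom_ext fun p q => ?_
  rw [LinearMap.comp_apply, proj_occ, degOp_occ]
  by_cases h : ((p : ℝ) + q) / 2 ∈ spins l ρ
  · rw [emb_ket_of_mem h, ind_of_mem (by push_cast; exact h), one_smul]
  · rw [ind_of_notMem (by push_cast; exact h), zero_smul, ket, dif_neg (fun h' => h h'.1), map_zero]

theorem proj_emb (l : ℤ) (ρ : ℂ) (v : V l ρ) : proj l ρ (emb l ρ v) = v := by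
  suffices h : proj l ρ ∘ₗ emb l ρ = LinearMap.id from LinearMap.congr_fun h v
  refine V.hom_ext fun p q h => ?_
  rw [LinearMap.comp_apply, emb_ket_of_mem h, proj_occ, LinearMap.id_apply]

/-- `P⁻` as a function of `n = 2j`. -/
def dnK (l : ℤ) (ρ : ℂ) (n : ℤ) : ℂ := Pminus l ρ (n / 2)

/-- `P⁺` as a function of `n = 2j`. -/
def upK (l : ℤ) (ρ : ℂ) (n : ℤ) : ℂ := Pplus l ρ (n / 2)

/-- `P` as a function of `n = 2j`. -/
def midK (l : ℤ) (ρ : ℂ) (n : ℤ) : ℂ := Pzero l ρ (n / 2)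

theorem dnK_add_two (l : ℤ) (ρ : ℂ) (n : ℤ) : dnK l ρ (n + 2) = upK l ρ n := by
  rw [dnK, upK, Pplus]; congr 1; push_cast; ring

/-- The generators on the Fock space, with the coefficients of `V_{λ,ρ}`. -/
def fockAct (l : ℤ) (ρ : ℂ) : Gen → (Fock →ₗ[ℂ] Fock)
  | .J0 => fJ0
  | .J s => fJ s
  | .K0 => fK0 (upK l ρ) (midK l ρ) (dnK l ρ)
  | .K s => fK (upK l ρ) (midK l ρ) (dnK l ρ) s

theorem Pminus_abs_lam (l : ℤ) (ρ : ℂ) : Pminus l ρ |lam l| = 0 := by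
  rcases abs_choice (lam l) with h | h <;> simp [Pminus, h]

theorem mem_spins_add_two {l : ℤ} {ρ : ℂ} {n : ℤ} (h : (n : ℝ) / 2 ∈ spins l ρ)
    (h' : upK l ρ n ≠ 0) : ((n + 2 : ℤ) : ℝ) / 2 ∈ spins l ρ := by
  obtain ⟨k, hk, hz⟩ := h
  refine ⟨k + 1, by push_cast; linarith, fun i hi => ?_⟩
  rcases Nat.lt_succ_iff_lt_or_eq.1 hi with hi | rfl
  · exact hz i hi
  · rwa [upK, hk] at h'

theorem mem_spins_sub_two {l : ℤ} {ρ : ℂ} {n : ℤ} (h : ((n + 2 : ℤ) : ℝ) / 2 ∈ spins l ρ)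
    (h' : upK l ρ n ≠ 0) : (n : ℝ) / 2 ∈ spins l ρ := by
  obtain ⟨k, hk, hz⟩ := h
  rcases k with _ | k
  · rw [← dnK_add_two, dnK, hk] at h'
    simp [Pminus_abs_lam] at h'
  · exact ⟨k, by push_cast at hk; linarith, fun i hi => hz i (by omega)⟩

theorem upK_mul_ind (l : ℤ) (ρ : ℂ) (n : ℤ) :
    upK l ρ n * ind l ρ (n + 2) = upK l ρ n * ind l ρ n := by
  by_cases h0 : upK l ρ n = 0
  · simp [h0]
  by_cases h : (n : ℝ) / 2 ∈ spins l ρ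
  · rw [ind_of_mem h, ind_of_mem (mem_spins_add_two h h0)]
  · rw [ind_of_notMem h, ind_of_notMem fun h' => h (mem_spins_sub_two h' h0)]

theorem dnK_mul_ind (l : ℤ) (ρ : ℂ) (n : ℤ) :
    dnK l ρ n * ind l ρ (n - 2) = dnK l ρ n * ind l ρ n := by
  have := upK_mul_ind l ρ (n - 2)
  rw [← dnK_add_two, sub_add_cancel] at this
  exact this.symm

theorem degOp_fJ0 (φ : ℤ → ℂ) (v : Fock) : degOp φ (fJ0 v) = fJ0 (degOp φ v) := by
  simp [fJ0, degOp_cre, degOp_ann]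

theorem degOp_fJ (φ : ℤ → ℂ) (s : ℤˣ) (v : Fock) : degOp φ (fJ s v) = fJ s (degOp φ v) := by
  simp [fJ, degOp_cre, degOp_ann]

theorem degOp_fK0 {φ u z d : ℤ → ℂ} (hu : ∀ n, u n * φ (n + 2) = u n * φ n)
    (hd : ∀ n, d n * φ (n - 2) = d n * φ n) (v : Fock) :
    degOp φ (fK0 u z d v) = fK0 u z d (degOp φ v) := by
  suffices h : degOp φ ∘ₗ fK0 u z d = fK0 u z d ∘ₗ degOp φ from LinearMap.congr_fun h v
  refine Fock.hom_ext fun p q => ?_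
  have h := hasDeg_occ p q
  generalize occ p q = v at h
  have hu := hu (p + q)
  have hd := hd (p + q)
  generalize ((p : ℤ) + q) = n at *
  have k1 : n + 1 + 1 = n + 2 := by ring
  have k2 : n - 1 - 1 = n - 2 := by ring
  simp only [LinearMap.comp_apply, h φ, map_smul, fK0_apply 1 h, map_add, ((h.cre (-1)).cre 1) φ,
    ((h.ann (-1)).ann 1) φ, h.fJ0 φ, k1, k2]
  match_scalars
  · linear_combination hu
  · ring
  · linear_combination hd

theorem degOp_ind_fockAct (l : ℤ) (ρ : ℂ) (X : Gen) (v : Fock) :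
    degOp (ind l ρ) (fockAct l ρ X v) = fockAct l ρ X (degOp (ind l ρ) v) := by
  have h0 := degOp_fK0 (z := midK l ρ) (upK_mul_ind l ρ) (dnK_mul_ind l ρ)
  cases X with
  | J0 => exact degOp_fJ0 _ _
  | J s => exact degOp_fJ _ _ _
  | K0 => exact h0 _
  | K s => simp only [fockAct, fK_eq_commutator, map_smul, map_sub, degOp_fJ, h0]

open Classical in
/-- The Fock state with spin `j` and weight `m`, or `0` if there is none. -/
def state (j m : ℝ) : Fock :=
  if ∃ p q : ℕ, j + m = p ∧ j - m = q then occ ⌊j + m⌋₊ ⌊j - m⌋₊ else 0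

theorem state_eq_occ {j m : ℝ} {p q : ℕ} (hp : j + m = p) (hq : j - m = q) :
    state j m = occ p q := by
  rw [state, if_pos ⟨p, q, hp, hq⟩, hp, hq, Nat.floor_natCast, Nat.floor_natCast]

theorem occ_eq_state (p q : ℕ) : occ p q = state (((p : ℝ) + q) / 2) (((p : ℝ) - q) / 2) :=
  (state_eq_occ (by ring) (by ring)).symm

theorem state_eq_zero {j m : ℝ} (h : ∀ p q : ℕ, j + m = p → j - m ≠ q) : state j m = 0 :=
  if_neg fun ⟨p, q, hp, hq⟩ => h p q hp hq

theorem proj_state (l : ℤ) (ρ : ℂ) (j m : ℝ) : proj l ρ (state j m) = ket l ρ j m := by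
  by_cases h : ∃ p q : ℕ, j + m = p ∧ j - m = q
  · obtain ⟨p, q, hp, hq⟩ := h
    rw [state_eq_occ hp hq, proj_occ]
    congr 1 <;> linarith
  · push Not at h
    rw [state_eq_zero h, map_zero, ket, dif_neg]
    rintro ⟨hj, hm⟩
    obtain ⟨p, q, rfl, rfl⟩ := exists_occupation hj hm
    exact h p q (by ring) (by ring)

theorem emb_ket {l : ℤ} {ρ : ℂ} {j m : ℝ} (hj : j ∈ spins l ρ) (hm : m ∈ weights j) :
    emb l ρ (ket l ρ j m) = state j m := by
  obtain ⟨p, q, rfl, rfl⟩ := exists_occupation hj hm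
  rw [emb_ket_of_mem hj, occ_eq_state]

theorem cre_state (s : ℤˣ) (j m : ℝ) :
    cre s (state j m) = (√(j + sg s * m + 1) : ℂ) • state (j + 1 / 2) (m + sg s / 2) := by
  by_cases h : ∃ p q : ℕ, j + m = p ∧ j - m = q
  · obtain ⟨p, q, hp, hq⟩ := h
    rw [state_eq_occ hp hq]
    induction s using units_cases
    · rw [cre_one_occ, ← hp, sg_one, one_mul,
        state_eq_occ (p := p + 1) (q := q) (by push_cast; linarith) (by linarith)]
    · rw [cre_neg_one_occ, ← hq, sg_neg, sg_one, neg_one_mul, ← sub_eq_add_neg,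
        state_eq_occ (p := p) (q := q + 1) (by linarith) (by push_cast; linarith)]
  · push Not at h
    rw [state_eq_zero h, map_zero]
    by_cases h' : ∃ p q : ℕ, j + m + (1 + sg s) / 2 = p ∧ j - m + (1 - sg s) / 2 = q
    · obtain ⟨p, q, hp, hq⟩ := h'
      suffices j + sg s * m + 1 = 0 by simp [this]
      induction s using units_cases
      · simp only [sg_one] at *
        rcases p with _ | p
        · push_cast at hp; linarith
        · exact absurd (by linarith) (h p q (by push_cast at hp; linarith))
      · simp only [sg_neg, sg_one] at *
        rcases q with _ | q
        · push_cast at hq; linarith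
        · exact absurd (by push_cast at hq; linarith) (h p q (by linarith))
    · push Not at h'
      rw [state_eq_zero (fun p q hp hq => h' p q (by linarith) (by linarith)), smul_zero]

theorem ann_state (s : ℤˣ) (j m : ℝ) :
    ann s (state j m) = (√(j + sg s * m) : ℂ) • state (j - 1 / 2) (m - sg s / 2) := by
  by_cases h : ∃ p q : ℕ, j + m = p ∧ j - m = q
  · obtain ⟨p, q, hp, hq⟩ := h
    rw [state_eq_occ hp hq]
    induction s using units_cases
    · rw [ann_one_occ, ← hp, sg_one, one_mul]
      rcases p with _ | p
      · simp [hp]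
      · rw [state_eq_occ (p := p) (q := q) (by push_cast at hp; linarith) (by linarith),
          Nat.add_sub_cancel]
    · rw [ann_neg_one_occ, ← hq, sg_neg, sg_one, neg_one_mul, ← sub_eq_add_neg]
      rcases q with _ | q
      · simp [hq]
      · rw [state_eq_occ (p := p) (q := q) (by linarith) (by push_cast at hq; linarith),
          Nat.add_sub_cancel]
  · push Not at h
    rw [state_eq_zero h, map_zero, state_eq_zero, smul_zero]
    intro p q hp hq
    induction s using units_cases
    · simp only [sg_one] at *
      exact h (p + 1) q (by push_cast; linarith) (by linarith)
    · simp only [sg_neg, sg_one] at *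
      exact h p (q + 1) (by linarith) (by push_cast; linarith)

theorem hasDeg_state {j m : ℝ} {n : ℤ} (h : 2 * j = n) : HasDeg n (state j m) := by
  by_cases h' : ∃ p q : ℕ, j + m = p ∧ j - m = q
  · obtain ⟨p, q, hp, hq⟩ := h'
    have : n = p + q := by
      have : (n : ℝ) = p + q := by linarith
      exact_mod_cast this
    rw [state_eq_occ hp hq, this]
    exact hasDeg_occ p q
  · push Not at h'
    rw [state_eq_zero h']
    intro φ
    simp

theorem fJ_state (s : ℤˣ) (j m : ℝ) :
    fJ s (state j m) = (Cpm s j m : ℂ) • state j (m + sg s) := by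
  have h := sg_sq_real s
  rw [fJ_apply, ann_state, map_smul, cre_state, smul_smul, Cpm, sg_neg]
  have e1 : j + -sg s * m = j - sg s * m := by ring
  have e2 : j - 1 / 2 + sg s * (m - -sg s / 2) + 1 = j + sg s * m + 1 := by
    linear_combination h / 2
  have e3 : j - 1 / 2 + 1 / 2 = j := by ring
  have e4 : m - -sg s / 2 + sg s / 2 = m + sg s := by ring
  rw [e1, e2, e3, e4, Complex.ofReal_mul]

theorem fJ0_state (j m : ℝ) : fJ0 (state j m) = (m : ℂ) • state j m := by
  by_cases h : ∃ p q : ℕ, j + m = p ∧ j - m = q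
  · obtain ⟨p, q, hp, hq⟩ := h
    have : m = (p - q) / 2 := by linarith
    rw [state_eq_occ hp hq, fJ0_apply 1, cre_ann_occ, cre_ann_occ, ← sub_smul, smul_smul, this]
    congr 1
    simp [num]; ring
  · push Not at h
    rw [state_eq_zero h, map_zero, smul_zero]

theorem cre_cre_state (s t : ℤˣ) (j m : ℝ) {x y m' : ℝ} (hy : y = j + sg t * m + 1)
    (hx : x = j + 1 / 2 + sg s * (m + sg t / 2) + 1) (hm : m' = m + (sg s + sg t) / 2) :
    cre s (cre t (state j m)) = ((√y : ℂ) * (√x : ℂ)) • state (j + 1) m' := by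
  rw [cre_state, map_smul, cre_state, smul_smul, hx, hy, hm]
  congr 2 <;> ring

theorem ann_ann_state (s t : ℤˣ) (j m : ℝ) {x y m' : ℝ} (hy : y = j + sg t * m)
    (hx : x = j - 1 / 2 + sg s * (m - sg t / 2)) (hm : m' = m - (sg s + sg t) / 2) :
    ann s (ann t (state j m)) = ((√y : ℂ) * (√x : ℂ)) • state (j - 1) m' := by
  rw [ann_state, map_smul, ann_state, smul_smul, hx, hy, hm]
  congr 2 <;> ring

theorem act_eq (l : ℤ) (ρ : ℂ) (X : Gen) (v : V l ρ) :
    act l ρ X v = proj l ρ (fockAct l ρ X (emb l ρ v)) := by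
  suffices h : act l ρ X = proj l ρ ∘ₗ fockAct l ρ X ∘ₗ emb l ρ from LinearMap.congr_fun h v
  refine V.hom_ext fun p q h => ?_
  rw [LinearMap.comp_apply, LinearMap.comp_apply, emb_ket h (mem_weights p q)]
  have hd : HasDeg (p + q) (state (((p : ℝ) + q) / 2) (((p : ℝ) - q) / 2)) :=
    hasDeg_state (by push_cast; ring)
  have hm := mem_weights p q
  have hu : upK l ρ (p + q) = Pplus l ρ (((p : ℝ) + q) / 2) := by rw [upK]; push_cast; rfl
  have hz : midK l ρ (p + q) = Pzero l ρ (((p : ℝ) + q) / 2) := by rw [midK]; push_cast; rfl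
  have hdn : dnK l ρ (p + q) = Pminus l ρ (((p : ℝ) + q) / 2) := by rw [dnK]; push_cast; rfl
  generalize ((p : ℝ) + q) / 2 = j at *
  generalize ((p : ℝ) - q) / 2 = m at *
  cases X with
  | J0 => rw [fockAct, fJ0_state, map_smul, proj_state, act, actJ0, onKets_ket _ h hm]
  | J s => rw [fockAct, fJ_state, map_smul, proj_state, act, actJ, onKets_ket _ h hm]
  | K0 =>
    rw [fockAct, fK0_apply 1 hd, fJ0_state,
      cre_cre_state (x := j + m + 1) (y := j - m + 1) (m' := m) 1 (-1) _ _ (by simp; ring)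
        (by simp; ring) (by simp),
      ann_ann_state (x := j + m) (y := j - m) (m' := m) 1 (-1) _ _ (by simp; ring)
        (by simp; ring) (by simp), act, actK0, onKets_ket _ h hm]
    simp only [map_add, map_smul, proj_state, hu, hz, hdn]
    module
  | K s =>
    have hs := sg_sq_real s
    rw [fockAct, fK_apply s hd, fJ_state,
      cre_cre_state (x := j + sg s * m + 2) (y := j + sg s * m + 1) (m' := m + sg s) s s _ _ rfl
        (by linear_combination -hs / 2) (by ring),
      ann_ann_state (x := j - sg s * m - 1) (y := j - sg s * m) (m' := m + sg s) (-s) (-s) _ _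
        (by simp; ring) (by simp; linear_combination hs / 2) (by simp), act, actK,
        onKets_ket _ h hm]
    simp only [map_add, map_smul, proj_state, hu, hz, hdn]
    module

theorem emb_act (l : ℤ) (ρ : ℂ) (X : Gen) (v : V l ρ) :
    emb l ρ (act l ρ X v) = fockAct l ρ X (emb l ρ v) := by
  rw [act_eq, emb_proj, degOp_ind_fockAct, ← emb_proj, proj_emb]

theorem act_proj (l : ℤ) (ρ : ℂ) (X : Gen) (w : Fock) :
    act l ρ X (proj l ρ w) = proj l ρ (fockAct l ρ X w) := by
  rw [act_eq, emb_proj, ← degOp_ind_fockAct, ← emb_proj, proj_emb]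

/-! ### The coefficient functions of the doublet operators

The operators `T^A` (`ε = 1`) and `T̃^A` (`ε = -1`) depend on `x = ε λ` and `y = ε A ρ`. -/

/-- The raising coefficient. -/
def upS (κ : ℂ) (x : ℝ) (y : ℂ) (n : ℤ) : ℂ :=
  κ * ((√((n : ℝ) / 2 - x + 1) : ℂ) * Complex.sqrt ((n : ℂ) / 2 - y + 1)) /
    ((√((n : ℝ) + 1) : ℂ) * (√((n : ℝ) + 2) : ℂ))

/-- The lowering coefficient. -/
def dnS (x : ℝ) (y : ℂ) (n : ℤ) : ℂ :=
  ((√((n : ℝ) / 2 + x) : ℂ) * Complex.sqrt ((n : ℂ) / 2 + y)) /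
    ((√(n : ℝ) : ℂ) * (√((n : ℝ) + 1) : ℂ))

theorem upS_eq {κ : ℂ} {x : ℝ} {y : ℂ} {n : ℤ} {b r r' : ℝ} {d : ℂ}
    (hb : (n : ℝ) / 2 - x + 1 = b) (hd : (n : ℂ) / 2 - y + 1 = d)
    (hr : (n : ℝ) + 1 = r) (hr' : (n : ℝ) + 2 = r') :
    upS κ x y n = κ * ((√b : ℂ) * Complex.sqrt d) / ((√r : ℂ) * (√r' : ℂ)) := by
  subst hb hd hr hr'; rfl

theorem dnS_eq {x : ℝ} {y : ℂ} {n : ℤ} {a r r' : ℝ} {c : ℂ}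
    (ha : (n : ℝ) / 2 + x = a) (hc : (n : ℂ) / 2 + y = c)
    (hr : (n : ℝ) = r) (hr' : (n : ℝ) + 1 = r') :
    dnS x y n = ((√a : ℂ) * Complex.sqrt c) / ((√r : ℂ) * (√r' : ℂ)) := by
  subst ha hc hr hr'; rfl

theorem dnK_eq (ε A : ℤˣ) {l : ℤ} {ρ : ℂ} {n : ℤ} {a b r r' : ℝ} {c d : ℂ}
    (ha : (n : ℝ) / 2 + sg ε * lam l = a) (hb : (n : ℝ) / 2 - sg ε * lam l = b)
    (hc : (n : ℂ) / 2 + sg ε * sg A * ρ = c) (hd : (n : ℂ) / 2 - sg ε * sg A * ρ = d)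
    (hr : (n : ℝ) + 1 = r) (hr' : (n : ℝ) - 1 = r') :
    dnK l ρ n = ((√a : ℂ) * (√b : ℂ) * (Complex.sqrt c * Complex.sqrt d)) /
      ((n / 2 : ℂ) * ((√r : ℂ) * (√r' : ℂ))) := by
  rw [← ha, ← hb, ← hc, ← hd, ← hr, ← hr', dnK, Pminus,
    show 2 * ((n : ℝ) / 2) + 1 = n + 1 by ring, show 2 * ((n : ℝ) / 2) - 1 = n - 1 by ring]
  push_cast
  induction ε using units_cases <;> induction A using units_cases <;>
    simp [sub_eq_add_neg] <;> ring

theorem midK_eq (ε A : ℤˣ) {l : ℤ} {ρ : ℂ} {n : ℤ} (hn : n ≠ 0) :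
    midK l ρ n = Complex.I * sg A * ((sg ε * lam l : ℝ) * (sg ε * sg A * ρ)) * 4 /
      (n * (n + 2)) := by
  have : (n : ℝ) / 2 ≠ 0 := by simpa using hn
  have h0 : (n : ℂ) ≠ 0 := by exact_mod_cast hn
  rw [midK, Pzero, if_neg this]
  have e : (n : ℂ) / 2 * (n / 2 + 1) = n * (n + 2) / 4 := by ring
  have hε := sg_sq ε
  have hA := sg_sq A
  push_cast
  rw [e, div_div_eq_mul_div]
  congr 1
  linear_combination (-4 * Complex.I * lam l * ρ) * (hε * (sg A : ℂ) ^ 2 + hA)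

theorem ofReal_sqrt_ne_zero {x : ℝ} (hx : 0 < x) : (√x : ℂ) ≠ 0 := by
  simpa using (Real.sqrt_pos.2 hx).ne'

theorem half_add_lam_nonneg {l n : ℤ} (h : |l| ≤ n) (ε : ℤˣ) :
    0 ≤ (n : ℝ) / 2 + sg ε * lam l ∧ 0 ≤ (n : ℝ) / 2 - sg ε * lam l := by
  have h1 : ((|l| : ℤ) : ℝ) ≤ n := by exact_mod_cast h
  rw [Int.cast_abs] at h1
  have h2 := abs_le.1 h1
  induction ε using units_cases <;> simp [lam] <;> constructor <;> linarith

theorem sg_mul_lam_sub (ε δ : ℤˣ) (l : ℤ) : sg ε * lam (l - δ) = sg ε * lam l - sg ε * sg δ / 2 := by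
  rw [lam, lam, sg, sg]; push_cast; ring

theorem I_mul_sg_sq (A : ℤˣ) : (Complex.I * sg A) ^ 2 = -1 := by
  rw [mul_pow, Complex.I_sq, sg_sq]; ring

theorem intertwines_up {ε A : ℤˣ} {l l' : ℤ} {ρ ρ' : ℂ} {n : ℤ} (hn : 0 ≤ n)
    (hl : l' = l - ε) (hρ : ρ' = ρ - sg ε * sg A / 2) {κ : ℂ} :
    upK l ρ n * upS κ (sg ε * lam l) (sg ε * sg A * ρ) (n + 2) =
      upS κ (sg ε * lam l) (sg ε * sg A * ρ) n * upK l' ρ' (n + 1) := by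
  have hn0 : (0 : ℝ) ≤ n := by exact_mod_cast hn
  have hx' : sg ε * lam l' = sg ε * lam l - 1 / 2 := by
    rw [hl, sg_mul_lam_sub, ← sq, sg_sq_real]
  have hy' : (sg ε * sg A * ρ' : ℂ) = sg ε * sg A * ρ - 1 / 2 := by
    rw [hρ]; linear_combination (-1 / 2) * (sg_sq ε * (sg A : ℂ) ^ 2 + sg_sq A)
  generalize hx : sg ε * lam l = x at hx' ⊢
  generalize hy : (sg ε * sg A * ρ : ℂ) = y at hy' ⊢
  rw [← dnK_add_two, ← dnK_add_two,
    dnK_eq ε A (n := n + 2) (a := n / 2 + x + 1) (b := n / 2 - x + 1) (c := n / 2 + y + 1)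
      (d := n / 2 - y + 1) (r := n + 3) (r' := n + 1)
      (by rw [hx]; push_cast; ring) (by rw [hx]; push_cast; ring) (by rw [hy]; push_cast; ring)
      (by rw [hy]; push_cast; ring) (by push_cast; ring) (by push_cast; ring),
    dnK_eq ε A (n := n + 1 + 2) (a := n / 2 + x + 1) (b := n / 2 - x + 2) (c := n / 2 + y + 1)
      (d := n / 2 - y + 2) (r := n + 4) (r' := n + 2)
      (by rw [hx']; push_cast; ring) (by rw [hx']; push_cast; ring) (by rw [hy']; push_cast; ring)
      (by rw [hy']; push_cast; ring) (by push_cast; ring) (by push_cast; ring),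
    upS_eq (n := n + 2) (b := n / 2 - x + 2) (d := n / 2 - y + 2) (r := n + 3) (r' := n + 4)
      (by push_cast; ring) (by push_cast; ring) (by push_cast; ring) (by push_cast; ring), upS]
  have r1 := ofReal_sqrt_ne_zero (x := n + 1) (by linarith)
  have r2 := ofReal_sqrt_ne_zero (x := n + 2) (by linarith)
  have r3 := ofReal_sqrt_ne_zero (x := n + 3) (by linarith)
  have r4 := ofReal_sqrt_ne_zero (x := n + 4) (by linarith)
  have s2 := ofReal_sqrt_sq (x := n + 2) (by linarith)
  have s3 := ofReal_sqrt_sq (x := n + 3) (by linarith)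
  have n2 : ((n + 2 : ℤ) : ℂ) = (√((n : ℝ) + 2) : ℂ) ^ 2 := by rw [s2]; push_cast; ring
  have n3 : ((n + 1 + 2 : ℤ) : ℂ) = (√((n : ℝ) + 3) : ℂ) ^ 2 := by rw [s3]; push_cast; ring
  rw [n2, n3]
  generalize (√((n : ℝ) + 1) : ℂ) = q1 at *
  generalize (√((n : ℝ) + 2) : ℂ) = q2 at *
  generalize (√((n : ℝ) + 3) : ℂ) = q3 at *
  generalize (√((n : ℝ) + 4) : ℂ) = q4 at *
  rw [div_mul_div_comm, div_mul_div_comm, div_eq_div_iff (by simp [r1, r2, r3, r4]) (by simp [r1, r2, r3, r4])]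
  ring

theorem intertwines_down {ε A : ℤˣ} {l l' : ℤ} {ρ ρ' : ℂ} {n : ℤ} (hn : 0 ≤ n)
    (hl : l' = l - ε) (hρ : ρ' = ρ - sg ε * sg A / 2) :
    dnK l ρ n * dnS (sg ε * lam l) (sg ε * sg A * ρ) (n - 2) =
      dnS (sg ε * lam l) (sg ε * sg A * ρ) n * dnK l' ρ' (n - 1) := by
  have hn0 : (0 : ℝ) ≤ n := by exact_mod_cast hn
  have hx' : sg ε * lam l' = sg ε * lam l - 1 / 2 := by
    rw [hl, sg_mul_lam_sub, ← sq, sg_sq_real]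
  have hy' : (sg ε * sg A * ρ' : ℂ) = sg ε * sg A * ρ - 1 / 2 := by
    rw [hρ]; linear_combination (-1 / 2) * (sg_sq ε * (sg A : ℂ) ^ 2 + sg_sq A)
  generalize hx : sg ε * lam l = x at hx' ⊢
  generalize hy : (sg ε * sg A * ρ : ℂ) = y at hy' ⊢
  rw [dnK_eq ε A (n := n) (a := n / 2 + x) (b := n / 2 - x) (c := n / 2 + y)
      (d := n / 2 - y) (r := n + 1) (r' := n - 1)
      (by rw [hx]) (by rw [hx]) (by rw [hy]) (by rw [hy]) rfl rfl,
    dnK_eq ε A (n := n - 1) (a := n / 2 + x - 1) (b := n / 2 - x) (c := n / 2 + y - 1)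
      (d := n / 2 - y) (r := n) (r' := n - 2)
      (by rw [hx']; push_cast; ring) (by rw [hx']; push_cast; ring) (by rw [hy']; push_cast; ring)
      (by rw [hy']; push_cast; ring) (by push_cast; ring) (by push_cast; ring),
    dnS_eq (n := n - 2) (a := n / 2 + x - 1) (c := n / 2 + y - 1) (r := n - 2) (r' := n - 1)
      (by push_cast; ring) (by push_cast; ring) (by push_cast; ring) (by push_cast; ring), dnS]
  obtain h0 | h0 | h0 : n = 0 ∨ n = 1 ∨ 2 ≤ n := by have := hn; omega
  · simp [h0]
  · simp [h0]
  have h2 : (2 : ℝ) ≤ n := by exact_mod_cast h0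
  have r0 := ofReal_sqrt_ne_zero (x := n) (by linarith)
  have r1 := ofReal_sqrt_ne_zero (x := n + 1) (by linarith)
  have rm := ofReal_sqrt_ne_zero (x := n - 1) (by linarith)
  have s0 := ofReal_sqrt_sq (x := n) (by linarith)
  have sm := ofReal_sqrt_sq (x := n - 1) (by linarith)
  have n2 : (n : ℂ) = (√(n : ℝ) : ℂ) ^ 2 := by rw [s0]; push_cast; ring
  have n3 : ((n - 1 : ℤ) : ℂ) = (√((n : ℝ) - 1) : ℂ) ^ 2 := by rw [sm]; push_cast; ring
  generalize (√((n : ℝ) - 2) : ℂ) = t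
  rw [n3]
  generalize Complex.sqrt _ = t1
  generalize Complex.sqrt _ = t2
  generalize Complex.sqrt _ = t3
  rw [n2]
  generalize (√(n : ℝ) : ℂ) = q0 at *
  generalize (√((n : ℝ) + 1) : ℂ) = q1 at *
  generalize (√((n : ℝ) - 1) : ℂ) = qm at *
  rcases eq_or_ne t 0 with rfl | ht
  · simp
  rw [div_mul_div_comm, div_mul_div_comm, div_eq_div_iff (by simp [r0, r1, rm, ht]) (by simp [r0, r1, rm, ht])]
  ring

theorem sg_mul_lam_sub_self {ε : ℤˣ} {l l' : ℤ} (hl : l' = l - ε) :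
    sg ε * lam l' = sg ε * lam l - 1 / 2 := by
  rw [hl, sg_mul_lam_sub, ← sq, sg_sq_real]

theorem sg_mul_sub_self {ε A : ℤˣ} {ρ ρ' : ℂ} (hρ : ρ' = ρ - sg ε * sg A / 2) :
    (sg ε * sg A * ρ' : ℂ) = sg ε * sg A * ρ - 1 / 2 := by
  rw [hρ]; linear_combination (-1 / 2) * (sg_sq ε * (sg A : ℂ) ^ 2 + sg_sq A)

theorem upK_mul_dnS {ε A : ℤˣ} {l : ℤ} {ρ : ℂ} {n : ℤ} {a b : ℝ} {c d : ℂ} (hn : 0 ≤ n)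
    (ha : (n : ℝ) / 2 + sg ε * lam l = a) (hb : (n : ℝ) / 2 - sg ε * lam l = b)
    (hc : (n : ℂ) / 2 + sg ε * sg A * ρ = c) (hd : (n : ℂ) / 2 - sg ε * sg A * ρ = d)
    (ha0 : 0 ≤ a) :
    upK l ρ n * dnS (sg ε * lam l) (sg ε * sg A * ρ) (n + 2) =
      (√(b + 1) : ℂ) * Complex.sqrt (d + 1) / ((√((n : ℝ) + 1) : ℂ) * (√((n : ℝ) + 2) : ℂ)) *
        ((a + 1) * (c + 1) * 2 / ((n + 2) * (n + 3))) := by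
  have hn0 : (0 : ℝ) ≤ n := by exact_mod_cast hn
  rw [← dnK_add_two, dnK_eq ε A (n := n + 2) (a := a + 1) (b := b + 1) (c := c + 1)
      (d := d + 1) (r := n + 3) (r' := n + 1)
      (by rw [← ha]; push_cast; ring) (by rw [← hb]; push_cast; ring)
      (by rw [← hc]; push_cast; ring) (by rw [← hd]; push_cast; ring)
      (by push_cast; ring) (by push_cast; ring),
    dnS_eq (n := n + 2) (a := a + 1) (c := c + 1) (r := n + 2) (r' := n + 3)
      (by rw [← ha]; push_cast; ring) (by rw [← hc]; push_cast; ring) (by push_cast; ring)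
      (by push_cast; ring)]
  have r1 := ofReal_sqrt_ne_zero (x := n + 1) (by linarith)
  have r2 := ofReal_sqrt_ne_zero (x := n + 2) (by linarith)
  have r3 := ofReal_sqrt_ne_zero (x := n + 3) (by linarith)
  have s2 := ofReal_sqrt_sq (x := n + 2) (by linarith)
  have s3 := ofReal_sqrt_sq (x := n + 3) (by linarith)
  have sa := ofReal_sqrt_sq (x := a + 1) (by linarith)
  have sc := csqrt_sq (c + 1)
  have e : ((n + 2 : ℤ) : ℂ) = (√((n : ℝ) + 2) : ℂ) ^ 2 := by rw [s2]; push_cast; ring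
  have e2 : (n + 2 : ℂ) = (√((n : ℝ) + 2) : ℂ) ^ 2 := by rw [s2]; push_cast; ring
  have e3 : (n + 3 : ℂ) = (√((n : ℝ) + 3) : ℂ) ^ 2 := by rw [s3]; push_cast; ring
  have ea : (a + 1 : ℂ) = (√(a + 1) : ℂ) ^ 2 := by rw [sa]; push_cast; ring
  have ec : c + 1 = Complex.sqrt (c + 1) ^ 2 := sc.symm
  rw [e, e2, e3, ea]
  conv_rhs => rw [ec]
  generalize (√((n : ℝ) + 1) : ℂ) = q1 at *
  generalize (√((n : ℝ) + 2) : ℂ) = q2 at *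
  generalize (√((n : ℝ) + 3) : ℂ) = q3 at *
  generalize Complex.sqrt _ = t
  generalize (√_ : ℂ) = t'
  rw [div_mul_div_comm, div_mul_div_comm, div_eq_div_iff (by simp [r1, r2, r3])
    (by simp [r1, r2, r3])]
  ring

theorem dnS_mul_dnK {ε A : ℤˣ} {l l' : ℤ} {ρ ρ' : ℂ} {n : ℤ} {a b : ℝ} {c d : ℂ} (hn : 0 < n)
    (hl : l' = l - ε) (hρ : ρ' = ρ - sg ε * sg A / 2)
    (ha : (n : ℝ) / 2 + sg ε * lam l = a) (hb : (n : ℝ) / 2 - sg ε * lam l = b)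
    (hc : (n : ℂ) / 2 + sg ε * sg A * ρ = c) (hd : (n : ℂ) / 2 - sg ε * sg A * ρ = d)
    (ha0 : 0 ≤ a) :
    dnS (sg ε * lam l) (sg ε * sg A * ρ) n * dnK l' ρ' (n + 1) =
      (√(b + 1) : ℂ) * Complex.sqrt (d + 1) / ((√((n : ℝ) + 1) : ℂ) * (√((n : ℝ) + 2) : ℂ)) *
        (a * c * 2 / (n * (n + 1))) := by
  have hn0 : (0 : ℝ) < n := by exact_mod_cast hn
  rw [dnK_eq ε A (n := n + 1) (a := a) (b := b + 1) (c := c)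
      (d := d + 1) (r := n + 2) (r' := n)
      (by rw [sg_mul_lam_sub_self hl, ← ha]; push_cast; ring)
      (by rw [sg_mul_lam_sub_self hl, ← hb]; push_cast; ring)
      (by rw [sg_mul_sub_self hρ, ← hc]; push_cast; ring)
      (by rw [sg_mul_sub_self hρ, ← hd]; push_cast; ring)
      (by push_cast; ring) (by push_cast; ring),
    dnS_eq (n := n) (a := a) (c := c) (r := n) (r' := n + 1) ha hc rfl rfl]
  have r0 := ofReal_sqrt_ne_zero (x := n) (by linarith)
  have r1 := ofReal_sqrt_ne_zero (x := n + 1) (by linarith)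
  have r2 := ofReal_sqrt_ne_zero (x := n + 2) (by linarith)
  have s0 := ofReal_sqrt_sq (x := n) (by linarith)
  have s1 := ofReal_sqrt_sq (x := n + 1) (by linarith)
  have sa := ofReal_sqrt_sq (x := a) (by linarith)
  have e : ((n + 1 : ℤ) : ℂ) = (√((n : ℝ) + 1) : ℂ) ^ 2 := by rw [s1]; push_cast; ring
  have e1 : (n + 1 : ℂ) = (√((n : ℝ) + 1) : ℂ) ^ 2 := by rw [s1]; push_cast; ring
  have e0 : (n : ℂ) = (√(n : ℝ) : ℂ) ^ 2 := by rw [s0]; push_cast; ring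
  rw [e, e1, ← sa]
  conv_rhs => rw [e0, ← csqrt_sq c]
  generalize (√(n : ℝ) : ℂ) = q0 at *
  generalize (√((n : ℝ) + 1) : ℂ) = q1 at *
  generalize (√((n : ℝ) + 2) : ℂ) = q2 at *
  generalize Complex.sqrt _ = t
  generalize Complex.sqrt _ = t'
  rw [div_mul_div_comm, div_mul_div_comm, div_eq_div_iff (by simp [r0, r1, r2])
    (by simp [r0, r1, r2])]
  ring

theorem midK_zero (l : ℤ) (ρ : ℂ) : midK l ρ 0 = 0 := by simp [midK, Pzero]

theorem intertwines_midUp {ε A : ℤˣ} {l l' : ℤ} {ρ ρ' : ℂ} {n : ℤ} (hn : |l| ≤ n)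
    (hl : l' = l - ε) (hρ : ρ' = ρ - sg ε * sg A / 2) {f g : ℤ → ℂ}
    (hf : f = upS (Complex.I * sg A) (sg ε * lam l) (sg ε * sg A * ρ))
    (hg : g = dnS (sg ε * lam l) (sg ε * sg A * ρ))
    (x y : ℕ) (hxy : n = x + y) :
    upK l ρ n * g (n + 2) * (1 + y) + midK l ρ n * f n * (x - y) / 2 +
        Complex.I * sg A / 2 * f n =
      f n * midK l' ρ' (n + 1) * (x - y + 1) / 2 + g n * upK l' ρ' (n - 1) * y := by
  have hn0 : 0 ≤ n := (abs_nonneg l).trans hn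
  have hb := half_add_lam_nonneg hn ε
  have h1 := upK_mul_dnS (ε := ε) (A := A) (l := l) (ρ := ρ) hn0 rfl rfl rfl rfl hb.1
  have hz' := midK_eq ε A (l := l') (ρ := ρ') (n := n + 1) (by omega)
  have hκ := I_mul_sg_sq A
  have hnC : (n : ℂ) = x + y := by rw [hxy]; push_cast; rfl
  rw [sg_mul_lam_sub_self hl, sg_mul_sub_self hρ] at hz'
  rw [hg, h1, hf, hz', upS, ← dnK_add_two, show n - 1 + 2 = n + 1 by ring]
  have n1 : (n + 1 : ℂ) ≠ 0 := by exact_mod_cast (by omega : n + 1 ≠ 0)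
  have n2 : (n + 2 : ℂ) ≠ 0 := by exact_mod_cast (by omega : n + 2 ≠ 0)
  have n3 : (n + 3 : ℂ) ≠ 0 := by exact_mod_cast (by omega : n + 3 ≠ 0)
  rcases hn0.eq_or_lt with h0 | h0
  · obtain ⟨rfl, rfl⟩ : x = 0 ∧ y = 0 := by omega
    have hl0 : l = 0 := abs_eq_zero.1 (le_antisymm (h0 ▸ hn) (abs_nonneg l))
    subst h0
    simp only [hl0, midK_zero, lam, Int.cast_zero, zero_div, mul_zero]
    push_cast
    generalize (√_ : ℂ) = s1
    generalize Complex.sqrt _ = s2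
    linear_combination (s1 * s2 / ((√(0 + 1) : ℂ) * (√(0 + 2) : ℂ))) *
      (1 + sg ε * sg A * ρ) / 3 * hκ
  · have h2 := dnS_mul_dnK (A := A) h0 hl hρ rfl rfl rfl rfl hb.1
    have n0 : (n : ℂ) ≠ 0 := by exact_mod_cast h0.ne'
    rw [h2, midK_eq ε A h0.ne']
    generalize sg ε * lam l = X at *
    generalize (sg ε * sg A * ρ : ℂ) = Y at *
    have key : ((n / 2 + X) + 1) * ((n / 2 + Y) + 1) * 2 / ((n + 2) * (n + 3)) * (1 + y)
        - X * Y * 4 / (n * (n + 2)) * (x - y) / 2 - 1 / 2 =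
        -((X - 1 / 2) * (Y - 1 / 2) * 4 / ((n + 1) * (n + 3)) * (x - y + 1) / 2) +
        (n / 2 + X) * (n / 2 + Y) * 2 / (n * (n + 1)) * (y : ℂ) := by
      rw [hnC] at *
      field_simp
      ring
    push_cast
    generalize (√_ : ℂ) = s1
    generalize Complex.sqrt _ = s2
    generalize (√((n : ℝ) + 1) : ℂ) = q1
    generalize (√((n : ℝ) + 2) : ℂ) = q2
    have e : (n + 1 + 2 : ℂ) = n + 3 := by ring
    rw [e]
    linear_combination (s1 * s2 / (q1 * q2)) * key +
      (s1 * s2 / (q1 * q2)) * (X * Y * 4 / (n * (n + 2)) * (x - y) / 2 + 1 / 2 -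
        (X - 1 / 2) * (Y - 1 / 2) * 4 / ((n + 1) * (n + 3)) * (x - y + 1) / 2) * hκ

theorem dnK_mul_upS {ε A : ℤˣ} {l : ℤ} {ρ : ℂ} {n : ℤ} {a b : ℝ} {c d κ : ℂ} (hn : 2 ≤ n)
    (ha : (n : ℝ) / 2 + sg ε * lam l = a) (hb : (n : ℝ) / 2 - sg ε * lam l = b)
    (hc : (n : ℂ) / 2 + sg ε * sg A * ρ = c) (hd : (n : ℂ) / 2 - sg ε * sg A * ρ = d)
    (hb0 : 0 ≤ b) :
    dnK l ρ n * upS κ (sg ε * lam l) (sg ε * sg A * ρ) (n - 2) =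
      κ * ((√a : ℂ) * Complex.sqrt c / ((√(n : ℝ) : ℂ) * (√((n : ℝ) + 1) : ℂ))) *
        (b * d * 2 / (n * (n - 1))) := by
  have hn0 : (2 : ℝ) ≤ n := by exact_mod_cast hn
  rw [dnK_eq ε A (n := n) (a := a) (b := b) (c := c)
      (d := d) (r := n + 1) (r' := n - 1) ha hb hc hd rfl rfl,
    upS_eq (n := n - 2) (b := b) (d := d) (r := n - 1) (r' := n)
      (by rw [← hb]; push_cast; ring) (by rw [← hd]; push_cast; ring) (by push_cast; ring)
      (by push_cast; ring)]
  have r0 := ofReal_sqrt_ne_zero (x := n) (by linarith)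
  have r1 := ofReal_sqrt_ne_zero (x := n + 1) (by linarith)
  have rm := ofReal_sqrt_ne_zero (x := n - 1) (by linarith)
  have s0 := ofReal_sqrt_sq (x := n) (by linarith)
  have sm := ofReal_sqrt_sq (x := n - 1) (by linarith)
  have sb := ofReal_sqrt_sq (x := b) (by linarith)
  have em : (n - 1 : ℂ) = (√((n : ℝ) - 1) : ℂ) ^ 2 := by rw [sm]; push_cast; ring
  have e0 : (n : ℂ) = (√(n : ℝ) : ℂ) ^ 2 := by rw [s0]; push_cast; ring
  have ed := csqrt_sq d
  rw [em, ← sb]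
  nth_rewrite 3 [← ed]
  rw [e0]
  generalize (√(n : ℝ) : ℂ) = q0 at *
  generalize (√((n : ℝ) + 1) : ℂ) = q1 at *
  generalize (√((n : ℝ) - 1) : ℂ) = qm at *
  generalize Complex.sqrt _ = t
  generalize Complex.sqrt _ = t'
  rw [div_mul_div_comm, mul_assoc κ, div_mul_div_comm, ← mul_div_assoc,
    div_eq_div_iff (by simp [r0, r1, rm]) (by simp [r0, r1, rm])]
  ring

theorem upS_mul_dnK {ε A : ℤˣ} {l l' : ℤ} {ρ ρ' : ℂ} {n : ℤ} {a b : ℝ} {c d κ : ℂ} (hn : 0 < n)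
    (hl : l' = l - ε) (hρ : ρ' = ρ - sg ε * sg A / 2)
    (ha : (n : ℝ) / 2 + sg ε * lam l = a) (hb : (n : ℝ) / 2 - sg ε * lam l = b)
    (hc : (n : ℂ) / 2 + sg ε * sg A * ρ = c) (hd : (n : ℂ) / 2 - sg ε * sg A * ρ = d)
    (hb0 : 0 ≤ b) :
    upS κ (sg ε * lam l) (sg ε * sg A * ρ) n * dnK l' ρ' (n + 1) =
      κ * ((√a : ℂ) * Complex.sqrt c / ((√(n : ℝ) : ℂ) * (√((n : ℝ) + 1) : ℂ))) *
        ((b + 1) * (d + 1) * 2 / ((n + 1) * (n + 2))) := by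
  have hn0 : (0 : ℝ) < n := by exact_mod_cast hn
  rw [dnK_eq ε A (n := n + 1) (a := a) (b := b + 1) (c := c)
      (d := d + 1) (r := n + 2) (r' := n)
      (by rw [sg_mul_lam_sub_self hl, ← ha]; push_cast; ring)
      (by rw [sg_mul_lam_sub_self hl, ← hb]; push_cast; ring)
      (by rw [sg_mul_sub_self hρ, ← hc]; push_cast; ring)
      (by rw [sg_mul_sub_self hρ, ← hd]; push_cast; ring)
      (by push_cast; ring) (by push_cast; ring),
    upS_eq (n := n) (b := b + 1) (d := d + 1) (r := n + 1) (r' := n + 2) (by rw [hb])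
      (by rw [hd]) rfl rfl]
  have r0 := ofReal_sqrt_ne_zero (x := n) (by linarith)
  have r1 := ofReal_sqrt_ne_zero (x := n + 1) (by linarith)
  have r2 := ofReal_sqrt_ne_zero (x := n + 2) (by linarith)
  have s1 := ofReal_sqrt_sq (x := n + 1) (by linarith)
  have s2 := ofReal_sqrt_sq (x := n + 2) (by linarith)
  have sb := ofReal_sqrt_sq (x := b + 1) (by linarith)
  have e : ((n + 1 : ℤ) : ℂ) = (√((n : ℝ) + 1) : ℂ) ^ 2 := by rw [s1]; push_cast; ring
  have e1 : (n + 1 : ℂ) = (√((n : ℝ) + 1) : ℂ) ^ 2 := by rw [s1]; push_cast; ring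
  have e2 : (n + 2 : ℂ) = (√((n : ℝ) + 2) : ℂ) ^ 2 := by rw [s2]; push_cast; ring
  have eb : (b + 1 : ℂ) = (√(b + 1) : ℂ) ^ 2 := by rw [sb]; push_cast; ring
  rw [e, e1, e2, eb]
  conv_rhs => rw [← csqrt_sq (d + 1)]
  generalize (√(n : ℝ) : ℂ) = q0 at *
  generalize (√((n : ℝ) + 1) : ℂ) = q1 at *
  generalize (√((n : ℝ) + 2) : ℂ) = q2 at *
  generalize Complex.sqrt _ = t
  generalize Complex.sqrt _ = t'
  rw [← mul_div_assoc κ, div_mul_div_comm, div_mul_div_comm, div_eq_div_iff (by simp [r0, r1, r2]) (by simp [r0, r1, r2])]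
  ring

theorem intertwines_midDown {ε A : ℤˣ} {l l' : ℤ} {ρ ρ' : ℂ} {n : ℤ} (hn : |l| ≤ n)
    (hp : Even (n - l))
    (hl : l' = l - ε) (hρ : ρ' = ρ - sg ε * sg A / 2) {f g : ℤ → ℂ}
    (hf : f = upS (Complex.I * sg A) (sg ε * lam l) (sg ε * sg A * ρ))
    (hg : g = dnS (sg ε * lam l) (sg ε * sg A * ρ))
    (x y : ℕ) (hxy : n = x + y) (hy : y ≠ 0) :
    dnK l ρ n * f (n - 2) * x + midK l ρ n * g n * (x - y) / 2 + Complex.I * sg A / 2 * g n =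
      f n * dnK l' ρ' (n + 1) * (1 + x) + g n * midK l' ρ' (n - 1) * (x - y + 1) / 2 := by
  have h0 : 0 < n := by omega
  have hb := half_add_lam_nonneg hn ε
  have h2 := upS_mul_dnK (A := A) (κ := Complex.I * sg A) h0 hl hρ rfl rfl rfl rfl hb.2
  have hnC : (n : ℂ) = x + y := by rw [hxy]; push_cast; rfl
  have n0 : (n : ℂ) ≠ 0 := by exact_mod_cast h0.ne'
  have n1 : (n + 1 : ℂ) ≠ 0 := by exact_mod_cast (by omega : n + 1 ≠ 0)
  have n2 : (n + 2 : ℂ) ≠ 0 := by exact_mod_cast (by omega : n + 2 ≠ 0)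
  have hX := sg_mul_lam_sub_self hl
  rw [hg, hf, h2, midK_eq ε A h0.ne', dnS]
  rcases eq_or_ne n 1 with h1 | h1
  · obtain ⟨rfl, rfl⟩ : x = 0 ∧ y = 1 := by omega
    rw [h1, sub_self, midK_zero]
    have hl1 : l = ε ∨ l = -ε := by
      rw [h1] at hn hp
      have := abs_le.1 hn
      obtain ⟨k, hk⟩ := hp
      induction ε using units_cases <;> simp <;> omega
    rcases hl1 with hl1 | hl1
    · have : sg ε * lam l = 1 / 2 := by
        have := sg_sq_real ε
        rw [hl1, lam, ← sg]; linear_combination this / 2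
      rw [this]
      push_cast
      ring
    · have : sg ε * lam l = -(1 / 2) := by
        have := sg_sq_real ε
        rw [hl1, lam, Int.cast_neg, ← sg]; linear_combination -this / 2
      rw [this]
      simp
  · have h3 := dnK_mul_upS (ε := ε) (A := A) (l := l) (ρ := ρ) (κ := Complex.I * sg A)
      (n := n) (by omega) rfl rfl rfl rfl hb.2
    have nm : (n - 1 : ℂ) ≠ 0 := by exact_mod_cast (by omega : n - 1 ≠ 0)
    rw [h3, midK_eq ε A (l := l') (by omega), hX, sg_mul_sub_self hρ]
    generalize sg ε * lam l = X at *
    generalize (sg ε * sg A * ρ : ℂ) = Y at *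
    have key : (n / 2 - X) * (n / 2 - Y) * 2 / (n * (n - 1)) * x
        + X * Y * 4 / (n * (n + 2)) * (x - y) / 2 + 1 / 2 =
        (n / 2 - X + 1) * (n / 2 - Y + 1) * 2 / ((n + 1) * (n + 2)) * (1 + x) +
        (X - 1 / 2) * (Y - 1 / 2) * 4 / ((n - 1) * (n + 1)) * (x - y + 1) / 2 := by
      rw [hnC] at *
      field_simp
      ring
    push_cast
    generalize (√_ : ℂ) = s1
    generalize Complex.sqrt _ = s2
    generalize (√(n : ℝ) : ℂ) = q1
    generalize (√((n : ℝ) + 1) : ℂ) = q2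
    have e : (n - 1 + 2 : ℂ) = n + 1 := by ring
    rw [e]
    linear_combination (Complex.I * sg A * (s1 * s2 / (q1 * q2))) * key

theorem factors {ε A : ℤˣ} {l : ℤ} {ρ : ℂ} {n : ℤ} (hn : |l| ≤ n) {x : ℝ} {y κ : ℂ}
    (hx : sg ε * lam l = x) (hy : sg ε * sg A * ρ = y) (hκ : κ = Complex.I * sg A) :
    Factors κ (-κ) (upS κ (-x) (-y)) (dnS (-x) (-y)) (upS κ (x + 1 / 2) (y + 1 / 2))
      (dnS (x + 1 / 2) (y + 1 / 2)) (upK l ρ) (midK l ρ) (dnK l ρ) n := by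
  have hn0 : 0 ≤ n := (abs_nonneg l).trans hn
  have hn0' : (0 : ℝ) ≤ n := by exact_mod_cast hn0
  have hb := half_add_lam_nonneg hn ε
  rw [hx] at hb
  have hκ2 : κ ^ 2 = -1 := by rw [hκ, I_mul_sg_sq]
  have r1 := ofReal_sqrt_ne_zero (x := n + 1) (by linarith)
  have r2 := ofReal_sqrt_ne_zero (x := n + 2) (by linarith)
  have s1 := ofReal_sqrt_sq (x := n + 1) (by linarith)
  have s2 := ofReal_sqrt_sq (x := n + 2) (by linarith)
  have e1 : (n + 1 : ℂ) = (√((n : ℝ) + 1) : ℂ) ^ 2 := by rw [s1]; push_cast; ring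
  have e2 : (n + 2 : ℂ) = (√((n : ℝ) + 2) : ℂ) ^ 2 := by rw [s2]; push_cast; ring
  constructor
  · have r3 := ofReal_sqrt_ne_zero (x := n + 3) (by linarith)
    rw [upS_eq (b := n / 2 + x + 1) (d := n / 2 + y + 1) (by ring) (by ring) rfl rfl,
      upS_eq (n := n + 1) (b := n / 2 - x + 1) (d := n / 2 - y + 1) (r := n + 2) (r' := n + 3)
        (by push_cast; ring) (by push_cast; ring) (by push_cast; ring) (by push_cast; ring),
      ← dnK_add_two, dnK_eq ε A (n := n + 2) (a := n / 2 + x + 1) (b := n / 2 - x + 1)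
        (c := n / 2 + y + 1) (d := n / 2 - y + 1) (r := n + 3) (r' := n + 1)
        (by rw [hx]; push_cast; ring) (by rw [hx]; push_cast; ring)
        (by rw [hy]; push_cast; ring) (by rw [hy]; push_cast; ring)
        (by push_cast; ring) (by push_cast; ring),
      show ((n + 2 : ℤ) : ℂ) = (√((n : ℝ) + 2) : ℂ) ^ 2 by rw [← e2]; push_cast; rfl]
    generalize (√((n : ℝ) + 1) : ℂ) = q1 at *
    generalize (√((n : ℝ) + 2) : ℂ) = q2 at *
    generalize (√((n : ℝ) + 3) : ℂ) = q3 at *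
    rw [div_mul_div_comm, ← mul_div_assoc, ← mul_div_assoc,
      div_eq_div_iff (by simp [r1, r2, r3]) (by simp [r1, r2, r3])]
    generalize Complex.sqrt _ = t1
    generalize Complex.sqrt _ = t2
    generalize (√_ : ℂ) = t3
    generalize (√_ : ℂ) = t4
    linear_combination (-κ * t1 * t2 * t3 * t4 * q1 * q2 ^ 2 * q3 / 2) * hκ2
  · rw [dnS_eq (a := n / 2 - x) (c := n / 2 - y) (by ring) (by ring) rfl rfl,
      dnS_eq (n := n - 1) (a := n / 2 + x) (c := n / 2 + y) (r := n - 1) (r' := n)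
        (by push_cast; ring) (by push_cast; ring) (by push_cast; ring) (by push_cast; ring),
      dnK_eq ε A (n := n) (a := n / 2 + x) (b := n / 2 - x)
        (c := n / 2 + y) (d := n / 2 - y) (r := n + 1) (r' := n - 1)
        (by rw [hx]) (by rw [hx]) (by rw [hy]) (by rw [hy]) rfl rfl]
    have s0 := ofReal_sqrt_sq (x := n) (by linarith)
    have e0 : (n : ℂ) = (√(n : ℝ) : ℂ) ^ 2 := by rw [s0]; push_cast; ring
    generalize Complex.sqrt _ = t1
    generalize Complex.sqrt _ = t2
    rw [e0]
    generalize (√((n : ℝ) + 1) : ℂ) = q1 at *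
    generalize (√(n : ℝ) : ℂ) = q0 at *
    generalize (√((n : ℝ) - 1) : ℂ) = qm at *
    rcases eq_or_ne q0 0 with rfl | r0
    · simp
    rcases eq_or_ne qm 0 with rfl | rm
    · simp
    rw [div_mul_div_comm, ← mul_div_assoc, ← mul_div_assoc,
      div_eq_div_iff (by simp [r1, r0, rm]) (by simp [r1, r0, rm])]
    ring
  · intro h0
    have h1 : 1 ≤ n := by omega
    have h1' : (1 : ℝ) ≤ n := by exact_mod_cast h1
    have n0 : (n : ℂ) ≠ 0 := by exact_mod_cast h0
    rw [midK_eq ε A h0, hx, hy, ← hκ,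
      upS_eq (b := n / 2 + x + 1) (d := n / 2 + y + 1) (by ring) (by ring) rfl rfl,
      upS_eq (n := n - 1) (b := n / 2 - x) (d := n / 2 - y) (r := n) (r' := n + 1)
        (by push_cast; ring) (by push_cast; ring) (by push_cast; ring) (by push_cast; ring),
      dnS_eq (n := n) (a := n / 2 - x) (c := n / 2 - y) (by ring) (by ring) rfl rfl,
      dnS_eq (n := n + 1) (a := n / 2 + x + 1) (c := n / 2 + y + 1) (r := n + 1) (r' := n + 2)
        (by push_cast; ring) (by push_cast; ring) (by push_cast; ring) (by push_cast; ring)]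
    have r0 := ofReal_sqrt_ne_zero (x := n) (by linarith)
    have s0 := ofReal_sqrt_sq (x := n) (by linarith)
    have sa := ofReal_sqrt_sq (x := n / 2 + x + 1) (by linarith)
    have sb := ofReal_sqrt_sq (x := n / 2 - x) (by linarith)
    have sc := csqrt_sq (n / 2 + y + 1)
    have sd := csqrt_sq (n / 2 - y)
    have n1 : (n + 1 : ℂ) ≠ 0 := by rw [e1]; exact pow_ne_zero 2 r1
    have n2 : (n + 2 : ℂ) ≠ 0 := by rw [e2]; exact pow_ne_zero 2 r2
    push_cast at s0 s1 s2 sa sb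
    generalize Complex.sqrt _ = t1 at *
    generalize Complex.sqrt _ = t2 at *
    generalize (√((n : ℝ) + 1) : ℂ) = q1 at *
    generalize (√((n : ℝ) + 2) : ℂ) = q2 at *
    generalize (√(n : ℝ) : ℂ) = q0 at *
    generalize (√_ : ℂ) = t3 at *
    generalize (√_ : ℂ) = t4 at *
    have p1 : κ * (t3 * t1) / (q1 * q2) * (t3 * t1 / (q1 * q2)) =
        κ * ((n / 2 + x + 1) * (n / 2 + y + 1)) / ((n + 1) * (n + 2)) := by
      rw [← sa, ← sc, ← s1, ← s2, div_mul_div_comm]; congr 1 <;> ring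
    have p2 : (t4 * t2) / (q0 * q1) * (κ * (t4 * t2) / (q0 * q1)) =
        κ * ((n / 2 - x) * (n / 2 - y)) / (n * (n + 1)) := by
      rw [← sb, ← sd, ← s1, ← s0, div_mul_div_comm]; congr 1 <;> ring
    rw [p1, p2]
    have key : ((n / 2 + x + 1 : ℂ) * (n / 2 + y + 1)) / ((n + 1) * (n + 2)) +
        (n / 2 - x) * (n / 2 - y) / (n * (n + 1)) = (1 + x * y * 4 / (n * (n + 2))) / 2 := by
      field_simp
      ring
    linear_combination key - (((n / 2 + x + 1 : ℂ) * (n / 2 + y + 1)) / ((n + 1) * (n + 2)) +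
        (n / 2 - x) * (n / 2 - y) / (n * (n + 1)) - x * y * 4 / (n * (n + 2)) / 2) * hκ2

/-- The four products of square roots occurring in the commutator of two doublet operators. -/
def Quad (n : ℂ) (σ : ℤˣ) (N₁ N₂ N₃ N₄ : ℂ) : Prop :=
  (σ = 1 ∧ N₁ = N₂ ∧ N₃ = N₂ ∧ N₄ = N₂) ∨
    (σ = -1 ∧ ∃ a b, a + b = n ∧ N₁ = a + 1 ∧ N₂ = a ∧ N₃ = b + 1 ∧ N₄ = b)

theorem quad_real (σ : ℤˣ) {x : ℝ} {n : ℤ} (h1 : 0 ≤ (n : ℝ) / 2 + x) (h2 : 0 ≤ (n : ℝ) / 2 - x) :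
    Quad n σ ((√((n : ℝ) / 2 - sg σ * x + 1) : ℂ) * (√(((n + 1 : ℤ) : ℝ) / 2 + (x - sg σ / 2)) : ℂ))
      ((√((n : ℝ) / 2 + x) : ℂ) * (√(((n - 1 : ℤ) : ℝ) / 2 - (sg σ * x - sg σ / 2) + 1) : ℂ))
      ((√((n : ℝ) / 2 - x + 1) : ℂ) * (√(((n + 1 : ℤ) : ℝ) / 2 + (sg σ * x - sg σ / 2)) : ℂ))
      ((√((n : ℝ) / 2 + sg σ * x) : ℂ) * (√(((n - 1 : ℤ) : ℝ) / 2 - (x - sg σ / 2) + 1) : ℂ)) := by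
  induction σ using units_cases
  · refine Or.inl ⟨rfl, ?_, ?_, ?_⟩ <;> simp only [sg_one, one_mul] <;> push_cast
    · rw [mul_comm]; congr 3; all_goals ring_nf
    · rw [mul_comm]; congr 3; all_goals ring_nf
  · refine Or.inr ⟨rfl, n / 2 + x, n / 2 - x, by ring, ?_, ?_, ?_, ?_⟩ <;>
      simp only [sg_neg, sg_one, neg_one_mul] <;> push_cast
    · rw [show ((n : ℝ) + 1) / 2 + (x - -1 / 2) = n / 2 - -x + 1 by ring,
        ofReal_sqrt_mul_self (by linarith)]; push_cast; ring
    · rw [show ((n : ℝ) - 1) / 2 - (-x - -1 / 2) + 1 = n / 2 + x by ring,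
        ofReal_sqrt_mul_self (by linarith)]; push_cast; ring
    · rw [show ((n : ℝ) + 1) / 2 + (-x - -1 / 2) = n / 2 - x + 1 by ring,
        ofReal_sqrt_mul_self (by linarith)]; push_cast; ring
    · rw [show ((n : ℝ) - 1) / 2 - (x - -1 / 2) + 1 = n / 2 + -x by ring,
        ofReal_sqrt_mul_self (by linarith)]; push_cast; ring

theorem csqrt_mul_self (z : ℂ) : Complex.sqrt z * Complex.sqrt z = z := by rw [← sq, csqrt_sq]

theorem quad_complex (σ : ℤˣ) (y : ℂ) (n : ℤ) :
    Quad n σ (Complex.sqrt ((n : ℂ) / 2 - sg σ * y + 1) *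
        Complex.sqrt (((n + 1 : ℤ) : ℂ) / 2 + (y - sg σ / 2)))
      (Complex.sqrt ((n : ℂ) / 2 + y) *
        Complex.sqrt (((n - 1 : ℤ) : ℂ) / 2 - (sg σ * y - sg σ / 2) + 1))
      (Complex.sqrt ((n : ℂ) / 2 - y + 1) *
        Complex.sqrt (((n + 1 : ℤ) : ℂ) / 2 + (sg σ * y - sg σ / 2)))
      (Complex.sqrt ((n : ℂ) / 2 + sg σ * y) *
        Complex.sqrt (((n - 1 : ℤ) : ℂ) / 2 - (y - sg σ / 2) + 1)) := by
  induction σ using units_cases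
  · refine Or.inl ⟨rfl, ?_, ?_, ?_⟩ <;> simp only [sg_one] <;> push_cast
    · rw [mul_comm]; congr 2 <;> ring
    · rw [mul_comm]; congr 2 <;> ring
    · congr 2 <;> ring
  · refine Or.inr ⟨rfl, n / 2 + y, n / 2 - y, by ring, ?_, ?_, ?_, ?_⟩ <;>
      simp only [sg_neg, sg_one] <;> push_cast
    · rw [show ((n : ℂ) + 1) / 2 + (y - -1 / 2) = n / 2 - -1 * y + 1 by ring, csqrt_mul_self]; ring
    · rw [show ((n : ℂ) - 1) / 2 - (-1 * y - -1 / 2) + 1 = n / 2 + y by ring, csqrt_mul_self]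
    · rw [show ((n : ℂ) + 1) / 2 + (-1 * y - -1 / 2) = n / 2 - y + 1 by ring, csqrt_mul_self]
    · rw [show ((n : ℂ) - 1) / 2 - (y - -1 / 2) + 1 = n / 2 + -1 * y by ring, csqrt_mul_self]; ring

theorem upS_mul_upS_comm {σ τ : ℤˣ} {κ x y} {n : ℤ} :
    upS (sg σ * sg τ * κ) (sg σ * x) (sg τ * y) n * upS κ (x - sg σ / 2) (y - sg τ / 2) (n + 1) =
      upS κ x y n * upS (sg σ * sg τ * κ) (sg σ * x - sg σ / 2) (sg τ * y - sg τ / 2) (n + 1) := by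
  have h1 : (√((n : ℝ) / 2 - sg σ * x + 1) : ℂ) *
        (√(((n + 1 : ℤ) : ℝ) / 2 - (x - sg σ / 2) + 1) : ℂ) =
      (√((n : ℝ) / 2 - x + 1) : ℂ) *
        (√(((n + 1 : ℤ) : ℝ) / 2 - (sg σ * x - sg σ / 2) + 1) : ℂ) := by
    induction σ using units_cases <;> simp only [sg_one, sg_neg, one_mul, neg_one_mul]
    rw [mul_comm]; push_cast; congr 3; all_goals ring_nf
  have h2 : Complex.sqrt ((n : ℂ) / 2 - sg τ * y + 1) *
        Complex.sqrt (((n + 1 : ℤ) : ℂ) / 2 - (y - sg τ / 2) + 1) =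
      Complex.sqrt ((n : ℂ) / 2 - y + 1) *
        Complex.sqrt (((n + 1 : ℤ) : ℂ) / 2 - (sg τ * y - sg τ / 2) + 1) := by
    induction τ using units_cases <;> simp only [sg_one, sg_neg, Complex.ofReal_neg,
      Complex.ofReal_one, one_mul, neg_one_mul]
    rw [mul_comm]; push_cast; congr 2 <;> ring
  rw [upS, upS, upS, upS, div_mul_div_comm, div_mul_div_comm]
  congr 1
  linear_combination (sg σ * sg τ * κ ^ 2) *
    (Complex.sqrt ((n : ℂ) / 2 - sg τ * y + 1) *
        Complex.sqrt (((n + 1 : ℤ) : ℂ) / 2 - (y - sg τ / 2) + 1) * h1 +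
      ((√((n : ℝ) / 2 - x + 1) : ℂ) *
        (√(((n + 1 : ℤ) : ℝ) / 2 - (sg σ * x - sg σ / 2) + 1) : ℂ)) * h2)

theorem dnS_mul_dnS_comm {σ τ : ℤˣ} {x y} {n : ℤ} :
    dnS (sg σ * x) (sg τ * y) n * dnS (x - sg σ / 2) (y - sg τ / 2) (n - 1) =
      dnS x y n * dnS (sg σ * x - sg σ / 2) (sg τ * y - sg τ / 2) (n - 1) := by
  have h1 : (√((n : ℝ) / 2 + sg σ * x) : ℂ) *
        (√(((n - 1 : ℤ) : ℝ) / 2 + (x - sg σ / 2)) : ℂ) =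
      (√((n : ℝ) / 2 + x) : ℂ) *
        (√(((n - 1 : ℤ) : ℝ) / 2 + (sg σ * x - sg σ / 2)) : ℂ) := by
    induction σ using units_cases <;> simp only [sg_one, sg_neg, one_mul, neg_one_mul]
    rw [mul_comm]; push_cast; congr 3; all_goals ring_nf
  have h2 : Complex.sqrt ((n : ℂ) / 2 + sg τ * y) *
        Complex.sqrt (((n - 1 : ℤ) : ℂ) / 2 + (y - sg τ / 2)) =
      Complex.sqrt ((n : ℂ) / 2 + y) *
        Complex.sqrt (((n - 1 : ℤ) : ℂ) / 2 + (sg τ * y - sg τ / 2)) := by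
    induction τ using units_cases <;> simp only [sg_one, sg_neg, Complex.ofReal_neg,
      Complex.ofReal_one, one_mul, neg_one_mul]
    rw [mul_comm]; push_cast; congr 2 <;> ring
  rw [dnS, dnS, dnS, dnS, div_mul_div_comm, div_mul_div_comm]
  congr 1
  linear_combination
    (Complex.sqrt ((n : ℂ) / 2 + sg τ * y) *
        Complex.sqrt (((n - 1 : ℤ) : ℂ) / 2 + (y - sg τ / 2)) * h1 +
      ((√((n : ℝ) / 2 + x) : ℂ) *
        (√(((n - 1 : ℤ) : ℝ) / 2 + (sg σ * x - sg σ / 2)) : ℂ)) * h2)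

theorem upS_mul_dnS {κ x y x' y'} {n : ℤ} (hn : 0 ≤ n) :
    upS κ x y n * dnS x' y' (n + 1) =
      κ * (((√((n : ℝ) / 2 - x + 1) : ℂ) * (√(((n + 1 : ℤ) : ℝ) / 2 + x') : ℂ)) *
        (Complex.sqrt ((n : ℂ) / 2 - y + 1) * Complex.sqrt (((n + 1 : ℤ) : ℂ) / 2 + y'))) /
        ((n + 1) * (n + 2)) := by
  have hn0 : (0 : ℝ) ≤ n := by exact_mod_cast hn
  have s1 := ofReal_sqrt_sq (x := n + 1) (by linarith)
  have s2 := ofReal_sqrt_sq (x := n + 2) (by linarith)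
  push_cast at s1 s2
  rw [upS, dnS_eq (r := n + 1) (r' := n + 2) rfl rfl (by push_cast; ring) (by push_cast; ring),
    ← s1, ← s2, div_mul_div_comm]
  congr 1 <;> ring

theorem dnS_mul_upS {κ x y x' y'} {n : ℤ} (hn : 0 ≤ n) :
    dnS x' y' n * upS κ x y (n - 1) =
      κ * (((√((n : ℝ) / 2 + x') : ℂ) * (√(((n - 1 : ℤ) : ℝ) / 2 - x + 1) : ℂ)) *
        (Complex.sqrt ((n : ℂ) / 2 + y') * Complex.sqrt (((n - 1 : ℤ) : ℂ) / 2 - y + 1))) /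
        (n * (n + 1)) := by
  have hn0 : (0 : ℝ) ≤ n := by exact_mod_cast hn
  have s1 := ofReal_sqrt_sq (x := n + 1) (by linarith)
  have s0 := ofReal_sqrt_sq (x := n) (by linarith)
  push_cast at s1 s0
  rw [dnS, upS_eq (r := n) (r' := n + 1) rfl rfl (by push_cast; ring) (by push_cast; ring),
    div_mul_div_comm]
  congr 1
  · ring
  · linear_combination (√((n : ℝ) + 1) : ℂ) ^ 2 * s0 + n * s1

theorem Quad.symm_diff {n κ : ℂ} {σ τ : ℤˣ} {L₁ L₂ L₃ L₄ R₁ R₂ R₃ R₄ : ℂ}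
    (hL : Quad n σ L₁ L₂ L₃ L₄) (hR : Quad n τ R₁ R₂ R₃ R₄) (n0 : n ≠ 0) (n1 : n + 1 ≠ 0)
    (n2 : n + 2 ≠ 0) :
    sg σ * sg τ * κ * (L₁ * R₁) / ((n + 1) * (n + 2)) -
        sg σ * sg τ * κ * (L₂ * R₂) / (n * (n + 1)) =
      κ * (L₃ * R₃) / ((n + 1) * (n + 2)) - κ * (L₄ * R₄) / (n * (n + 1)) := by
  rcases hL with ⟨rfl, rfl, rfl, rfl⟩ | ⟨rfl, a, b, rfl, rfl, rfl, rfl, rfl⟩ <;>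
    rcases hR with ⟨rfl, rfl, rfl, rfl⟩ | ⟨rfl, c, d, h, rfl, rfl, rfl, rfl⟩ <;>
    simp only [sg_one, sg_neg, Complex.ofReal_neg, Complex.ofReal_one]
  · ring
  · subst h; field_simp; ring
  · field_simp; ring
  · obtain rfl : R₄ = L₂ + L₄ - R₂ := by linear_combination h
    field_simp; ring

theorem Quad.commutator {n κ : ℂ} {σ τ : ℤˣ} {L₁ L₂ L₃ L₄ R₁ R₂ R₃ R₄ : ℂ}
    (hL : Quad n σ L₁ L₂ L₃ L₄) (hR : Quad n τ R₁ R₂ R₃ R₄) (n1 : n + 1 ≠ 0)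
    (n2 : n + 2 ≠ 0) (h0 : n = 0 → L₂ = 0) :
    n * (sg σ * sg τ * κ * (L₁ * R₁) / ((n + 1) * (n + 2)) -
        sg σ * sg τ * κ * (L₂ * R₂) / (n * (n + 1))) +
      sg σ * sg τ * κ * (L₁ * R₁) / ((n + 1) * (n + 2)) + κ * (L₃ * R₃) / ((n + 1) * (n + 2)) =
      if σ = -1 ∧ τ = -1 then κ else 0 := by
  by_cases n0 : n = 0
  · have h0 := h0 n0
    rcases hL with ⟨rfl, rfl, rfl, rfl⟩ | ⟨rfl, a, b, h, rfl, rfl, rfl, rfl⟩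
    · simp [h0]
    · obtain rfl : L₄ = 0 := by rw [h0, n0] at h; simpa using h
      rcases hR with ⟨rfl, rfl, rfl, rfl⟩ | ⟨rfl, c, d, h, rfl, rfl, rfl, rfl⟩
      · simp [h0, n0]
        ring
      · obtain rfl : R₄ = -R₂ := by rw [n0] at h; linear_combination h
        simp [h0, n0]
        ring
  · rcases hL with ⟨rfl, rfl, rfl, rfl⟩ | ⟨rfl, a, b, rfl, rfl, rfl, rfl, rfl⟩ <;>
    rcases hR with ⟨rfl, rfl, rfl, rfl⟩ | ⟨rfl, c, d, h, rfl, rfl, rfl, rfl⟩ <;>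
    simp [-mul_eq_zero, -neg_mul]
    · field_simp; ring
    · subst h; field_simp; ring
    · field_simp; ring
    · obtain rfl : R₄ = L₂ + L₄ - R₂ := by linear_combination h
      field_simp; ring

/-- The commutator of two doublet operators on a state of degree not below the lowest one. -/
theorem dbl_upS_dnS_commutator {σ τ : ℤˣ} {κ : ℂ} {x : ℝ} {y : ℂ} {p q : ℕ} {n : ℤ}
    (hn : n = p + q) (h1 : 0 ≤ (n : ℝ) / 2 + x) (h2 : 0 ≤ (n : ℝ) / 2 - x) (s t : ℤˣ) :
    dbl (upS κ (x - sg σ / 2) (y - sg τ / 2)) (dnS (x - sg σ / 2) (y - sg τ / 2)) s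
        (dbl (upS (sg σ * sg τ * κ) (sg σ * x) (sg τ * y)) (dnS (sg σ * x) (sg τ * y)) t
          (occ p q)) -
      dbl (upS (sg σ * sg τ * κ) (sg σ * x - sg σ / 2) (sg τ * y - sg τ / 2))
        (dnS (sg σ * x - sg σ / 2) (sg τ * y - sg τ / 2)) t
        (dbl (upS κ x y) (dnS x y) s (occ p q)) =
      (if σ = -1 ∧ τ = -1 ∧ t = -s then sg s * κ else 0) • occ p q := by
  have hn0 : 0 ≤ n := by omega
  have n1 : (n + 1 : ℂ) ≠ 0 := by exact_mod_cast (by omega : n + 1 ≠ 0)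
  have n2 : (n + 2 : ℂ) ≠ 0 := by exact_mod_cast (by omega : n + 2 ≠ 0)
  have hx0 : n = 0 → x = 0 := fun h => by
    rw [h] at h1 h2
    simp at h1 h2
    linarith
  have hL := quad_real σ h1 h2
  have hR := quad_complex τ y n
  rw [dbl_commutator (κ := if σ = -1 ∧ τ = -1 then κ else 0) hn upS_mul_upS_comm dnS_mul_dnS_comm]
  · by_cases hst : t = -s <;> by_cases hσ : σ = -1 <;> by_cases hτ : τ = -1 <;>
      simp [hst, hσ, hτ]
  · intro h0
    rw [upS_mul_dnS hn0, upS_mul_dnS hn0, dnS_mul_upS hn0, dnS_mul_upS hn0]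
    exact hL.symm_diff hR (by exact_mod_cast h0) n1 n2
  · rw [upS_mul_dnS hn0, upS_mul_dnS hn0, dnS_mul_upS hn0]
    refine hL.commutator hR n1 n2 fun h => ?_
    have h : n = 0 := by exact_mod_cast h
    rw [h, hx0 h]
    simp

/-! ### The group `SU(2)` -/

section

open scoped Nat

/-- `SU(2)` on the Fock space, with the matrix elements of the modules `V_{λ,ρ}`. -/
def fockSU2 (k : Matrix (Fin 2) (Fin 2) ℂ) : Fock →ₗ[ℂ] Fock :=
  onOcc fun p q => ∑ p' ∈ Finset.range (p + q + 1), wigner k p q p' • occ p' (p + q - p')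

theorem actSU2_eq (l : ℤ) (ρ : ℂ) (k : Matrix.specialUnitaryGroup (Fin 2) ℂ) (v : V l ρ) :
    actSU2 l ρ k v = proj l ρ (fockSU2 k (emb l ρ v)) := by
  suffices h : actSU2 l ρ k = proj l ρ ∘ₗ fockSU2 k ∘ₗ emb l ρ from LinearMap.congr_fun h v
  refine V.hom_ext fun p q h => ?_
  rw [LinearMap.comp_apply, LinearMap.comp_apply, emb_ket_of_mem h, fockSU2, onOcc_occ, actSU2,
    onKets_ket _ h (mem_weights p q), map_sum]
  have e1 : ⌊2 * (((p : ℝ) + q) / 2)⌋₊ = p + q := by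
    rw [show 2 * (((p : ℝ) + q) / 2) = ((p + q : ℕ) : ℝ) by push_cast; ring, Nat.floor_natCast]
  have e2 : ⌊((p : ℝ) + q) / 2 + ((p : ℝ) - q) / 2⌋₊ = p := by
    rw [show ((p : ℝ) + q) / 2 + ((p : ℝ) - q) / 2 = p by ring, Nat.floor_natCast]
  have e3 : ⌊((p : ℝ) + q) / 2 - ((p : ℝ) - q) / 2⌋₊ = q := by
    rw [show ((p : ℝ) + q) / 2 - ((p : ℝ) - q) / 2 = q by ring, Nat.floor_natCast]
  rw [e1, e2, e3]
  refine Finset.sum_congr rfl fun p' hp' => ?_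
  have hp' : p' ≤ p + q := by simpa [Nat.lt_succ_iff] using hp'
  rw [map_smul, proj_occ, Nat.cast_sub hp']
  congr 2 <;> push_cast <;> ring

theorem degOp_fockSU2 (ψ : ℤ → ℂ) (k : Matrix (Fin 2) (Fin 2) ℂ) (v : Fock) :
    degOp ψ (fockSU2 k v) = fockSU2 k (degOp ψ v) := by
  suffices h : degOp ψ ∘ₗ fockSU2 k = fockSU2 k ∘ₗ degOp ψ from LinearMap.congr_fun h v
  refine Fock.hom_ext fun p q => ?_
  rw [LinearMap.comp_apply, LinearMap.comp_apply, degOp_occ, map_smul, fockSU2, onOcc_occ, map_sum,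
    Finset.smul_sum]
  refine Finset.sum_congr rfl fun p' hp' => ?_
  have hp' : p' ≤ p + q := by simpa [Nat.lt_succ_iff] using hp'
  rw [map_smul, degOp_occ, smul_comm, Nat.cast_sub hp']
  congr 2
  push_cast
  ring

theorem emb_actSU2 (l : ℤ) (ρ : ℂ) (k : Matrix.specialUnitaryGroup (Fin 2) ℂ) (v : V l ρ) :
    emb l ρ (actSU2 l ρ k v) = fockSU2 k (emb l ρ v) := by
  rw [actSU2_eq, emb_proj, degOp_fockSU2, ← emb_proj, proj_emb]

theorem actSU2_proj (l : ℤ) (ρ : ℂ) (k : Matrix.specialUnitaryGroup (Fin 2) ℂ) (w : Fock) :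
    actSU2 l ρ k (proj l ρ w) = proj l ρ (fockSU2 k w) := by
  rw [actSU2_eq, emb_proj, ← degOp_fockSU2, ← emb_proj, proj_emb]

/-- The homogeneous polynomial of degree `n` with dehomogenisation `Q`, as a Fock vector. -/
def polyVec (n : ℕ) (Q : Polynomial ℂ) : Fock :=
  ∑ i ∈ Finset.range (n + 1), (Q.coeff i * (√((i ! : ℝ) * ((n - i) ! : ℝ)) : ℂ)) • occ i (n - i)

theorem polyVec_add (n : ℕ) (P Q : Polynomial ℂ) :
    polyVec n (P + Q) = polyVec n P + polyVec n Q := by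
  simp [polyVec, add_mul, add_smul, Finset.sum_add_distrib]

theorem polyVec_C_mul (n : ℕ) (c : ℂ) (Q : Polynomial ℂ) :
    polyVec n (Polynomial.C c * Q) = c • polyVec n Q := by
  simp [polyVec, Finset.smul_sum, smul_smul, mul_assoc]

theorem polyVec_zero (n : ℕ) : polyVec n 0 = 0 := by simp [polyVec]

theorem sqrt_factorial_succ_mul (i m : ℕ) :
    √(((i + 1) ! : ℝ) * (m : ℝ)) = √((i ! : ℝ) * (m : ℝ)) * √((i : ℝ) + 1) := by
  rw [← Real.sqrt_mul (by positivity), Nat.factorial_succ]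
  congr 1
  push_cast
  ring

theorem cre_one_polyVec (n : ℕ) (Q : Polynomial ℂ) :
    cre 1 (polyVec n Q) = polyVec (n + 1) (Polynomial.X * Q) := by
  rw [polyVec, polyVec, Finset.sum_range_succ' _ (n + 1), map_sum]
  simp only [Polynomial.coeff_X_mul_zero, zero_mul, zero_smul, add_zero]
  refine Finset.sum_congr rfl fun i _ => ?_
  rw [map_smul, cre_one_occ, smul_smul, Polynomial.coeff_X_mul, Nat.add_sub_add_right,
    sqrt_factorial_succ_mul]
  congr 1
  push_cast
  ring

theorem cre_neg_one_polyVec {n : ℕ} {Q : Polynomial ℂ} (hQ : Q.natDegree ≤ n) :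
    cre (-1) (polyVec n Q) = polyVec (n + 1) Q := by
  rw [polyVec, polyVec, Finset.sum_range_succ _ (n + 1), map_sum,
    Polynomial.coeff_eq_zero_of_natDegree_lt (Nat.lt_succ_of_le hQ)]
  simp only [zero_mul, zero_smul, add_zero]
  refine Finset.sum_congr rfl fun i hi => ?_
  have hi : i ≤ n := by simpa [Nat.lt_succ_iff] using hi
  rw [map_smul, cre_neg_one_occ, smul_smul, Nat.succ_sub hi, mul_comm (i ! : ℝ),
    mul_comm (i ! : ℝ), sqrt_factorial_succ_mul]
  congr 1
  push_cast
  ring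

theorem ann_polyVec_zero (s : ℤˣ) (Q : Polynomial ℂ) : ann s (polyVec 0 Q) = 0 := by
  have : ann s (occ 0 0) = 0 := ann_occ_eq_zero (by simp [num])
  simp [polyVec, this]

theorem ann_one_polyVec (n : ℕ) (Q : Polynomial ℂ) :
    ann 1 (polyVec (n + 1) Q) = polyVec n (Polynomial.derivative Q) := by
  rw [polyVec, polyVec, Finset.sum_range_succ' _ (n + 1), map_add, map_sum]
  have h0 : ann 1 (occ 0 (n + 1 - 0)) = 0 := ann_occ_eq_zero (by simp [num])
  rw [map_smul, h0, smul_zero, add_zero]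
  refine Finset.sum_congr rfl fun i _ => ?_
  rw [map_smul, ann_one_occ, smul_smul, Polynomial.coeff_derivative, Nat.add_sub_add_right,
    sqrt_factorial_succ_mul, Nat.add_sub_cancel]
  congr 1
  have := ofReal_sqrt_mul_self (x := (i : ℝ) + 1) (by positivity)
  push_cast at this ⊢
  linear_combination (Q.coeff (i + 1) * (√((i ! : ℝ) * ((n - i) ! : ℝ)) : ℂ)) * this

theorem coeff_X_mul_derivative (Q : Polynomial ℂ) (i : ℕ) :
    (Polynomial.X * Polynomial.derivative Q).coeff i = i * Q.coeff i := by
  rcases i with _ | i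
  · simp
  · rw [Polynomial.coeff_X_mul, Polynomial.coeff_derivative]; push_cast; ring

theorem ann_neg_one_polyVec (n : ℕ) (Q : Polynomial ℂ) :
    ann (-1) (polyVec (n + 1) Q) =
      polyVec n (Polynomial.C (n + 1 : ℂ) * Q - Polynomial.X * Polynomial.derivative Q) := by
  rw [polyVec, polyVec, Finset.sum_range_succ _ (n + 1), map_add, map_sum]
  have h0 : ann (-1) (occ (n + 1) (n + 1 - (n + 1))) = 0 := ann_occ_eq_zero (by simp [num])
  rw [map_smul, h0, smul_zero, add_zero]
  refine Finset.sum_congr rfl fun i hi => ?_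
  have hi : i ≤ n := by simpa [Nat.lt_succ_iff] using hi
  rw [map_smul, ann_neg_one_occ, smul_smul, Nat.succ_sub hi, mul_comm (i ! : ℝ),
    mul_comm (i ! : ℝ), sqrt_factorial_succ_mul, Nat.succ_sub_one, Polynomial.coeff_sub,
    Polynomial.coeff_C_mul, coeff_X_mul_derivative]
  congr 1
  have := ofReal_sqrt_mul_self (x := ((n - i : ℕ) : ℝ) + 1) (by positivity)
  rw [Nat.cast_sub hi] at this
  push_cast [Nat.cast_sub hi] at this ⊢
  linear_combination (Q.coeff i * (√(((n - i) ! : ℝ) * (i ! : ℝ)) : ℂ)) * this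

/-- The image of `x^p y^q` under the substitution defined by `k`. -/
def substPoly (k : Matrix (Fin 2) (Fin 2) ℂ) (p q : ℕ) : Polynomial ℂ :=
  (Polynomial.C (k 0 0) * Polynomial.X + Polynomial.C (k 1 0)) ^ p *
    (Polynomial.C (k 0 1) * Polynomial.X + Polynomial.C (k 1 1)) ^ q

theorem natDegree_substPoly (k : Matrix (Fin 2) (Fin 2) ℂ) (p q : ℕ) :
    (substPoly k p q).natDegree ≤ p + q := by
  refine Polynomial.natDegree_mul_le_of_le ?_ ?_
  · simpa using Polynomial.natDegree_pow_le_of_le p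
      (Polynomial.natDegree_linear_le (a := k 0 0) (b := k 1 0))
  · simpa using Polynomial.natDegree_pow_le_of_le q
      (Polynomial.natDegree_linear_le (a := k 0 1) (b := k 1 1))

/-- The factor between `x^p y^q` and the normalised state. -/
def stateNorm (p q : ℕ) : ℂ := (√((p ! : ℝ) * (q ! : ℝ)) : ℂ)⁻¹

theorem fockSU2_occ (k : Matrix (Fin 2) (Fin 2) ℂ) (p q : ℕ) :
    fockSU2 k (occ p q) = stateNorm p q • polyVec (p + q) (substPoly k p q) := by
  rw [fockSU2, onOcc_occ, polyVec, Finset.smul_sum]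
  refine Finset.sum_congr rfl fun i _ => ?_
  rw [smul_smul, wigner, stateNorm, substPoly]
  congr 1
  push_cast
  ring

theorem stateNorm_comm (p q : ℕ) : stateNorm p q = stateNorm q p := by rw [stateNorm, stateNorm, mul_comm]

theorem stateNorm_succ (p q : ℕ) : (√((p : ℝ) + 1) : ℂ) * stateNorm (p + 1) q = stateNorm p q := by
  have := ofReal_sqrt_ne_zero (x := (p : ℝ) + 1) (by positivity)
  rw [stateNorm, stateNorm, sqrt_factorial_succ_mul, Complex.ofReal_mul, mul_inv]
  field_simp

theorem stateNorm_pred (p q : ℕ) :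
    (√((p : ℝ) + 1) : ℂ) * stateNorm p q = (p + 1 : ℂ) * stateNorm (p + 1) q := by
  rw [← stateNorm_succ, ← mul_assoc, ofReal_sqrt_mul_self (by positivity)]
  push_cast
  rfl

/-- The index of a sign in the basis of `F`. -/
def idx (s : ℤˣ) : Fin 2 := if s = 1 then 0 else 1

theorem fockSU2_cre (k : Matrix (Fin 2) (Fin 2) ℂ) (s : ℤˣ) (v : Fock) :
    fockSU2 k (cre s v) =
      k 0 (idx s) • cre 1 (fockSU2 k v) + k 1 (idx s) • cre (-1) (fockSU2 k v) := by
  suffices h : fockSU2 k ∘ₗ cre s =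
      k 0 (idx s) • cre 1 ∘ₗ fockSU2 k + k 1 (idx s) • cre (-1) ∘ₗ fockSU2 k from
    LinearMap.congr_fun h v
  refine Fock.hom_ext fun p q => ?_
  simp only [LinearMap.comp_apply, LinearMap.add_apply, LinearMap.smul_apply, fockSU2_occ,
    map_smul, cre_one_polyVec, cre_neg_one_polyVec (natDegree_substPoly k p q)]
  have e : k 0 (idx s) • stateNorm p q • polyVec (p + q + 1) (Polynomial.X * substPoly k p q) +
      k 1 (idx s) • stateNorm p q • polyVec (p + q + 1) (substPoly k p q) =
      stateNorm p q • polyVec (p + q + 1) (Polynomial.C (k 0 (idx s)) *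
        (Polynomial.X * substPoly k p q) + Polynomial.C (k 1 (idx s)) * substPoly k p q) := by
    rw [polyVec_add, polyVec_C_mul, polyVec_C_mul]
    module
  rw [e]
  induction s using units_cases
  · rw [cre_one_occ, map_smul, fockSU2_occ, smul_smul, stateNorm_succ, Nat.add_right_comm]
    congr 2
    simp only [substPoly, idx, if_true]
    ring
  · rw [cre_neg_one_occ, map_smul, fockSU2_occ, smul_smul, stateNorm_comm, stateNorm_succ, stateNorm_comm,
      ← Nat.add_assoc]
    congr 2
    simp only [substPoly, idx, if_neg (show (-1 : ℤˣ) ≠ 1 by decide)]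
    ring

theorem fockSU2_ann_one (k : Matrix (Fin 2) (Fin 2) ℂ) (p q n : ℕ) (h : p + q = n + 1) :
    fockSU2 k (ann 1 (occ p q)) =
      stateNorm p q • polyVec n (Polynomial.C (p : ℂ) * substPoly k (p - 1) q) := by
  rcases p with _ | p
  · simp [ann_one_occ, polyVec_zero]
  · rw [ann_one_occ, Nat.add_sub_cancel, map_smul, fockSU2_occ, smul_smul, polyVec_C_mul, smul_smul]
    push_cast
    rw [stateNorm_pred, mul_comm, show p + q = n by omega]

theorem fockSU2_ann_neg_one (k : Matrix (Fin 2) (Fin 2) ℂ) (p q n : ℕ) (h : p + q = n + 1) :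
    fockSU2 k (ann (-1) (occ p q)) =
      stateNorm p q • polyVec n (Polynomial.C (q : ℂ) * substPoly k p (q - 1)) := by
  rcases q with _ | q
  · simp [ann_neg_one_occ, polyVec_zero]
  · rw [ann_neg_one_occ, Nat.add_sub_cancel, map_smul, fockSU2_occ, smul_smul, polyVec_C_mul,
      smul_smul]
    push_cast
    rw [stateNorm_comm p q, stateNorm_pred, mul_comm, stateNorm_comm, show p + q = n by omega]

theorem derivative_substPoly (k : Matrix (Fin 2) (Fin 2) ℂ) (p q : ℕ) :
    Polynomial.derivative (substPoly k p q) =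
      Polynomial.C (k 0 0) * (Polynomial.C (p : ℂ) * substPoly k (p - 1) q) +
        Polynomial.C (k 0 1) * (Polynomial.C (q : ℂ) * substPoly k p (q - 1)) := by
  simp only [substPoly, Polynomial.derivative_mul, Polynomial.derivative_pow,
    Polynomial.derivative_add, Polynomial.derivative_C, Polynomial.derivative_X]
  ring

theorem C_mul_substPoly_pred_left (k : Matrix (Fin 2) (Fin 2) ℂ) (p q : ℕ) :
    (Polynomial.C (k 0 0) * Polynomial.X + Polynomial.C (k 1 0)) *
      (Polynomial.C (p : ℂ) * substPoly k (p - 1) q) = Polynomial.C (p : ℂ) * substPoly k p q := by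
  rcases p with _ | p
  · simp
  · rw [Nat.add_sub_cancel, substPoly, substPoly]; ring

theorem C_mul_substPoly_pred_right (k : Matrix (Fin 2) (Fin 2) ℂ) (p q : ℕ) :
    (Polynomial.C (k 0 1) * Polynomial.X + Polynomial.C (k 1 1)) *
      (Polynomial.C (q : ℂ) * substPoly k p (q - 1)) = Polynomial.C (q : ℂ) * substPoly k p q := by
  rcases q with _ | q
  · simp
  · rw [Nat.add_sub_cancel, substPoly, substPoly]; ring

theorem fockSU2_ann {k : Matrix (Fin 2) (Fin 2) ℂ} (hk : k 0 0 * k 1 1 - k 0 1 * k 1 0 = 1)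
    (s : ℤˣ) (v : Fock) :
    (sg s : ℂ) • fockSU2 k (ann (-s) v) =
      k 0 (idx s) • ann (-1) (fockSU2 k v) - k 1 (idx s) • ann 1 (fockSU2 k v) := by
  suffices h : (sg s : ℂ) • fockSU2 k ∘ₗ ann (-s) =
      k 0 (idx s) • ann (-1) ∘ₗ fockSU2 k - k 1 (idx s) • ann 1 ∘ₗ fockSU2 k from
    LinearMap.congr_fun h v
  refine Fock.hom_ext fun p q => ?_
  simp only [LinearMap.comp_apply, LinearMap.sub_apply, LinearMap.smul_apply, fockSU2_occ k p q,
    map_smul]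
  obtain h | ⟨n, h⟩ : p + q = 0 ∨ ∃ n, p + q = n + 1 := by
    rcases hpq : p + q with _ | n
    · exact Or.inl rfl
    · exact Or.inr ⟨n, rfl⟩
  · obtain ⟨rfl, rfl⟩ : p = 0 ∧ q = 0 := by omega
    rw [ann_occ_eq_zero (by simp [num])]
    simp [ann_polyVec_zero]
  have hkC : Polynomial.C (k 0 0) * Polynomial.C (k 1 1) -
      Polynomial.C (k 0 1) * Polynomial.C (k 1 0) = 1 := by
    rw [← Polynomial.C_mul, ← Polynomial.C_mul, ← Polynomial.C_sub, hk, Polynomial.C_1]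
  have hn : Polynomial.C (n + 1 : ℂ) = Polynomial.C (p : ℂ) + Polynomial.C (q : ℂ) := by
    rw [← Polynomial.C_add]; congr 1; exact_mod_cast h.symm
  have hl := C_mul_substPoly_pred_left k p q
  have hr := C_mul_substPoly_pred_right k p q
  rw [h, ann_one_polyVec, ann_neg_one_polyVec, smul_comm, smul_comm (k 1 _), ← smul_sub,
    ← polyVec_C_mul, ← polyVec_C_mul, sub_eq_add_neg, ← neg_one_smul ℂ (polyVec _ _),
    ← polyVec_C_mul, ← polyVec_add, hn, derivative_substPoly]
  have hs : (-1 : ℤˣ) ≠ 1 := by decide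
  induction s using units_cases
  · rw [fockSU2_ann_neg_one k p q n h, sg_one, Complex.ofReal_one, one_smul]
    congr 2
    simp only [idx, if_true, Polynomial.C_neg, Polynomial.C_1]
    generalize Polynomial.C (p : ℂ) * substPoly k (p - 1) q = L at *
    generalize Polynomial.C (q : ℂ) * substPoly k p (q - 1) = R at *
    linear_combination (-R) * hkC + Polynomial.C (k 0 0) * (hl + hr)
  · rw [neg_neg, fockSU2_ann_one k p q n h, smul_comm, ← polyVec_C_mul]
    congr 2
    simp only [idx, if_neg hs, sg_neg, sg_one, Complex.ofReal_neg, Complex.ofReal_one,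
      Polynomial.C_neg, Polynomial.C_1]
    generalize Polynomial.C (p : ℂ) * substPoly k (p - 1) q = L at *
    generalize Polynomial.C (q : ℂ) * substPoly k p (q - 1) = R at *
    linear_combination L * hkC + Polynomial.C (k 0 1) * (hl + hr)

theorem fockSU2_dbl {k : Matrix (Fin 2) (Fin 2) ℂ} (hk : k 0 0 * k 1 1 - k 0 1 * k 1 0 = 1)
    (f g : ℤ → ℂ) (s : ℤˣ) (v : Fock) :
    fockSU2 k (dbl f g s v) =
      k 0 (idx s) • dbl f g 1 (fockSU2 k v) + k 1 (idx s) • dbl f g (-1) (fockSU2 k v) := by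
  simp only [dbl, LinearMap.add_apply, LinearMap.smul_apply, LinearMap.comp_apply, map_add,
    map_smul, fockSU2_cre, fockSU2_ann hk, degOp_fockSU2, neg_neg, sg_neg, sg_one]
  push_cast
  module

end

/-! ### Infinite-dimensional modules -/

theorem abs_lam (l : ℤ) : |lam l| = ((|l| : ℤ) : ℝ) / 2 := by
  rw [lam, abs_div, abs_two, Int.cast_abs]

theorem admissible_of_mem_spins {l n : ℤ} {ρ : ℂ} (h : (n : ℝ) / 2 ∈ spins l ρ) :
    |l| ≤ n ∧ Even (n - l) := by
  obtain ⟨k, hk, -⟩ := h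
  rw [abs_lam] at hk
  have h' : n = |l| + 2 * k := by
    have : (n : ℝ) = (|l| : ℤ) + 2 * k := by linarith
    exact_mod_cast this
  refine ⟨by omega, ?_⟩
  rcases abs_choice l with h | h
  · exact ⟨k, by omega⟩
  · exact ⟨k - l, by omega⟩

theorem exists_of_admissible {l n : ℤ} (h : |l| ≤ n) (hp : Even (n - l)) :
    ∃ k : ℕ, n = |l| + 2 * k := by
  obtain ⟨i, hi⟩ := hp
  rcases abs_choice l with h' | h'
  · exact ⟨i.toNat, by omega⟩
  · exact ⟨(i + l).toNat, by omega⟩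

theorem csqrt_eq_zero {z : ℂ} : Complex.sqrt z = 0 ↔ z = 0 := by
  rw [← pow_eq_zero_iff two_ne_zero, csqrt_sq]

theorem Pplus_eq_zero_iff (l : ℤ) (ρ : ℂ) (k : ℕ) :
    Pplus l ρ (|lam l| + k) = 0 ↔ ρ ^ 2 = ((|lam l| + k + 1 : ℝ) : ℂ) ^ 2 := by
  have h := abs_nonneg (lam l)
  have h1 := le_abs_self (lam l)
  have h2 := neg_abs_le (lam l)
  have hk : (0 : ℝ) ≤ k := k.cast_nonneg
  rw [Pplus, Pminus]
  have e1 := ofReal_sqrt_ne_zero (x := |lam l| + k + 1 + lam l) (by linarith)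
  have e2 := ofReal_sqrt_ne_zero (x := |lam l| + k + 1 - lam l) (by linarith)
  have e3 := ofReal_sqrt_ne_zero (x := 2 * (|lam l| + k + 1) + 1) (by linarith)
  have e4 := ofReal_sqrt_ne_zero (x := 2 * (|lam l| + k + 1) - 1) (by linarith)
  have e5 : ((|lam l| + k + 1 : ℝ) : ℂ) ≠ 0 := by
    rw [Complex.ofReal_ne_zero]; positivity
  rw [div_eq_zero_iff, or_iff_left (mul_ne_zero (mul_ne_zero e5 e3) e4), mul_assoc,
    mul_eq_zero, or_iff_right (mul_ne_zero e1 e2), mul_eq_zero, csqrt_eq_zero, csqrt_eq_zero,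
    ← mul_eq_zero]
  generalize ((|lam l| + k + 1 : ℝ) : ℂ) = z
  constructor <;> intro h <;> linear_combination -h

theorem InfDim.Pplus_ne_zero {l : ℤ} {ρ : ℂ} (h : InfDim l ρ) (k : ℕ) :
    Pplus l ρ (|lam l| + k) ≠ 0 := by
  intro h0
  refine h ?_
  have hfin : {s : ℝ × ℝ | s.1 ∈ spins l ρ ∧ s.2 ∈ weights s.1}.Finite := by
    refine ((Finset.range (l.natAbs + 2 * k + 1) ×ˢ
      Finset.range (l.natAbs + 2 * k + 1)).finite_toSet.image
        fun x : ℕ × ℕ => (((x.1 : ℝ) + x.2) / 2, ((x.1 : ℝ) - x.2) / 2)).subset ?_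
    rintro ⟨j, m⟩ ⟨hj, hm⟩
    obtain ⟨p, q, rfl, rfl⟩ := exists_occupation hj hm
    refine ⟨(p, q), ?_, rfl⟩
    obtain ⟨i, hi, hz⟩ := hj
    have hik : i ≤ k := by
      by_contra! hlt
      exact hz k hlt h0
    rw [abs_lam] at hi
    have : (p : ℤ) + q = |l| + 2 * i := by
      have : ((p : ℝ) + q) = (|l| : ℤ) + 2 * i := by linarith
      exact_mod_cast this
    simp only [Finset.coe_product, Set.mem_prod, Finset.coe_range, Set.mem_Iio]
    have := Int.natCast_natAbs l
    omega
  have : Finite (State l ρ) := hfin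
  infer_instance

theorem infDim_of_Pplus_ne_zero {l : ℤ} {ρ : ℂ} (h : ∀ k : ℕ, Pplus l ρ (|lam l| + k) ≠ 0) :
    InfDim l ρ := by
  intro hfin
  have : Finite (State l ρ) :=
    Module.Finite.finite_basis (Finsupp.basisSingleOne (R := ℂ) (ι := State l ρ))
  let f : ℕ → State l ρ := fun k =>
    ⟨(|lam l| + k, -(|lam l| + k)), ⟨k, rfl, fun i _ => h i⟩, 0, by simp, by
      have := abs_nonneg (lam l)
      have : (0 : ℝ) ≤ k := k.cast_nonneg
      dsimp only
      linarith⟩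
  refine not_injective_infinite_finite f fun a b hab => ?_
  have := congrArg (fun s : State l ρ => s.1.1) hab
  simpa [f] using this

theorem InfDim.mem_spins {l n : ℤ} {ρ : ℂ} (h : InfDim l ρ) (hn : |l| ≤ n) (hp : Even (n - l)) :
    (n : ℝ) / 2 ∈ spins l ρ := by
  obtain ⟨k, rfl⟩ := exists_of_admissible hn hp
  refine ⟨k, ?_, fun i _ => h.Pplus_ne_zero i⟩
  rw [abs_lam]
  push_cast
  ring

theorem InfDim.shift {l l' : ℤ} {ρ ρ' : ℂ} {ε A : ℤˣ} (h : InfDim l ρ)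
    (hne : ρ ^ 2 ≠ (lam l : ℂ) ^ 2) (hl : l' = l - ε) (hρ : ρ' = ρ - sg ε * sg A / 2) :
    InfDim l' ρ' := by
  refine infDim_of_Pplus_ne_zero fun k hk => ?_
  rw [Pplus_eq_zero_iff] at hk
  have habs : |l'| = |l| + 1 ∨ |l'| = |l| - 1 := by
    have : (ε : ℤ) = 1 ∨ (ε : ℤ) = -1 := by
      induction ε using units_cases <;> simp
    rw [hl]
    rcases abs_cases l with h1 | h1 <;> rcases abs_cases (l - ε) with h2 | h2 <;> omega
  have key : ∃ i : ℕ, ρ ^ 2 = ((|lam l| + i : ℝ) : ℂ) ^ 2 := by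
    obtain ⟨η, hη⟩ : ∃ η : ℤˣ, ρ' = sg η * ((|lam l'| + k + 1 : ℝ) : ℂ) := by
      rcases sq_eq_sq_iff_eq_or_eq_neg.1 hk with h | h
      · exact ⟨1, by rw [h]; simp⟩
      · exact ⟨-1, by rw [h]; simp⟩
    have hsq : ρ ^ 2 = ((|lam l'| + k + 1 + sg (η * ε * A) / 2 : ℝ) : ℂ) ^ 2 := by
      have h1 : ρ = ρ' + sg ε * sg A / 2 := by rw [hρ]; ring
      rw [h1, hη]
      generalize |lam l'| = z
      induction η using units_cases <;> induction ε using units_cases <;>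
        induction A using units_cases <;> simp <;> ring
    rw [hsq]
    have hs : (η * ε * A : ℤˣ) = 1 ∨ (η * ε * A : ℤˣ) = -1 := Int.units_eq_one_or _
    rw [abs_lam, abs_lam]
    rcases habs with h1 | h1 <;> rcases hs with h2 | h2 <;> rw [h1, h2]
    · exact ⟨k + 2, by push_cast [sg_one]; ring⟩
    · exact ⟨k + 1, by push_cast [sg_neg, sg_one]; ring⟩
    · exact ⟨k + 1, by push_cast [sg_one]; ring⟩
    · exact ⟨k, by push_cast [sg_neg, sg_one]; ring⟩
  obtain ⟨i, hi⟩ := key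
  rcases i with _ | i
  · refine hne ?_
    rw [hi, Nat.cast_zero, add_zero, ← Complex.ofReal_pow, sq_abs, Complex.ofReal_pow]
  · refine h.Pplus_ne_zero i ((Pplus_eq_zero_iff l ρ i).2 ?_)
    rw [hi]
    push_cast
    ring

/-! ### The doublet operators between the modules -/

/-- The doublet operator on the Fock space attached to the index `(λ,ρ)`. -/
def fockDbl (A ε : ℤˣ) (l : ℤ) (ρ : ℂ) (s : ℤˣ) : Fock →ₗ[ℂ] Fock :=
  dbl (upS (Complex.I * sg A) (sg ε * lam l) (sg ε * sg A * ρ))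
    (dnS (sg ε * lam l) (sg ε * sg A * ρ)) s

/-- The multiple by `c` of the doublet operator from `V_{λ,ρ}` to `V_{λ',ρ'}`. -/
def dblOp (c : ℂ) (A ε : ℤˣ) (l : ℤ) (ρ : ℂ) (l' : ℤ) (ρ' : ℂ) (s : ℤˣ) : V l ρ →ₗ[ℂ] V l' ρ' :=
  c • proj l' ρ' ∘ₗ fockDbl A ε l ρ s ∘ₗ emb l ρ

theorem dblOp_apply (c : ℂ) (A ε : ℤˣ) (l : ℤ) (ρ : ℂ) (l' : ℤ) (ρ' : ℂ) (s : ℤˣ) (v : V l ρ) :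
    dblOp c A ε l ρ l' ρ' s v = c • proj l' ρ' (fockDbl A ε l ρ s (emb l ρ v)) := rfl

theorem emb_ext {l : ℤ} {ρ : ℂ} {W : Type} [AddCommGroup W] [Module ℂ W] {f g : Fock →ₗ[ℂ] W}
    (h : ∀ p q : ℕ, |l| ≤ (p + q : ℤ) → Even ((p + q : ℤ) - l) → f (occ p q) = g (occ p q))
    (v : V l ρ) : f (emb l ρ v) = g (emb l ρ v) := by
  suffices h : f ∘ₗ emb l ρ = g ∘ₗ emb l ρ from LinearMap.congr_fun h v
  refine V.hom_ext fun p q hj => ?_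
  rw [LinearMap.comp_apply, LinearMap.comp_apply, emb_ket_of_mem hj]
  have := admissible_of_mem_spins (n := p + q) (l := l) (ρ := ρ) (by push_cast; exact hj)
  exact h p q this.1 this.2

/-- An infinite-dimensional target does not truncate the doublet operators. -/
theorem emb_proj_fockDbl {A ε : ℤˣ} {l l' : ℤ} {ρ ρ' : ℂ} (h' : InfDim l' ρ') (hl : l' = l - ε)
    (s : ℤˣ) (v : V l ρ) :
    emb l' ρ' (proj l' ρ' (fockDbl A ε l ρ s (emb l ρ v))) = fockDbl A ε l ρ s (emb l ρ v) := by
  rw [emb_proj]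
  refine emb_ext (f := degOp (ind l' ρ') ∘ₗ fockDbl A ε l ρ s) (fun p q hn hp => ?_) v
  have h := hasDeg_occ p q
  rw [LinearMap.comp_apply, fockDbl, dbl_apply s h, map_add, map_smul, map_smul, (h.cre s) _,
    (h.ann (-s)) _]
  generalize (p + q : ℤ) = n at *
  have hε : (ε : ℤ) = 1 ∨ (ε : ℤ) = -1 := by
    induction ε using units_cases <;> simp
  have hpar : Even (n + 1 - l') ∧ Even (n - 1 - l') := by
    obtain ⟨k, hk⟩ := hp
    rcases hε with h | h
    · exact ⟨⟨k + 1, by omega⟩, ⟨k, by omega⟩⟩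
    · exact ⟨⟨k, by omega⟩, ⟨k - 1, by omega⟩⟩
  have hle : |l'| ≤ n + 1 := by
    rw [hl]
    have := abs_le.1 hn
    exact abs_le.2 (by omega)
  rw [ind_of_mem (h'.mem_spins hle hpar.1), one_smul]
  by_cases hd : |l'| ≤ n - 1
  · rw [ind_of_mem (h'.mem_spins hd hpar.2), one_smul]
  · have hnl : (n : ℤ) + ε * l = 0 := by
      obtain ⟨k, hk⟩ := hpar.2
      rw [hl] at hd hk
      have h1 := abs_le.1 hn
      rcases hε with h | h <;> rw [h] at hd hk ⊢ <;>
        rcases abs_cases (l - (1 : ℤ)) with h2 | h2 <;>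
        rcases abs_cases (l - (-1 : ℤ)) with h3 | h3 <;> omega
    have h0 : (n : ℝ) / 2 + sg ε * lam l = 0 := by
      rw [lam, sg, ← mul_div_assoc, ← add_div]
      have : ((n : ℝ) + ((ε : ℤ) : ℝ) * l) = 0 := by exact_mod_cast hnl
      rw [this, zero_div]
    have : dnS (sg ε * lam l) (sg ε * sg A * ρ) n = 0 := by simp [dnS, h0]
    simp [this]

theorem sg_mul (s t : ℤˣ) : sg (s * t) = sg s * sg t := by simp [sg]

theorem fockDbl_commutator {A B ε ε' : ℤˣ} {l l₁ l₂ : ℤ} {ρ ρ₁ ρ₂ : ℂ}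
    (hl₁ : l₁ = l - ε') (hρ₁ : ρ₁ = ρ - sg ε' * sg B / 2)
    (hl₂ : l₂ = l - ε) (hρ₂ : ρ₂ = ρ - sg ε * sg A / 2) (s t : ℤˣ) (v : V l ρ) :
    fockDbl A ε l₁ ρ₁ s (fockDbl B ε' l ρ t (emb l ρ v)) -
        fockDbl B ε' l₂ ρ₂ t (fockDbl A ε l ρ s (emb l ρ v)) =
      (if ε' = -ε ∧ B = A ∧ t = -s then sg s * (Complex.I * sg A) else 0) • emb l ρ v := by
  refine emb_ext (f := fockDbl A ε l₁ ρ₁ s ∘ₗ fockDbl B ε' l ρ t -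
    fockDbl B ε' l₂ ρ₂ t ∘ₗ fockDbl A ε l ρ s)
    (g := (if ε' = -ε ∧ B = A ∧ t = -s then sg s * (Complex.I * sg A) else 0) • LinearMap.id)
    (fun p q hn hp => ?_) v
  have hb := half_add_lam_nonneg hn ε
  have H := dbl_upS_dnS_commutator (σ := ε * ε') (τ := ε * A * ε' * B) (κ := Complex.I * sg A)
    (y := sg ε * sg A * ρ) (p := p) (q := q) rfl hb.1 hb.2 s t
  have hε := sg_sq ε
  have hA := sg_sq A
  have hεr := sg_sq_real ε
  have e1 : (sg (ε * ε') * sg (ε * A * ε' * B) * (Complex.I * sg A) : ℂ) = Complex.I * sg B := by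
    have hε' := sg_sq ε'
    simp only [sg_mul]
    push_cast
    linear_combination (Complex.I * sg B) * (hε * sg ε' ^ 2 * sg A ^ 2 + hε' * sg A ^ 2 + hA)
  have e2 : sg (ε * ε') * (sg ε * lam l) = sg ε' * lam l := by
    rw [sg_mul]; linear_combination (sg ε' * lam l) * hεr
  have e3 : (sg (ε * A * ε' * B) * (sg ε * sg A * ρ) : ℂ) = sg ε' * sg B * ρ := by
    simp only [sg_mul]
    push_cast
    linear_combination (sg ε' * sg B * ρ) * (hε * sg A ^ 2 + hA)
  have e4 : sg ε * lam l - sg (ε * ε') / 2 = sg ε * lam l₁ := by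
    rw [hl₁, sg_mul_lam_sub, sg_mul]
  have e5 : (sg ε * sg A * ρ - sg (ε * A * ε' * B) / 2 : ℂ) = sg ε * sg A * ρ₁ := by
    rw [hρ₁]; simp only [sg_mul]; push_cast; ring
  have e6 : sg ε' * lam l - sg (ε * ε') / 2 = sg ε' * lam l₂ := by
    rw [hl₂, sg_mul_lam_sub, sg_mul, mul_comm (sg ε)]
  have e7 : (sg ε' * sg B * ρ - sg (ε * A * ε' * B) / 2 : ℂ) = sg ε' * sg B * ρ₂ := by
    rw [hρ₂]; simp only [sg_mul]; push_cast; ring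
  rw [e1, e2, e3, e4, e5, e6, e7] at H
  have hcond : (ε * ε' = -1 ∧ ε * A * ε' * B = -1 ∧ t = -s) ↔ (ε' = -ε ∧ B = A ∧ t = -s) := by
    have : ∀ ε ε' A B : ℤˣ, (ε * ε' = -1 ∧ ε * A * ε' * B = -1) ↔ (ε' = -ε ∧ B = A) := by decide
    rw [← and_assoc, this, and_assoc]
  simp only [hcond] at H
  exact H

/-! ### Tensor operators from their components -/

/-- The linear map on `F^A ⊗ V` with components `t s`. -/
def tensorOf {A : ℤˣ} {l l' : ℤ} {ρ ρ' : ℂ} (t : ℤˣ → (V l ρ →ₗ[ℂ] V l' ρ')) :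
    F A ⊗[ℂ] V l ρ →ₗ[ℂ] V l' ρ' :=
  TensorProduct.lift
    ((LinearMap.proj (R := ℂ) (φ := fun _ : Fin 2 => ℂ) 0).smulRight (t 1) +
      (LinearMap.proj (R := ℂ) (φ := fun _ : Fin 2 => ℂ) 1).smulRight (t (-1)))

theorem tensorOf_tmul {A : ℤˣ} {l l' : ℤ} {ρ ρ' : ℂ} (t : ℤˣ → (V l ρ →ₗ[ℂ] V l' ρ')) (f : F A)
    (v : V l ρ) : tensorOf t (f ⊗ₜ[ℂ] v) = f 0 • t 1 v + f 1 • t (-1) v := rfl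

theorem comp_tensorOf {A : ℤˣ} {l l' : ℤ} {ρ ρ' : ℂ} (t : ℤˣ → (V l ρ →ₗ[ℂ] V l' ρ')) (s : ℤˣ) :
    comp (tensorOf (A := A) t) s = t s := by
  refine LinearMap.ext fun v => ?_
  rw [comp, LinearMap.comp_apply, TensorProduct.mk_apply, tensorOf_tmul]
  induction s using units_cases
  · simp [spinor]
  · simp [spinor, show (-1 : ℤˣ) ≠ 1 by decide]

theorem act_K_eq (l : ℤ) (ρ : ℂ) (s : ℤˣ) (v : V l ρ) :
    act l ρ (.K s) v = (-(sg s) : ℂ) •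
      (act l ρ (.J s) (act l ρ .K0 v) - act l ρ .K0 (act l ρ (.J s) v)) := by
  rw [← proj_emb l ρ (act l ρ (.K s) v), emb_act, fockAct, fK_eq_commutator, act_eq l ρ (.J s),
    emb_act, act_eq l ρ .K0, emb_act, ← map_sub, ← map_smul]
  rfl

theorem det_of_mem_SU2 (k : Matrix.specialUnitaryGroup (Fin 2) ℂ) :
    (k : Matrix (Fin 2) (Fin 2) ℂ) 0 0 * (k : Matrix (Fin 2) (Fin 2) ℂ) 1 1 -
      (k : Matrix (Fin 2) (Fin 2) ℂ) 0 1 * (k : Matrix (Fin 2) (Fin 2) ℂ) 1 0 = 1 := by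
  rw [← Matrix.det_fin_two]
  exact (Matrix.mem_specialUnitaryGroup_iff.1 k.2).2

theorem isTensorOperator_tensorOf {A : ℤˣ} {l l' : ℤ} {ρ ρ' : ℂ}
    {t : ℤˣ → (V l ρ →ₗ[ℂ] V l' ρ')}
    (hJ0 : ∀ s v, act l' ρ' .J0 (t s v) = t s (act l ρ .J0 v) + (sg s / 2 : ℂ) • t s v)
    (hJ : ∀ r s v, act l' ρ' (.J r) (t s v) =
      t s (act l ρ (.J r) v) + if r = -s then t r v else 0)
    (hK0 : ∀ s v, act l' ρ' .K0 (t s v) =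
      t s (act l ρ .K0 v) + (Complex.I * sg A * (sg s / 2) : ℂ) • t s v)
    (hk : ∀ (k : Matrix.specialUnitaryGroup (Fin 2) ℂ) s v, actSU2 l' ρ' k (t s v) =
      (k : Matrix (Fin 2) (Fin 2) ℂ) 0 (idx s) • t 1 (actSU2 l ρ k v) +
        (k : Matrix (Fin 2) (Fin 2) ℂ) 1 (idx s) • t (-1) (actSU2 l ρ k v)) :
    IsTensorOperator A (tensorOf (A := A) t) := by
  have hne : (-1 : ℤˣ) ≠ 1 := by decide
  have hne' : (1 : ℤˣ) ≠ -1 := by decide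
  have hK : ∀ r s v, act l' ρ' (.K r) (t s v) =
      t s (act l ρ (.K r) v) + if r = -s then (Complex.I * sg A : ℂ) • t r v else 0 := by
    intro r s v
    rw [act_K_eq, act_K_eq, hK0, map_add, map_smul, hJ, hJ, map_add, hK0]
    split_ifs with h
    · rw [hK0, h]
      simp only [map_smul, map_sub, sg_neg]
      have := sg_sq s
      push_cast
      match_scalars <;> grind
    · simp only [map_smul, map_sub, map_zero]
      module
  constructor
  · intro X
    refine TensorProduct.ext' fun f v => ?_
    simp only [LinearMap.comp_apply, LinearMap.add_apply, TensorProduct.map_tmul, map_add,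
      LinearMap.id_apply, tensorOf_tmul, map_smul]
    cases X with
    | J0 =>
      rw [hJ0, hJ0]
      simp [actF, spinJ0, dotProduct, Fin.sum_univ_two]
      module
    | J r =>
      rw [hJ, hJ]
      induction r using units_cases <;>
        simp [actF, spinJ, dotProduct, Fin.sum_univ_two, hne, hne'] <;> module
    | K0 =>
      rw [hK0, hK0]
      simp [actF, spinJ0, dotProduct, Fin.sum_univ_two]
      module
    | K r =>
      rw [hK, hK]
      induction r using units_cases <;>
        simp [actF, spinJ, dotProduct, Fin.sum_univ_two, hne, hne'] <;> module
  · intro k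
    refine TensorProduct.ext' fun f v => ?_
    simp only [LinearMap.comp_apply, TensorProduct.map_tmul, tensorOf_tmul, map_add, map_smul, hk]
    simp [actFSU2, Matrix.mulVec, dotProduct, Fin.sum_univ_two, idx, hne]
    module

theorem intertwines_fockDbl {ε A : ℤˣ} {l l' : ℤ} {ρ ρ' : ℂ} {n : ℤ} (hn : |l| ≤ n)
    (hp : Even (n - l)) (hl : l' = l - ε) (hρ : ρ' = ρ - sg ε * sg A / 2) :
    Intertwines (Complex.I * sg A) (upS (Complex.I * sg A) (sg ε * lam l) (sg ε * sg A * ρ))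
      (dnS (sg ε * lam l) (sg ε * sg A * ρ)) (upK l ρ) (midK l ρ) (dnK l ρ)
      (upK l' ρ') (midK l' ρ') (dnK l' ρ') n :=
  have hn0 : 0 ≤ n := (abs_nonneg l).trans hn
  ⟨intertwines_up hn0 hl hρ, intertwines_down hn0 hl hρ, intertwines_midUp hn hl hρ rfl rfl,
    intertwines_midDown hn hp hl hρ rfl rfl⟩

theorem isTensorOperator_dblOp (c : ℂ) {ε A : ℤˣ} {l l' : ℤ} {ρ ρ' : ℂ} (hl : l' = l - ε)
    (hρ : ρ' = ρ - sg ε * sg A / 2) :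
    IsTensorOperator A (tensorOf (A := A) (dblOp c A ε l ρ l' ρ')) := by
  refine isTensorOperator_tensorOf (fun s v => ?_) (fun r s v => ?_) (fun s v => ?_)
    fun k s v => ?_
  · simp only [dblOp_apply, map_smul, act_proj, emb_act, fockAct, fockDbl, fJ0_dbl, map_add,
      smul_add]
    module
  · simp only [dblOp_apply, map_smul, act_proj, emb_act, fockAct, fockDbl, fJ_dbl, map_add,
      smul_add]
    split_ifs <;> simp
  · simp only [dblOp_apply, map_smul, act_proj, emb_act, fockAct]
    have : fK0 (upK l' ρ') (midK l' ρ') (dnK l' ρ') (fockDbl A ε l ρ s (emb l ρ v)) =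
        fockDbl A ε l ρ s (fK0 (upK l ρ) (midK l ρ) (dnK l ρ) (emb l ρ v)) +
          (Complex.I * sg A * (sg s / 2) : ℂ) • fockDbl A ε l ρ s (emb l ρ v) :=
      emb_ext (f := fK0 (upK l' ρ') (midK l' ρ') (dnK l' ρ') ∘ₗ fockDbl A ε l ρ s)
        (g := fockDbl A ε l ρ s ∘ₗ fK0 (upK l ρ) (midK l ρ) (dnK l ρ) +
          (Complex.I * sg A * (sg s / 2) : ℂ) • fockDbl A ε l ρ s)
        (fun p q hn hp => (intertwines_fockDbl hn hp hl hρ).fK0_dbl rfl s) v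
    rw [this, map_add, map_smul]
    module
  · simp only [dblOp_apply, map_smul, actSU2_proj, emb_actSU2, fockDbl,
      fockSU2_dbl (det_of_mem_SU2 k), map_add]
    module

/-! ### Products of two operators -/

theorem emb_dblOp {A ε : ℤˣ} {l l' : ℤ} {ρ ρ' : ℂ} (c : ℂ) (h' : InfDim l' ρ') (hl : l' = l - ε)
    (s : ℤˣ) (v : V l ρ) :
    emb l' ρ' (dblOp c A ε l ρ l' ρ' s v) = c • fockDbl A ε l ρ s (emb l ρ v) := by
  rw [dblOp_apply, map_smul, emb_proj_fockDbl h' hl]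

theorem coords_congr {l l' : ℤ} {ρ ρ' : ℂ} (hl : l = l') (hρ : ρ = ρ') (w : Fock) :
    coords l ρ (proj l ρ w) = coords l' ρ' (proj l' ρ' w) := by
  subst hl hρ
  rfl

theorem coords_dblOp_commutator {A B ε ε' : ℤˣ} {l l₁ l₂ l₃ l₄ : ℤ} {ρ ρ₁ ρ₂ ρ₃ ρ₄ : ℂ} (c c' : ℂ)
    (h₁ : InfDim l₁ ρ₁) (h₂ : InfDim l₂ ρ₂)
    (hl₁ : l₁ = l - ε') (hρ₁ : ρ₁ = ρ - sg ε' * sg B / 2)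
    (hl₂ : l₂ = l - ε) (hρ₂ : ρ₂ = ρ - sg ε * sg A / 2)
    (hl₃ : l₃ = l₁ - ε) (hρ₃ : ρ₃ = ρ₁ - sg ε * sg A / 2)
    (hl₄ : l₄ = l₂ - ε') (hρ₄ : ρ₄ = ρ₂ - sg ε' * sg B / 2) (s t : ℤˣ) (v : V l ρ) :
    coords l₃ ρ₃ (dblOp c A ε l₁ ρ₁ l₃ ρ₃ s (dblOp c' B ε' l ρ l₁ ρ₁ t v)) -
        coords l₄ ρ₄ (dblOp c' B ε' l₂ ρ₂ l₄ ρ₄ t (dblOp c A ε l ρ l₂ ρ₂ s v)) =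
      (if ε' = -ε ∧ B = A ∧ t = -s then c * c' * (sg s * (Complex.I * sg A)) else 0) •
        coords l ρ v := by
  have h43 : l₄ = l₃ := by rw [hl₄, hl₃, hl₁, hl₂]; ring
  have h43' : ρ₄ = ρ₃ := by rw [hρ₄, hρ₃, hρ₁, hρ₂]; ring
  rw [dblOp_apply, dblOp_apply c' B ε' l₂, emb_dblOp c' h₁ hl₁, emb_dblOp c h₂ hl₂]
  have H := congrArg (fun w => (c * c') • coords l₃ ρ₃ (proj l₃ ρ₃ w))
    (fockDbl_commutator hl₁ hρ₁ hl₂ hρ₂ s t v)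
  simp only [map_smul, map_sub, smul_sub, smul_smul] at H ⊢
  rw [coords_congr h43 h43', mul_comm c' c, H]
  split_ifs with h
  · obtain ⟨rfl, rfl, rfl⟩ := h
    have e1 : l₃ = l := by rw [hl₃, hl₁]; push_cast; ring
    have e2 : ρ₃ = ρ := by rw [hρ₃, hρ₁]; simp; ring
    rw [coords_congr e1 e2, proj_emb]
  · simp

theorem fockDbl_factors {A : ℤˣ} {l l₁ : ℤ} {ρ ρ₁ : ℂ} {n : ℤ} (hn : |l| ≤ n)
    (hl₁ : l₁ = l - (-1 : ℤˣ)) (hρ₁ : ρ₁ = ρ - sg (-1) * sg A / 2) :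
    Factors (Complex.I * sg A) (-(Complex.I * sg A))
      (upS (Complex.I * sg A) (sg (-1) * lam l) (sg (-1) * sg A * ρ))
      (dnS (sg (-1) * lam l) (sg (-1) * sg A * ρ))
      (upS (Complex.I * sg A) (sg 1 * lam l₁) (sg 1 * sg A * ρ₁))
      (dnS (sg 1 * lam l₁) (sg 1 * sg A * ρ₁)) (upK l ρ) (midK l ρ) (dnK l ρ) n := by
  have hA := sg_sq A
  have H := factors (ε := 1) (A := A) (ρ := ρ) hn rfl rfl rfl
  have e1 : sg (-1) * lam l = -(sg 1 * lam l) := by simp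
  have e2 : (sg (-1) * sg A * ρ : ℂ) = -(sg 1 * sg A * ρ) := by simp
  have e3 : sg 1 * lam l₁ = sg 1 * lam l + 1 / 2 := by
    rw [hl₁, sg_mul_lam_sub]; simp; ring
  have e4 : (sg 1 * sg A * ρ₁ : ℂ) = sg 1 * sg A * ρ + 1 / 2 := by
    rw [hρ₁]
    simp only [sg_neg, sg_one]
    push_cast
    linear_combination hA / 2
  rw [e1, e2, e3, e4]
  exact H

theorem coords_dblOp_dblOp {A s t : ℤˣ} {l l₁ l₂ : ℤ} {ρ ρ₁ ρ₂ : ℂ} (c : ℂ) (h₁ : InfDim l₁ ρ₁)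
    (hl₁ : l₁ = l - (-1 : ℤˣ)) (hρ₁ : ρ₁ = ρ - sg (-1) * sg A / 2)
    (hl₂ : l₂ = l₁ - (1 : ℤˣ)) (hρ₂ : ρ₂ = ρ₁ - sg 1 * sg A / 2) (v : V l ρ) :
    coords l₂ ρ₂ (dblOp 1 A 1 l₁ ρ₁ l₂ ρ₂ s (dblOp c A (-1) l ρ l₁ ρ₁ t v)) =
      c • coords l ρ (proj l ρ (fockDbl A 1 l₁ ρ₁ s (fockDbl A (-1) l ρ t (emb l ρ v)))) := by
  have e1 : l₂ = l := by rw [hl₂, hl₁]; push_cast; ring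
  have e2 : ρ₂ = ρ := by rw [hρ₂, hρ₁]; simp; ring
  rw [dblOp_apply, emb_dblOp _ h₁ hl₁, map_smul, map_smul, one_smul, map_smul, map_smul,
    coords_congr e1 e2]

theorem coords_actM {A s : ℤˣ} {l l₁ l₂ : ℤ} {ρ ρ₁ ρ₂ : ℂ} (h₁ : InfDim l₁ ρ₁)
    (hl₁ : l₁ = l - (-1 : ℤˣ)) (hρ₁ : ρ₁ = ρ - sg (-1) * sg A / 2)
    (hl₂ : l₂ = l₁ - (1 : ℤˣ)) (hρ₂ : ρ₂ = ρ₁ - sg 1 * sg A / 2) (v : V l ρ) :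
    coords l ρ (actM l ρ A s v) = (sg s : ℂ) • coords l₂ ρ₂ (dblOp 1 A 1 l₁ ρ₁ l₂ ρ₂ s
      (dblOp (-(Complex.I * sg A)) A (-1) l ρ l₁ ρ₁ s v)) := by
  have H := emb_ext (ρ := ρ)
    (f := (1 / 2 : ℂ) • (fJ s - (Complex.I * sg A) • fK (upK l ρ) (midK l ρ) (dnK l ρ) s))
    (g := (sg s * -(Complex.I * sg A) : ℂ) • fockDbl A 1 l₁ ρ₁ s ∘ₗ fockDbl A (-1) l ρ s)
    (fun p q hn _ => (fockDbl_factors hn hl₁ hρ₁).fK rfl s) v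
  rw [coords_dblOp_dblOp _ h₁ hl₁ hρ₁ hl₂ hρ₂, smul_smul, ← map_smul, ← map_smul]
  refine congrArg _ ?_
  refine Eq.trans ?_ (congrArg (proj l ρ) H)
  simp only [actM, LinearMap.smul_apply, LinearMap.sub_apply, act_eq, map_smul, map_sub, fockAct]

theorem coords_actM0 {A : ℤˣ} {l l₁ l₂ : ℤ} {ρ ρ₁ ρ₂ : ℂ} (h₁ : InfDim l₁ ρ₁)
    (hl₁ : l₁ = l - (-1 : ℤˣ)) (hρ₁ : ρ₁ = ρ - sg (-1) * sg A / 2)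
    (hl₂ : l₂ = l₁ - (1 : ℤˣ)) (hρ₂ : ρ₂ = ρ₁ - sg 1 * sg A / 2) (v : V l ρ) :
    coords l ρ (actM0 l ρ A v) = (-(1 / 2) : ℂ) •
      (coords l₂ ρ₂ (dblOp 1 A 1 l₁ ρ₁ l₂ ρ₂ (-1)
          (dblOp (-(Complex.I * sg A)) A (-1) l ρ l₁ ρ₁ 1 v)) +
        coords l₂ ρ₂ (dblOp 1 A 1 l₁ ρ₁ l₂ ρ₂ 1
          (dblOp (-(Complex.I * sg A)) A (-1) l ρ l₁ ρ₁ (-1) v))) := by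
  have H := emb_ext (ρ := ρ)
    (f := (1 / 2 : ℂ) • (fJ0 - (Complex.I * sg A) • fK0 (upK l ρ) (midK l ρ) (dnK l ρ)))
    (g := (-(1 / 2) * -(Complex.I * sg A) : ℂ) •
      (fockDbl A 1 l₁ ρ₁ (-1) ∘ₗ fockDbl A (-1) l ρ 1 +
        fockDbl A 1 l₁ ρ₁ 1 ∘ₗ fockDbl A (-1) l ρ (-1)))
    (fun p q hn _ => (fockDbl_factors hn hl₁ hρ₁).fK0 rfl) v
  rw [coords_dblOp_dblOp _ h₁ hl₁ hρ₁ hl₂ hρ₂, coords_dblOp_dblOp _ h₁ hl₁ hρ₁ hl₂ hρ₂, ← smul_add, smul_smul, ← map_add, ← map_add, ← map_smul, ← map_smul]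
  refine congrArg _ ?_
  refine Eq.trans ?_ (congrArg (proj l ρ) H)
  simp only [actM0, LinearMap.smul_apply, LinearMap.sub_apply, act_eq, map_smul, map_sub, fockAct]

/-! ### Matrix elements -/

theorem bra_ket {l : ℤ} {ρ : ℂ} {j m j' m' : ℝ} (hj' : j' ∈ spins l ρ) (hm' : m' ∈ weights j') :
    bra l ρ j' m' (ket l ρ j m) = if j' = j ∧ m' = m then 1 else 0 := by
  classical
  rw [bra, dif_pos ⟨hj', hm'⟩, Finsupp.lapply_apply, ket]
  split_ifs with h1 h2 h2
  · obtain ⟨rfl, rfl⟩ := h2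
    simp
  · rw [Finsupp.single_apply, if_neg]
    simp only [Subtype.mk.injEq, Prod.mk.injEq]
    exact fun h => h2 ⟨h.1.symm, h.2.symm⟩
  · obtain ⟨rfl, rfl⟩ := h2
    exact absurd ⟨hj', hm'⟩ h1
  · rfl

theorem bra_dblOp (c : ℂ) (A ε : ℤˣ) {l l' : ℤ} {ρ ρ' : ℂ} (s : ℤˣ) {j m j' m' : ℝ}
    (hj : j ∈ spins l ρ) (hm : m ∈ weights j) (hj' : j' ∈ spins l' ρ') (hm' : m' ∈ weights j') :
    bra l' ρ' j' m' (dblOp c A ε l ρ l' ρ' s (ket l ρ j m)) =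
      if m' = m + sg s / 2 then
        if j' = j - 1 / 2 then
          c * sg s * ((√(j - sg s * m) : ℂ) * (√(j + sg ε * lam l) : ℂ) *
            Complex.sqrt (j + sg ε * sg A * ρ)) / ((√(2 * j) : ℂ) * (√(2 * j + 1) : ℂ))
        else if j' = j + 1 / 2 then
          c * (Complex.I * sg A) * ((√(j + sg s * m + 1) : ℂ) * (√(j - sg ε * lam l + 1) : ℂ) *
            Complex.sqrt (j - sg ε * sg A * ρ + 1)) / ((√(2 * j + 1) : ℂ) * (√(2 * j + 2) : ℂ))
        else 0
      else 0 := by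
  rw [dblOp_apply, emb_ket hj hm]
  obtain ⟨p, q, hjp, -⟩ := exists_occupation hj hm
  have hn : 2 * j = ((p + q : ℤ) : ℝ) := by rw [hjp]; push_cast; ring
  generalize (p + q : ℤ) = n at hn
  have hj2 : (n : ℝ) / 2 = j := by linarith
  have hj2c : (n : ℂ) / 2 = j := by rw [← hj2]; push_cast; rfl
  have h := hasDeg_state (m := m) hn
  rw [fockDbl, dbl_apply s h, cre_state, ann_state, upS, dnS, hj2, hj2c, ← hn]
  have e : m - sg (-s) / 2 = m + sg s / 2 := by rw [sg_neg]; ring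
  have e' : j + sg (-s) * m = j - sg s * m := by rw [sg_neg]; ring
  simp only [map_add, map_smul, proj_state, bra_ket hj' hm', smul_eq_mul, e, e']
  by_cases h1 : m' = m + sg s / 2
  · by_cases h2 : j' = j - 1 / 2
    · simp only [h1, h2, if_true, and_true]
      rw [if_neg (by intro h; linarith)]
      ring
    · by_cases h3 : j' = j + 1 / 2
      · simp only [h1, h3, if_true, and_true]
        rw [if_neg (by intro h; linarith), if_neg (by intro h; linarith)]
        ring
      · simp only [h2, h3, false_and, if_false, mul_zero, add_zero, ite_self]
  · simp only [h1, and_false, if_false, mul_zero, add_zero]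

end

end LorentzJS

open LorentzJS
open scoped TensorProduct

theorem mainTheorem7 :
    ∃ (T : ∀ (A : ℤˣ) (l : ℤ) (ρ : ℂ), F A ⊗[ℂ] V l ρ →ₗ[ℂ] V (l - 1) (ρ - sg A / 2))
      (Tt : ∀ (A : ℤˣ) (l : ℤ) (ρ : ℂ), F A ⊗[ℂ] V l ρ →ₗ[ℂ] V (l + 1) (ρ + sg A / 2)),
      -- they are tensor operators on every infinite-dimensional module
      (∀ (A : ℤˣ) (l : ℤ) (ρ : ℂ), InfDim l ρ →
        IsTensorOperator A (T A l ρ) ∧ IsTensorOperator A (Tt A l ρ)) ∧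
      -- matrix elements
      (∀ (A : ℤˣ) (l : ℤ) (ρ : ℂ), InfDim l ρ →
        ∀ s : ℤˣ, ∀ j ∈ spins l ρ, ∀ m ∈ weights j,
          (∀ j' ∈ spins (l - 1) (ρ - sg A / 2), ∀ m' ∈ weights j',
            bra (l - 1) (ρ - sg A / 2) j' m' (comp (T A l ρ) s (ket l ρ j m)) =
              elT A l ρ s j m j' m') ∧
          (∀ j' ∈ spins (l + 1) (ρ + sg A / 2), ∀ m' ∈ weights j',
            bra (l + 1) (ρ + sg A / 2) j' m' (comp (Tt A l ρ) s (ket l ρ j m)) =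
              elTt A l ρ s j m j' m')) ∧
      -- for ρ² ≠ λ² the target modules are infinite-dimensional and the generators factor
      (∀ (l : ℤ) (ρ : ℂ), InfDim l ρ → ρ ^ 2 ≠ (lam l : ℂ) ^ 2 → ∀ A : ℤˣ,
        InfDim (l - 1) (ρ - sg A / 2) ∧ InfDim (l + 1) (ρ + sg A / 2) ∧
        ∀ v : V l ρ,
          coords l ρ (actM0 l ρ A v) =
            (-(1 / 2) : ℂ) •
              (coords _ _ (comp (T A _ _) (-1) (comp (Tt A l ρ) 1 v))
                + coords _ _ (comp (T A _ _) 1 (comp (Tt A l ρ) (-1) v))) ∧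
          ∀ s : ℤˣ, coords l ρ (actM l ρ A s v) =
            (sg s : ℂ) • coords _ _ (comp (T A _ _) s (comp (Tt A l ρ) s v))) ∧
      -- commutators of a T with a T̃
      (∀ (l : ℤ) (ρ : ℂ) (A B : ℤˣ), InfDim l ρ →
        InfDim (l - 1) (ρ - sg A / 2) → InfDim (l + 1) (ρ + sg B / 2) →
        ∀ v : V l ρ,
          coords _ _ (comp (T A _ _) 1 (comp (Tt B l ρ) (-1) v))
              - coords _ _ (comp (Tt B _ _) (-1) (comp (T A l ρ) 1 v)) =
            (if A = B then (1 : ℂ) else 0) • coords l ρ v ∧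
          coords _ _ (comp (Tt B _ _) 1 (comp (T A l ρ) (-1) v))
              - coords _ _ (comp (T A _ _) (-1) (comp (Tt B l ρ) 1 v)) =
            (if A = B then (1 : ℂ) else 0) • coords l ρ v ∧
          ∀ s : ℤˣ, coords _ _ (comp (T A _ _) s (comp (Tt B l ρ) s v))
              - coords _ _ (comp (Tt B _ _) s (comp (T A l ρ) s v)) = 0) ∧
      -- commutators of two T's
      (∀ (l : ℤ) (ρ : ℂ) (A B : ℤˣ), InfDim l ρ →
        InfDim (l - 1) (ρ - sg A / 2) → InfDim (l - 1) (ρ - sg B / 2) →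
        ∀ (s t : ℤˣ) (v : V l ρ),
          coords _ _ (comp (T A _ _) s (comp (T B l ρ) t v))
              - coords _ _ (comp (T B _ _) t (comp (T A l ρ) s v)) = 0) ∧
      -- commutators of two T̃'s
      (∀ (l : ℤ) (ρ : ℂ) (A B : ℤˣ), InfDim l ρ →
        InfDim (l + 1) (ρ + sg A / 2) → InfDim (l + 1) (ρ + sg B / 2) →
        ∀ (s t : ℤˣ) (v : V l ρ),
          coords _ _ (comp (Tt A _ _) s (comp (Tt B l ρ) t v))
              - coords _ _ (comp (Tt B _ _) t (comp (Tt A l ρ) s v)) = 0) := by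
  have hT : ∀ (A : ℤˣ) (ρ : ℂ), ρ - sg A / 2 = ρ - sg 1 * sg A / 2 := by simp
  have hTt : ∀ (A : ℤˣ) (ρ : ℂ), ρ + sg A / 2 = ρ - sg (-1) * sg A / 2 := fun A ρ => by
    simp; ring
  have lT : ∀ l : ℤ, l - 1 = l - (1 : ℤˣ) := by simp
  have lTt : ∀ l : ℤ, l + 1 = l - (-1 : ℤˣ) := by simp
  have hne : (1 : ℤˣ) ≠ -1 := by decide
  have hIA : ∀ A : ℤˣ, -(Complex.I * sg A) * (Complex.I * sg A) = 1 := fun A => by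
    linear_combination -I_mul_sg_sq A
  refine ⟨fun A l ρ => tensorOf (dblOp 1 A 1 l ρ _ _),
    fun A l ρ => tensorOf (dblOp (-(Complex.I * sg A)) A (-1) l ρ _ _), ?_, ?_, ?_, ?_, ?_, ?_⟩
  · exact fun A l ρ _ => ⟨isTensorOperator_dblOp 1 (lT l) (hT A ρ),
      isTensorOperator_dblOp _ (lTt l) (hTt A ρ)⟩
  · intro A l ρ _ s j hj m hm
    refine ⟨fun j' hj' m' hm' => ?_, fun j' hj' m' hm' => ?_⟩
    · rw [comp_tensorOf, bra_dblOp 1 A 1 s hj hm hj' hm', elT]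
      simp only [sg_one, Complex.ofReal_one, one_mul]
    · rw [comp_tensorOf, bra_dblOp _ A (-1) s hj hm hj' hm', elTt]
      simp only [sg_neg, sg_one, Complex.ofReal_neg, Complex.ofReal_one, hIA, one_mul,
        sub_neg_eq_add, ← sub_eq_add_neg, neg_mul]
      congr 2
      ring
  · intro l ρ h hne A
    have h1 := h.shift hne (lT l) (hT A ρ)
    have h2 := h.shift hne (lTt l) (hTt A ρ)
    refine ⟨h1, h2, fun v => ⟨?_, fun s => ?_⟩⟩
    · simp only [comp_tensorOf]
      exact coords_actM0 h2 (lTt _) (hTt _ _) (lT _) (hT _ _) v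
    · simp only [comp_tensorOf]
      exact coords_actM h2 (lTt _) (hTt _ _) (lT _) (hT _ _) v
  · intro l ρ A B _ h1 h2 v
    simp only [comp_tensorOf]
    have H := fun s t => coords_dblOp_commutator (A := A) (B := B) (l := l) (ρ := ρ)
      1 (-(Complex.I * sg B)) h2 h1 (lTt _)
      (hTt _ _) (lT _) (hT _ _) (lT _) (hT _ _) (lTt _) (hTt _ _) s t v
    refine ⟨?_, ?_, fun s => ?_⟩
    · rw [H]
      by_cases hAB : A = B
      · subst hAB; simp [hIA]
      · simp [hAB, Ne.symm hAB]
    · rw [← neg_sub, H]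
      by_cases hAB : A = B
      · subst hAB; simp [hIA]
      · simp [hAB, Ne.symm hAB]
    · rw [H, if_neg, zero_smul]
      rintro ⟨-, -, h⟩
      revert h
      induction s using units_cases <;> decide
  · intro l ρ A B _ h1 h2 s t v
    simp only [comp_tensorOf]
    rw [coords_dblOp_commutator 1 1 h2 h1 (lT _) (hT _ _) (lT _) (hT _ _) (lT _) (hT _ _)
      (lT _) (hT _ _) s t v, if_neg (fun h => hne h.1), zero_smul]
  · intro l ρ A B _ h1 h2 s t v
    simp only [comp_tensorOf]
    rw [coords_dblOp_commutator _ _ h2 h1 (lTt _) (hTt _ _) (lTt _) (hTt _ _) (lTt _) (hTt _ _)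
      (lTt _) (hTt _ _) s t v, if_neg (fun h => hne h.1.symm), zero_smul]
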